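/- Let $k\ge 0$. A $k$-graph is a nonempty countable small category $\Lambda$ with a functor $d:\Lambda\to\mathbb N^k$ such that whenever $d(\lambda)=m+n$ there are unique $\mu,\nu\in\Lambda$ with $d(\mu)=m$, $d(\nu)=n$ and $\lambda=\mu\nu$; a morphism of $k$-graphs is a degree-preserving functor. Let $Q_r(\Lambda)$ be the set of $\lambda\in\Lambda$ with $d(\lambda)\le(1,\dots,1)$ and $|d(\lambda)|=r$, and let $C_r(\Lambda)=\mathbb Z Q_r(\Lambda)$. If $\lambda\in Q_r(\Lambda)$ has degree $e_{i_1}+\dots+e_{i_r}$ with $i_1<\dots<i_r$, its faces $F_j^0(\lambda),F_j^1(\lambda)\in Q_{r-1}(\Lambda)$ are the unique elements with $F_j^0(\lambda)\beta=\lambda=\alpha F_j^1(\lambda)$ for some $\alpha,\beta$ of degree $e_{i_j}$. With $\partial_r(\lambda)=\sum_{\ell=0}^1\sum_{j=1}^r(-1)^{j+\ell}F_j^\ell(\lambda)$, $C_*(\Lambda)$ is a chain complex, and $H_r(\Lambda)$ denotes its $r$-th homology group. For a $k_1$-graph $\Lambda_1$ and a $k_2$-graph $\Lambda_2$, the product category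 $\Lambda_1\times\Lambda_2$ with degree $(d_1,d_2)\in\mathbb N^{k_1}\times\mathbb N^{k_2}=\mathbb N^{k_1+k_2}$ is a $(k_1+k_2)$-graph. **Theorem.** For all $k_1,k_2,r\ge 0$, every $k_1$-graph $\Lambda_1$ and every $k_2$-graph $\Lambda_2$ there is a split exact sequence of abelian groups $$0\to\bigoplus_{r_1+r_2=r}H_{r_1}(\Lambda_1)\otimes H_{r_2}(\Lambda_2)\xrightarrow{\ \alpha\ }H_r(\Lambda_1\times\Lambda_2)\xrightarrow{\ \beta\ }\bigoplus_{r_1+r_2=r-1}\operatorname{Tor}\big(H_{r_1}(\Lambda_1),H_{r_2}(\Lambda_2)\big)\to 0,$$ in which $r_1,r_2\ge 0$ (so the last sum is $0$ for $r=0$) and $\operatorname{Tor}=\operatorname{Tor}_1^{\mathbb Z}$. Here $\alpha$ is the homology product: $\alpha([x_1]\otimes[x_2])=[x_1\times x_2]$ for cycles $x_i\in C_{r_i}(\Lambda_i)$, where $\times$ is the bilinear map with $(\lambda_1,\lambda_2)\mapsto(\lambda_1,\lambda_2)\in Q_{r_1+r_2}(\Lambda_1\times\Lambda_2)$ for $\lambda_i\in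 Q_{r_i}(\Lambda_i)$. The homomorphisms $\alpha$ and $\beta$ are natural with respect to the maps induced by $k_1$-graph morphisms in $\Lambda_1$ and $k_2$-graph morphisms in $\Lambda_2$. The splitting is not natural: for some $k_1,k_2,r$ there is no family of right inverses $\sigma_{\Lambda_1,\Lambda_2}$ of $\beta$ that is natural in $(\Lambda_1,\Lambda_2)$. -/

import Mathlib

open CategoryTheory MonoidalCategory Limits

attribute [local instance 2000] CategoryStruct.toQuiver

/-- A `k`-graph: a nonempty countable small category together with a degree functor to `ℕ^k`
satisfying the factorisation property. In the categorical notation of Mathlib the product `μν` of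
two paths with `s(μ) = r(ν)` is `ν ≫ μ`. -/
structure KGraph (k : ℕ) : Type 1 where
  /-- The vertices. -/
  Obj : Type
  [cat : SmallCategory Obj]
  nonempty : Nonempty Obj
  countable : Countable (Σ x y : Obj, (x ⟶ y))
  /-- The degree functor. -/
  deg : ∀ {x y : Obj}, (x ⟶ y) → (Fin k → ℕ)
  deg_id : ∀ x : Obj, deg (𝟙 x) = 0
  deg_comp : ∀ {x y z : Obj} (f : x ⟶ y) (g : y ⟶ z), deg (f ≫ g) = deg f + deg g
  factorisation : ∀ {x y : Obj} (f : x ⟶ y) (m n : Fin k → ℕ), deg f = m + n →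
    ∃! p : Σ z : Obj, (z ⟶ y) × (x ⟶ z),
      deg p.2.1 = m ∧ deg p.2.2 = n ∧ p.2.2 ≫ p.2.1 = f

attribute [instance] KGraph.cat

namespace KGraph

variable {k k₁ k₂ : ℕ}

/-! ### The category of `k`-graphs -/

/-- A `k`-graph morphism: a degree-preserving functor. -/
@[ext]
structure Hom (Λ Γ : KGraph k) : Type where
  /-- The underlying functor. -/
  functor : Λ.Obj ⥤ Γ.Obj
  deg_map : ∀ {x y : Λ.Obj} (f : x ⟶ y), Γ.deg (functor.map f) = Λ.deg f

instance : Category (KGraph k) where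
  Hom := Hom
  id Λ := ⟨𝟭 Λ.Obj, fun _ => rfl⟩
  comp φ ψ := ⟨φ.functor ⋙ ψ.functor, fun f => by
    simp only [Functor.comp_map, ψ.deg_map, φ.deg_map]⟩

/-! ### Paths and segments of paths -/

/-- A path of `Λ`: a morphism of the category, with its source and its range. -/
structure Path (Λ : KGraph k) : Type where
  src : Λ.Obj
  tgt : Λ.Obj
  hom : src ⟶ tgt

/-- The degree of a path. -/
def Path.degree {Λ : KGraph k} (p : Λ.Path) : Fin k → ℕ := Λ.deg p.hom

/-- The image of a path under a `k`-graph morphism. -/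
def Hom.mapPath {Λ Γ : KGraph k} (φ : Hom Λ Γ) (p : Λ.Path) : Γ.Path :=
  ⟨φ.functor.obj p.src, φ.functor.obj p.tgt, φ.functor.map p.hom⟩

/-- `IsSegment p q m n` says that `p = α q β` for some paths `α` of degree `m` and `β` of degree
`n`, i.e. that `q = p(m, d(p) - n)`. -/
def IsSegment {Λ : KGraph k} (p q : Λ.Path) (m n : Fin k → ℕ) : Prop :=
  ∃ (α : q.tgt ⟶ p.tgt) (β : p.src ⟶ q.src),
    Λ.deg α = m ∧ Λ.deg β = n ∧ β ≫ q.hom ≫ α = p.hom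

theorem IsSegment.degree_eq {Λ : KGraph k} {p q : Λ.Path} {m n : Fin k → ℕ}
    (h : IsSegment p q m n) : p.degree = m + q.degree + n := by
  obtain ⟨α, β, hα, hβ, h⟩ := h
  rw [Path.degree, Path.degree, ← h, Λ.deg_comp, Λ.deg_comp, hα, hβ]
  abel

theorem IsSegment.trans {Λ : KGraph k} {p q q' : Λ.Path} {m n m' n' : Fin k → ℕ}
    (h : IsSegment p q m n) (h' : IsSegment q q' m' n') :
    IsSegment p q' (m + m') (n + n') := by
  obtain ⟨α, β, hα, hβ, h⟩ := h
  obtain ⟨α', β', hα', hβ', h'⟩ := h'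
  refine ⟨α' ≫ α, β ≫ β', ?_, ?_, ?_⟩
  · rw [Λ.deg_comp, hα, hα', add_comm]
  · rw [Λ.deg_comp, hβ, hβ']
  · rw [← h, ← h']; simp only [Category.assoc]

theorem IsSegment.map {Λ Γ : KGraph k} (φ : Hom Λ Γ) {p q : Λ.Path} {m n : Fin k → ℕ}
    (h : IsSegment p q m n) : IsSegment (φ.mapPath p) (φ.mapPath q) m n := by
  obtain ⟨α, β, hα, hβ, h⟩ := h
  refine ⟨φ.functor.map α, φ.functor.map β, ?_, ?_, ?_⟩
  · exact (φ.deg_map α).trans hα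
  · exact (φ.deg_map β).trans hβ
  · simp only [Hom.mapPath, ← Functor.map_comp, h]

theorem existsUnique_isSegment {Λ : KGraph k} (p : Λ.Path) (m n : Fin k → ℕ)
    (h : m + n ≤ p.degree) : ∃! q : Λ.Path, IsSegment p q m n := by
  obtain ⟨l, hl⟩ := exists_add_of_le h
  have h₁ : Λ.deg p.hom = m + (l + n) := by
    rw [← Path.degree, hl]; abel
  obtain ⟨⟨z, α, γ⟩, ⟨hα, hγ, hc⟩, hu⟩ := Λ.factorisation p.hom m (l + n) h₁
  obtain ⟨⟨w, q, β⟩, ⟨hq, hβ, hc'⟩, hu'⟩ := Λ.factorisation γ l n hγ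
  dsimp only at hα hγ hc hq hβ hc'
  refine ⟨⟨w, z, q⟩, ⟨α, β, hα, hβ, ?_⟩, ?_⟩
  · rw [← Category.assoc, hc', hc]
  · rintro ⟨w', z', q'⟩ hs
    have hd := hs.degree_eq
    obtain ⟨α', β', hα', hβ', hc₁⟩ := hs
    dsimp only at α' β' hα' hβ' hc₁
    have hq' : Λ.deg q' = l := by
      have h₂ : m + n + l = m + n + Λ.deg q' := by
        rw [← hl, hd, Path.degree]; abel
      exact (add_left_cancel h₂).symm
    have e := hu ⟨z', α', β' ≫ q'⟩ ⟨hα', by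
      dsimp only; rw [Λ.deg_comp, hβ', hq', add_comm], by
      dsimp only; rw [Category.assoc, hc₁]⟩
    cases e
    have e' := hu' ⟨w', q', β'⟩ ⟨hq', hβ', rfl⟩
    cases e'
    rfl

/-! ### Cubes and their faces -/

/-- `Λ.Cube r` is the set `Q_r(Λ)` of paths `λ` with `d(λ) ≤ (1, …, 1)` and `|λ| = r`. -/
@[ext]
structure Cube (Λ : KGraph k) (r : ℕ) : Type where
  path : Λ.Path
  le_one : ∀ i, path.degree i ≤ 1
  sum_degree : ∑ i, path.degree i = r

/-- The directions of a cube `λ`: the indices `i_1 < ⋯ < i_r` with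
`d(λ) = e_{i_1} + ⋯ + e_{i_r}`. -/
abbrev Cube.Dir {Λ : KGraph k} {r : ℕ} (c : Λ.Cube r) : Type :=
  {i : Fin k // c.path.degree i = 1}

/-- The position of a direction among the directions of a cube: `j` for `i = i_j`, where
`1 ≤ j ≤ r`. -/
def Cube.pos {Λ : KGraph k} {r : ℕ} (c : Λ.Cube r) (i : c.Dir) : ℕ :=
  (Finset.univ.filter fun i' : Fin k => c.path.degree i' = 1 ∧ i' ≤ i.1).card

/-- `IsFace l i p q` says that `q` is the face of `p` in direction `i` with index `l`: there is an
edge `β` of degree `e_i` with `q β = p` if `l = 0`, and an edge `α` of degree `e_i` with `α q = p`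
if `l = 1`. -/
def IsFace {Λ : KGraph k} (l : Fin 2) (i : Fin k) (p q : Λ.Path) : Prop :=
  IsSegment p q (if l = 1 then Pi.single i 1 else 0) (if l = 0 then Pi.single i 1 else 0)

theorem isFace_zero_iff {Λ : KGraph k} {i : Fin k} {x y : Λ.Obj} (f : x ⟶ y) (q : Λ.Path) :
    IsFace 0 i ⟨x, y, f⟩ q ↔ ∃ (z : Λ.Obj) (μ : z ⟶ y) (β : x ⟶ z),
      q = ⟨z, y, μ⟩ ∧ Λ.deg β = Pi.single i 1 ∧ β ≫ μ = f := by
  constructor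
  · rintro ⟨α, β, hα, hβ, h⟩
    simp only [Fin.isValue, zero_ne_one, if_false, if_true] at hα hβ
    obtain ⟨a, b, μ⟩ := q
    dsimp only at α β hα hβ h
    obtain ⟨p₀, -, hu⟩ := Λ.factorisation α 0 0 (by rw [hα]; rfl)
    have e := (hu ⟨b, α, 𝟙 b⟩ ⟨hα, Λ.deg_id b, Category.id_comp α⟩).trans
      (hu ⟨y, 𝟙 y, α⟩ ⟨Λ.deg_id y, hα, Category.comp_id α⟩).symm
    cases e
    exact ⟨a, μ, β, rfl, hβ, by rw [← h, Category.comp_id]⟩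
  · rintro ⟨z, μ, β, rfl, hβ, h⟩
    exact ⟨𝟙 y, β, by simpa using Λ.deg_id y, by simpa using hβ, by simpa using h⟩

theorem isFace_one_iff {Λ : KGraph k} {i : Fin k} {x y : Λ.Obj} (f : x ⟶ y) (q : Λ.Path) :
    IsFace 1 i ⟨x, y, f⟩ q ↔ ∃ (z : Λ.Obj) (ν : x ⟶ z) (α : z ⟶ y),
      q = ⟨x, z, ν⟩ ∧ Λ.deg α = Pi.single i 1 ∧ ν ≫ α = f := by
  constructor
  · rintro ⟨α, β, hα, hβ, h⟩
    simp only [Fin.isValue, one_ne_zero, if_false, if_true] at hα hβ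
    obtain ⟨a, b, ν⟩ := q
    dsimp only at α β hα hβ h
    obtain ⟨p₀, -, hu⟩ := Λ.factorisation β 0 0 (by rw [hβ]; rfl)
    have e := (hu ⟨x, β, 𝟙 x⟩ ⟨hβ, Λ.deg_id x, Category.id_comp β⟩).trans
      (hu ⟨a, 𝟙 a, β⟩ ⟨Λ.deg_id a, hβ, Category.comp_id β⟩).symm
    cases e
    exact ⟨b, ν, α, rfl, hα, by rw [← h, Category.id_comp]⟩
  · rintro ⟨z, ν, α, rfl, hα, h⟩
    exact ⟨α, 𝟙 x, by simpa using hα, by simpa using Λ.deg_id x, by simpa using h⟩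

theorem IsFace.degree_eq {Λ : KGraph k} {l : Fin 2} {i : Fin k} {p q : Λ.Path}
    (h : IsFace l i p q) : p.degree = q.degree + Pi.single i 1 := by
  have := IsSegment.degree_eq h
  fin_cases l
  · simpa using this
  · simpa [add_comm] using this

theorem existsUnique_isFace {Λ : KGraph k} (l : Fin 2) (i : Fin k) (p : Λ.Path)
    (h : p.degree i = 1) : ∃! q : Λ.Path, IsFace l i p q := by
  refine existsUnique_isSegment p _ _ ?_
  have : (Pi.single i 1 : Fin k → ℕ) ≤ p.degree := by
    intro j
    rcases eq_or_ne j i with rfl | hj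
    · simp [h]
    · simp [hj]
  fin_cases l
  · simpa using this
  · simpa using this

/-- The face `F_j^l(λ)` of a cube `λ`, where `i = i_j`. -/
noncomputable def Cube.face {Λ : KGraph k} {r : ℕ} (c : Λ.Cube (r + 1)) (l : Fin 2) (i : c.Dir) :
    Λ.Cube r where
  path := (existsUnique_isFace l i.1 c.path i.2).choose
  le_one j := by
    have h : IsFace l i.1 c.path _ := (existsUnique_isFace l i.1 c.path i.2).choose_spec.1
    have h₁ := congrFun h.degree_eq j
    have h₂ := c.le_one j
    simp only [Pi.add_apply] at h₁
    omega
  sum_degree := by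
    have h : IsFace l i.1 c.path _ := (existsUnique_isFace l i.1 c.path i.2).choose_spec.1
    have h₁ := c.sum_degree
    rw [h.degree_eq] at h₁
    simpa [Finset.sum_add_distrib] using h₁

theorem Cube.isFace_face {Λ : KGraph k} {r : ℕ} (c : Λ.Cube (r + 1)) (l : Fin 2) (i : c.Dir) :
    IsFace l i.1 c.path (c.face l i).path :=
  (existsUnique_isFace l i.1 c.path i.2).choose_spec.1

theorem Cube.face_eq {Λ : KGraph k} {r : ℕ} (c : Λ.Cube (r + 1)) (l : Fin 2) (i : c.Dir)
    (q : Λ.Cube r) (h : IsFace l i.1 c.path q.path) : c.face l i = q :=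
  Cube.ext ((existsUnique_isFace l i.1 c.path i.2).unique (c.isFace_face l i) h)

/-- The image of a cube under a `k`-graph morphism. -/
def Hom.mapCube {Λ Γ : KGraph k} (φ : Hom Λ Γ) {r : ℕ} (c : Λ.Cube r) : Γ.Cube r where
  path := φ.mapPath c.path
  le_one i := by
    have := c.le_one i
    rwa [Path.degree, ← φ.deg_map] at this
  sum_degree := by
    have := c.sum_degree
    rwa [Path.degree, ← φ.deg_map] at this

/-! ### The chain complex and the homology of a `k`-graph -/

/-- `C_r(Λ) = ℤ Q_r(Λ)`, the free abelian group on the set of `r`-cubes. -/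
abbrev Chain (Λ : KGraph k) (r : ℕ) : Type := Λ.Cube r →₀ ℤ

/-- The boundary `∑_l ∑_j (-1)^(j+l) F_j^l(λ)` of a cube `λ`. -/
noncomputable def Cube.boundary {Λ : KGraph k} {r : ℕ} (c : Λ.Cube (r + 1)) : Λ.Chain r :=
  ∑ l : Fin 2, ∑ i : c.Dir, Finsupp.single (c.face l i) ((-1 : ℤ) ^ (c.pos i + l.1))

/-- The boundary map `∂_{r+1} : C_{r+1}(Λ) → C_r(Λ)`. -/
noncomputable def boundary (Λ : KGraph k) (r : ℕ) : Λ.Chain (r + 1) →ₗ[ℤ] Λ.Chain r :=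
  Finsupp.linearCombination ℤ Cube.boundary

theorem boundary_single (Λ : KGraph k) (r : ℕ) (c : Λ.Cube (r + 1)) (a : ℤ) :
    Λ.boundary r (Finsupp.single c a) = a • c.boundary :=
  Finsupp.linearCombination_single ℤ a c

theorem Cube.face_ne {Λ : KGraph k} {r : ℕ} (c : Λ.Cube (r + 1)) (l : Fin 2) (i : c.Dir)
    (i' : (c.face l i).Dir) : i'.1 ≠ i.1 := by
  intro h
  have h₁ := congrFun (c.isFace_face l i).degree_eq i.1
  have h₂ := i'.2
  rw [h] at h₂
  have h₃ := i.2
  simp only [Pi.add_apply, Pi.single_eq_same] at h₁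
  omega

theorem Cube.degree_face_of_ne {Λ : KGraph k} {r : ℕ} (c : Λ.Cube (r + 1)) (l : Fin 2)
    (i : c.Dir) {j : Fin k} (h : j ≠ i.1) :
    (c.face l i).path.degree j = c.path.degree j := by
  have h₁ := congrFun (c.isFace_face l i).degree_eq j
  simp only [Pi.add_apply, Pi.single_eq_of_ne h, add_zero] at h₁
  exact h₁.symm

theorem Cube.degree_face_self {Λ : KGraph k} {r : ℕ} (c : Λ.Cube (r + 1)) (l : Fin 2)
    (i : c.Dir) : (c.face l i).path.degree i.1 = 0 := by
  have h₁ := congrFun (c.isFace_face l i).degree_eq i.1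
  have h₃ := i.2
  simp only [Pi.add_apply, Pi.single_eq_same] at h₁
  omega

theorem Cube.pos_face {Λ : KGraph k} {r : ℕ} (c : Λ.Cube (r + 1)) (l : Fin 2) (i : c.Dir)
    (i' : (c.face l i).Dir) (j : c.Dir) (hj : j.1 = i'.1) :
    (c.face l i).pos i' + (if i.1 < j.1 then 1 else 0) = c.pos j := by
  have hne := c.face_ne l i i'
  have key : (Finset.univ.filter fun x : Fin k =>
      (c.face l i).path.degree x = 1 ∧ x ≤ i'.1) =
      (Finset.univ.filter fun x : Fin k => c.path.degree x = 1 ∧ x ≤ j.1).erase i.1 := by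
    ext x
    simp only [Finset.mem_filter, Finset.mem_univ, true_and, Finset.mem_erase, hj]
    rcases eq_or_ne x i.1 with rfl | hx
    · simp [c.degree_face_self l i]
    · simp [c.degree_face_of_ne l i hx, hx]
  rw [Cube.pos, Cube.pos, key]
  split_ifs with h
  · refine Finset.card_erase_add_one ?_
    simp [i.2, h.le]
  · rw [Finset.erase_eq_of_notMem, add_zero]
    simp only [Finset.mem_filter, Finset.mem_univ, true_and, not_and, not_le]
    intro _
    rw [hj] at h ⊢
    omega

/-- Reverse the order of two successive directions. -/
theorem Cube.face_face {Λ : KGraph k} {r : ℕ} (c : Λ.Cube (r + 2)) (l : Fin 2) (i : c.Dir)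
    (l' : Fin 2) (i' : (c.face l i).Dir) (j : c.Dir) (hj : j.1 = i'.1)
    (j' : (c.face l' j).Dir) (hj' : j'.1 = i.1) :
    (c.face l i).face l' i' = (c.face l' j).face l j' := by
  have h₁ := (c.isFace_face l i).trans ((c.face l i).isFace_face l' i')
  have h₂ := (c.isFace_face l' j).trans ((c.face l' j).isFace_face l j')
  rw [hj, hj', add_comm (if l' = 1 then (Pi.single i'.1 1 : Fin k → ℕ) else 0),
    add_comm (if l' = 0 then (Pi.single i'.1 1 : Fin k → ℕ) else 0)] at h₂
  refine Cube.ext ((existsUnique_isSegment c.path _ _ ?_).unique h₁ h₂)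
  refine le_of_le_of_eq ?_ h₁.degree_eq.symm
  exact add_le_add_left le_self_add _

theorem boundary_comp_boundary (Λ : KGraph k) (r : ℕ) :
    Λ.boundary r ∘ₗ Λ.boundary (r + 1) = 0 := by
  refine Finsupp.lhom_ext' fun c => LinearMap.ext_ring ?_
  simp only [LinearMap.comp_apply, Finsupp.lsingle_apply, boundary_single, one_smul,
    LinearMap.zero_apply]
  have h₁ : Λ.boundary r c.boundary =
      ∑ t : (Σ p : Fin 2 × c.Dir, Fin 2 × (c.face p.1 p.2).Dir),
        Finsupp.single ((c.face t.1.1 t.1.2).face t.2.1 t.2.2)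
          ((-1 : ℤ) ^ (c.pos t.1.2 + t.1.1.1 + ((c.face t.1.1 t.1.2).pos t.2.2 + t.2.1.1))) := by
    rw [Fintype.sum_sigma, Fintype.sum_prod_type, Cube.boundary, map_sum]
    refine Finset.sum_congr rfl fun l _ => ?_
    rw [map_sum]
    refine Finset.sum_congr rfl fun i _ => ?_
    rw [boundary_single, Cube.boundary, Fintype.sum_prod_type, Finset.smul_sum]
    refine Finset.sum_congr rfl fun l' _ => ?_
    rw [Finset.smul_sum]
    refine Finset.sum_congr rfl fun i' _ => ?_
    rw [Finsupp.smul_single, smul_eq_mul, ← pow_add]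
  rw [h₁]
  have hd : ∀ (l : Fin 2) (i : c.Dir) (i' : (c.face l i).Dir), c.path.degree i'.1 = 1 :=
    fun l i i' => (c.degree_face_of_ne l i (c.face_ne l i i')).symm.trans i'.2
  have hd' : ∀ (l : Fin 2) (i : c.Dir) (l' : Fin 2) (i' : (c.face l i).Dir),
      (c.face l' ⟨i'.1, hd l i i'⟩).path.degree i.1 = 1 :=
    fun l i l' i' => (c.degree_face_of_ne l' ⟨i'.1, hd l i i'⟩ (c.face_ne l i i').symm).trans i.2
  refine Finset.sum_involution
    (fun t _ => ⟨(t.2.1, ⟨t.2.2.1, hd _ _ _⟩), (t.1.1, ⟨t.1.2.1, hd' _ _ _ _⟩)⟩) ?_ ?_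
    (fun _ _ => Finset.mem_univ _) (fun _ _ => rfl)
  · rintro ⟨⟨l, i⟩, ⟨l', i'⟩⟩ -
    dsimp only
    rw [c.face_face l i l' i' ⟨i'.1, hd _ _ _⟩ rfl ⟨i.1, hd' _ _ _ _⟩ rfl, ← Finsupp.single_add]
    have p₁ := c.pos_face l i i' ⟨i'.1, hd _ _ _⟩ rfl
    have p₂ := c.pos_face l' ⟨i'.1, hd _ _ _⟩ ⟨i.1, hd' _ _ _ _⟩ i rfl
    have hne := c.face_ne l i i'
    rw [← p₁, ← p₂]
    generalize (c.face l i).pos i' = a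
    generalize (c.face l' ⟨i'.1, hd _ _ _⟩).pos ⟨i.1, hd' _ _ _ _⟩ = b
    rcases lt_or_gt_of_ne hne with h | h
    · simp only [h, h.not_gt, if_true, if_false]
      rw [Finsupp.single_eq_zero]
      ring
    · simp only [h, h.not_gt, if_true, if_false]
      rw [Finsupp.single_eq_zero]
      ring
  · rintro ⟨⟨l, i⟩, ⟨l', i'⟩⟩ - - h
    have h₂ := congrArg (fun t => t.1.2.1) h
    exact c.face_ne l i i' h₂

/-- The chain complex `C_*(Λ)`. -/
noncomputable def chainComplex (Λ : KGraph k) : ChainComplex (ModuleCat ℤ) ℕ :=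
  ChainComplex.of (fun r => ModuleCat.of ℤ (Λ.Chain r))
    (fun r => ModuleCat.ofHom (Λ.boundary r)) (fun r => by
      rw [← ModuleCat.ofHom_comp, boundary_comp_boundary]
      rfl)

theorem Hom.mapCube_face {Λ Γ : KGraph k} (φ : Hom Λ Γ) {r : ℕ} (c : Λ.Cube (r + 1)) (l : Fin 2)
    (i : c.Dir) (i' : (φ.mapCube c).Dir) (h : i'.1 = i.1) :
    (φ.mapCube c).face l i' = φ.mapCube (c.face l i) := by
  refine Cube.face_eq _ _ _ _ ?_
  rw [h]
  exact IsSegment.map φ (c.isFace_face l i)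

theorem Hom.degree_mapCube {Λ Γ : KGraph k} (φ : Hom Λ Γ) {r : ℕ} (c : Λ.Cube r) :
    (φ.mapCube c).path.degree = c.path.degree :=
  φ.deg_map c.path.hom

theorem Hom.boundary_mapCube {Λ Γ : KGraph k} (φ : Hom Λ Γ) {r : ℕ} (c : Λ.Cube (r + 1)) :
    (φ.mapCube c).boundary = Finsupp.mapDomain φ.mapCube c.boundary := by
  rw [Cube.boundary, Cube.boundary, Finsupp.mapDomain_finsetSum]
  refine Finset.sum_congr rfl fun l _ => ?_
  rw [Finsupp.mapDomain_finsetSum]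
  refine Fintype.sum_equiv (Equiv.subtypeEquivRight fun i => by rw [φ.degree_mapCube]) _ _ ?_
  intro i
  rw [Finsupp.mapDomain_single]
  congr 1
  · exact φ.mapCube_face c l _ _ rfl
  · simp only [Cube.pos, φ.degree_mapCube, Equiv.subtypeEquivRight_apply_coe]

/-- The chain map `C_*(φ)` induced by a `k`-graph morphism `φ`, with `λ ↦ φ(λ)` on cubes. -/
noncomputable def chainMap {Λ Γ : KGraph k} (φ : Λ ⟶ Γ) : Λ.chainComplex ⟶ Γ.chainComplex :=
  ChainComplex.ofHom
    (fun _ => ModuleCat.ofHom (Finsupp.lmapDomain ℤ ℤ (Hom.mapCube φ))) (fun r => by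
      simp only [chainComplex, ChainComplex.of_d]
      rw [← ModuleCat.ofHom_comp, ← ModuleCat.ofHom_comp]
      congr 1
      refine Finsupp.lhom_ext' fun c => LinearMap.ext_ring ?_
      simp only [LinearMap.comp_apply, Finsupp.lsingle_apply, boundary_single, one_smul,
        Finsupp.lmapDomain_apply, Finsupp.mapDomain_single]
      exact Hom.boundary_mapCube φ c)

/-- The functor `Λ ↦ C_*(Λ)`. -/
noncomputable def chainFunctor (k : ℕ) : KGraph k ⥤ ChainComplex (ModuleCat ℤ) ℕ where
  obj Λ := Λ.chainComplex
  map φ := chainMap φ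
  map_id Λ := by
    ext r : 1
    exact ModuleCat.hom_ext (Finsupp.lmapDomain_id ℤ ℤ)
  map_comp φ ψ := by
    ext r : 1
    exact ModuleCat.hom_ext (Finsupp.lmapDomain_comp ℤ ℤ (Hom.mapCube φ) (Hom.mapCube ψ))

/-- The functor `Λ ↦ H_r(Λ)` from `k`-graphs to abelian groups. -/
noncomputable def homologyFunctor (k r : ℕ) : KGraph k ⥤ ModuleCat ℤ :=
  chainFunctor k ⋙ HomologicalComplex.homologyFunctor (ModuleCat ℤ) (ComplexShape.down ℕ) r

/-! ### Cartesian products -/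

/-- The cartesian product of a `k₁`-graph and a `k₂`-graph, a `(k₁ + k₂)`-graph: the product
category with the degree functor `d₁ × d₂`. -/
def prod (Λ₁ : KGraph k₁) (Λ₂ : KGraph k₂) : KGraph (k₁ + k₂) where
  Obj := Λ₁.Obj × Λ₂.Obj
  cat := CategoryTheory.prod' Λ₁.Obj Λ₂.Obj
  nonempty := by
    have := Λ₁.nonempty
    have := Λ₂.nonempty
    infer_instance
  countable := by
    have := Λ₁.countable
    have := Λ₂.countable
    let F : (Σ x y : Λ₁.Obj × Λ₂.Obj, (x ⟶ y)) →
        (Σ x y : Λ₁.Obj, (x ⟶ y)) × (Σ x y : Λ₂.Obj, (x ⟶ y)) :=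
      fun t => (⟨t.1.1, t.2.1.1, t.2.2.1⟩, ⟨t.1.2, t.2.1.2, t.2.2.2⟩)
    refine Function.Injective.countable (f := F) ?_
    rintro ⟨⟨a, b⟩, ⟨c, d⟩, ⟨f, g⟩⟩ ⟨⟨a', b'⟩, ⟨c', d'⟩, ⟨f', g'⟩⟩ h
    simp only [F, Prod.mk.injEq] at h
    obtain ⟨h₁, h₂⟩ := h
    cases h₁
    cases h₂
    rfl
  deg f := Fin.append (Λ₁.deg f.1) (Λ₂.deg f.2)
  deg_id x := by
    funext i
    refine Fin.addCases (fun i => ?_) (fun i => ?_) i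
    · simp [Λ₁.deg_id]
    · simp [Λ₂.deg_id]
  deg_comp f g := by
    funext i
    refine Fin.addCases (fun i => ?_) (fun i => ?_) i
    · simp [Λ₁.deg_comp]
    · simp [Λ₂.deg_comp]
  factorisation {x y} f m n h := by
    obtain ⟨⟨z, μ, ν⟩, ⟨h₁, h₂, h₃⟩, hu⟩ := Λ₁.factorisation f.1
      (fun i => m (Fin.castAdd k₂ i)) (fun i => n (Fin.castAdd k₂ i)) (by
        funext i
        simpa using congrFun h (Fin.castAdd k₂ i))
    obtain ⟨⟨z', μ', ν'⟩, ⟨h₁', h₂', h₃'⟩, hu'⟩ := Λ₂.factorisation f.2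
      (fun i => m (Fin.natAdd k₁ i)) (fun i => n (Fin.natAdd k₁ i)) (by
        funext i
        simpa using congrFun h (Fin.natAdd k₁ i))
    dsimp only at h₁ h₂ h₃ h₁' h₂' h₃'
    refine ⟨⟨(z, z'), (μ, μ'), (ν, ν')⟩, ⟨?_, ?_, ?_⟩, ?_⟩
    · funext i
      refine Fin.addCases (fun i => ?_) (fun i => ?_) i
      · simp [h₁]
      · simp [h₁']
    · funext i
      refine Fin.addCases (fun i => ?_) (fun i => ?_) i
      · simp [h₂]
      · simp [h₂']
    · exact Prod.ext h₃ h₃'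
    · rintro ⟨⟨w, w'⟩, ⟨a, a'⟩, ⟨b, b'⟩⟩ ⟨e₁, e₂, e₃⟩
      dsimp only at e₁ e₂ e₃
      have q := hu ⟨w, a, b⟩ ⟨by
        funext i
        simpa using congrFun e₁ (Fin.castAdd k₂ i), by
        funext i
        simpa using congrFun e₂ (Fin.castAdd k₂ i), congrArg Prod.fst e₃⟩
      have q' := hu' ⟨w', a', b'⟩ ⟨by
        funext i
        simpa using congrFun e₁ (Fin.natAdd k₁ i), by
        funext i
        simpa using congrFun e₂ (Fin.natAdd k₁ i), congrArg Prod.snd e₃⟩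
      cases q
      cases q'
      rfl

/-- The functor `(Λ₁, Λ₂) ↦ Λ₁ × Λ₂`. -/
def prodFunctor (k₁ k₂ : ℕ) : KGraph k₁ × KGraph k₂ ⥤ KGraph (k₁ + k₂) where
  obj P := P.1.prod P.2
  map φ :=
    { functor := (Hom.functor φ.1).prod (Hom.functor φ.2)
      deg_map := fun f => congrArg₂ Fin.append (Hom.deg_map φ.1 f.1) (Hom.deg_map φ.2 f.2) }

/-- The cube `(λ₁, λ₂)` of `Λ₁ × Λ₂` for cubes `λ₁` of `Λ₁` and `λ₂` of `Λ₂`. -/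
def Cube.prod {Λ₁ : KGraph k₁} {Λ₂ : KGraph k₂} {r₁ r₂ r : ℕ} (h : r₁ + r₂ = r)
    (c₁ : Λ₁.Cube r₁) (c₂ : Λ₂.Cube r₂) : (Λ₁.prod Λ₂).Cube r where
  path := ⟨(c₁.path.src, c₂.path.src), (c₁.path.tgt, c₂.path.tgt), (c₁.path.hom, c₂.path.hom)⟩
  le_one i := by
    refine Fin.addCases (fun i => ?_) (fun i => ?_) i
    · simpa [Path.degree, KGraph.prod] using c₁.le_one i
    · simpa [Path.degree, KGraph.prod] using c₂.le_one i
  sum_degree := by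
    refine Eq.trans ?_ ((congrArg₂ (· + ·) c₁.sum_degree c₂.sum_degree).trans h)
    rw [Fin.sum_univ_add]
    simp [Path.degree, KGraph.prod]

/-- The cross product of chains: the bilinear map
`C_{r₁}(Λ₁) × C_{r₂}(Λ₂) → C_{r₁ + r₂}(Λ₁ × Λ₂)` with `(λ₁, λ₂) ↦ (λ₁, λ₂)` on cubes. -/
noncomputable def cross {Λ₁ : KGraph k₁} {Λ₂ : KGraph k₂} {r₁ r₂ r : ℕ} (h : r₁ + r₂ = r)
    (x₁ : Λ₁.Chain r₁) (x₂ : Λ₂.Chain r₂) : (Λ₁.prod Λ₂).Chain r :=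
  x₁.sum fun c₁ a₁ => x₂.sum fun c₂ a₂ => Finsupp.single (Cube.prod h c₁ c₂) (a₁ * a₂)

/-! ### The terms of the Künneth sequence, as functors of the pair `(Λ₁, Λ₂)` -/

/-- The pairs `(r₁, r₂)` of natural numbers with `r₁ + r₂ = r`. -/
abbrev TensorIndex (r : ℕ) : Type := {p : ℕ × ℕ // p.1 + p.2 = r}

/-- The pairs `(r₁, r₂)` of natural numbers with `r₁ + r₂ = r - 1`, with no such pair for
`r = 0`. -/
abbrev TorIndex (r : ℕ) : Type := {p : ℕ × ℕ // p.1 + p.2 + 1 = r}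

instance (r : ℕ) : Finite (TensorIndex r) :=
  Set.Finite.subset (Finset.finite_toSet (Finset.HasAntidiagonal.antidiagonal r)) fun p (hp : p.1 + p.2 = r) => by
    simpa using hp

instance (r : ℕ) : Finite (TorIndex r) :=
  Set.Finite.subset (Finset.finite_toSet (Finset.HasAntidiagonal.antidiagonal (r - 1)))
    fun p (hp : p.1 + p.2 + 1 = r) => by
      have : p.1 + p.2 = r - 1 := by omega
      simpa using this

/-- The functor `(Λ₁, Λ₂) ↦ ⨁_{r₁ + r₂ = r} H_{r₁}(Λ₁) ⊗ H_{r₂}(Λ₂)`. -/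
noncomputable def tensorHomology (k₁ k₂ r : ℕ) : KGraph k₁ × KGraph k₂ ⥤ ModuleCat ℤ where
  obj P := ⨁ fun p : TensorIndex r =>
    (homologyFunctor k₁ p.1.1).obj P.1 ⊗ (homologyFunctor k₂ p.1.2).obj P.2
  map φ := biproduct.map fun p : TensorIndex r =>
    (homologyFunctor k₁ p.1.1).map φ.1 ⊗ₘ (homologyFunctor k₂ p.1.2).map φ.2

/-- The functor `(Λ₁, Λ₂) ↦ H_r(Λ₁ × Λ₂)`. -/
noncomputable def prodHomology (k₁ k₂ r : ℕ) : KGraph k₁ × KGraph k₂ ⥤ ModuleCat ℤ :=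
  prodFunctor k₁ k₂ ⋙ homologyFunctor (k₁ + k₂) r

/-- The functor `(Λ₁, Λ₂) ↦ ⨁_{r₁ + r₂ = r - 1} Tor(H_{r₁}(Λ₁), H_{r₂}(Λ₂))`. -/
noncomputable def torHomology (k₁ k₂ r : ℕ) : KGraph k₁ × KGraph k₂ ⥤ ModuleCat ℤ where
  obj P := ⨁ fun p : TorIndex r =>
    ((Tor (ModuleCat ℤ) 1).obj ((homologyFunctor k₁ p.1.1).obj P.1)).obj
      ((homologyFunctor k₂ p.1.2).obj P.2)
  map φ := biproduct.map fun p : TorIndex r =>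
    ((Tor (ModuleCat ℤ) 1).map ((homologyFunctor k₁ p.1.1).map φ.1)).app _ ≫
      ((Tor (ModuleCat ℤ) 1).obj _).map ((homologyFunctor k₂ p.1.2).map φ.2)
  map_comp φ ψ := by
    refine biproduct.hom_ext _ _ fun p => ?_
    rw [Category.assoc, biproduct.map_π, biproduct.map_π, biproduct.map_π_assoc, Category.assoc]
    refine congrArg (fun t => biproduct.π _ p ≫ t) ?_
    simp only [prod_comp, Functor.map_comp, NatTrans.comp_app, Category.assoc,
      NatTrans.naturality_assoc]

/-- The homology class in `H_r(Λ)` of an `r`-cycle of `Λ`. -/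
noncomputable abbrev homologyClass {Λ : KGraph k} {r : ℕ} (z : Λ.chainComplex.cycles r) :
    (homologyFunctor k r).obj Λ :=
  (Λ.chainComplex.homologyπ r).hom z

/-- The chain underlying an `r`-cycle of `Λ`. -/
noncomputable abbrev cycleChain {Λ : KGraph k} {r : ℕ} (z : Λ.chainComplex.cycles r) :
    Λ.Chain r :=
  (Λ.chainComplex.iCycles r).hom z

end KGraph

/-! A cube of `Λ₁ × Λ₂` is a pair of cubes whose dimensions add up, and the directions of the first
factor precede those of the second. The boundary therefore satisfies the Leibniz rule with sign
`(-1)^i`, and `C_*(Λ₁ × Λ₂)` is the tensor product of `C_*(Λ₁)` and `C_*(Λ₂)`, naturally in both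
graphs (`prodCube_bijective`, `prodChainEquiv_boundary`, `isCompatible_chainMap`). The rest of the
positive part is the algebraic Künneth theorem for complexes `C`, `D` of free modules over a
principal ideal domain.

Submodules of free modules are free, so `0 → B_j → Z_j → H_j(D) → 0` is a projective resolution, and
`Tor(H_i(C), H_j(D))` is the kernel of `H_i(C) ⊗ B_j → H_i(C) ⊗ Z_j` (`torι`, `exists_lift_torι`).
The map `β` sends the class of a cycle `x` to the class of `(1 ⊗ d) x` in `H_i(C) ⊗ B_j`
(`toHomologyTensorBounds`); the cycle condition puts this class into the kernel. Every element of
the kernel is reached by an explicit cycle (`exists_toHomologyTensorBounds_eq`). If all components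
of `β` vanish on `x`, then `x` can be changed by a boundary until `1 ⊗ d` kills it; its components
then lie in `Z_i ⊗ Z_j`, so its class is a sum of products (`mem_iSup_range_homologyProduct`).

The splitting comes from retractions of chains onto cycles, which exist because kernels of maps into
free modules are direct summands. They make each complex map to its homology, and the tensor product
of two such maps is a left inverse of `α` (`homologyRetraction`). The retractions are choices, not
natural. They also appear in the definition of `β`, but there they are evaluated only on elements of
`Z_i ⊗ B_j`, where the choice does not matter; so `β` is natural.

No natural splitting exists. Let `P` be a `2`-graph of the projective plane, with a cycle `z` and a
chain `w` such that `∂w = 2z`. Then `ζ = w ⊗ z + z ⊗ w` is a `3`-cycle of `P × P`. All products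
`H_i(P) ⊗ H_j(P)` with `i + j = 3` vanish, so `β` is injective there and a splitting must send
`β[ζ]` to `[ζ]`. Include `P` in a `2`-graph `F` in which `z = ∂y`. In `H_3(F × P)` the image of
`[ζ]` is killed by `β`, so naturality would make it zero. But it is the product of `[w - 2y]` and
`[z]`, and a functional modulo two detects it. -/

/-! ### Submodules of free modules over a principal ideal domain -/

section FreeSubmodule

/-- Triangular generators of a module mapping to a free module on a well-ordered set. -/
theorem exists_triangular_generators {R M : Type*} [CommRing R] [IsPrincipalIdealRing R]
    [AddCommGroup M] [Module R M] {ι : Type*} [LinearOrder ι] (f : M →ₗ[R] ι →₀ R) :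
    ∃ n : ι → M, (∀ i j, i < j → f (n i) j = 0) ∧
      ∀ i x, (∀ j, i < j → f x j = 0) → ∃ c : R, f x i = c * f (n i) i := by
  have key : ∀ i, ∃ n, (∀ j, i < j → f n j = 0) ∧
      ∀ x, (∀ j, i < j → f x j = 0) → ∃ c : R, f x i = c * f n i := by
    intro i
    let T : Submodule R M :=
      { carrier := {x | ∀ j, i < j → f x j = 0}
        add_mem' := fun ha hb j hj => by simp [ha j hj, hb j hj]
        zero_mem' := fun _ _ => by simp
        smul_mem' := fun c x hx j hj => by simp [hx j hj] }
    let g : M →ₗ[R] R := Finsupp.lapply i ∘ₗ f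
    -- The coefficients at `i` of elements of `T` form an ideal; `n` is an element of `T` whose
    -- coefficient generates it.
    obtain ⟨a, ha⟩ := IsPrincipalIdealRing.principal (T.map g)
    have haT : a ∈ T.map g := by
      rw [ha]; exact Submodule.mem_span_singleton_self a
    obtain ⟨n, hn, rfl⟩ := haT
    refine ⟨n, hn, fun x hx => ?_⟩
    have : g x ∈ T.map g := Submodule.mem_map_of_mem hx
    rw [ha] at this
    obtain ⟨c, hc⟩ := Submodule.mem_span_singleton.1 this
    exact ⟨c, hc.symm⟩
  choose n h₁ h₂ using key
  exact ⟨n, h₁, h₂⟩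

variable {R : Type*} [CommRing R] [IsDomain R] [IsPrincipalIdealRing R]

/-- Well-order `ι`. The triangular generators with nonzero leading coefficient form a basis: they
span by well-founded induction on the leading index, and they are independent because their leading
indices are distinct. -/
theorem Module.Free.of_injective_finsupp {M ι : Type*} [AddCommGroup M] [Module R M]
    (f : M →ₗ[R] ι →₀ R) (hf : Function.Injective f) : Module.Free R M := by
  obtain ⟨_, _⟩ := exists_wellFoundedLT ι
  obtain ⟨n, hn, hgen⟩ := exists_triangular_generators f
  let v : {i // f (n i) i ≠ 0} → M := fun i => n i.1
  have hmax : ∀ x, x ≠ 0 → ∃ m, f x m ≠ 0 ∧ ∀ j, m < j → f x j = 0 := by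
    intro x hx
    have h : (f x).support.Nonempty :=
      Finsupp.support_nonempty_iff.2 ((map_ne_zero_iff f hf).2 hx)
    refine ⟨_, Finsupp.mem_support_iff.1 (Finset.max'_mem _ h), fun j hj => ?_⟩
    by_contra hne
    exact hj.not_ge (Finset.le_max' _ _ (Finsupp.mem_support_iff.2 hne))
  have hspan : ∀ i x, (∀ j, i < j → f x j = 0) → x ∈ Submodule.span R (Set.range v) := by
    intro i
    induction i using WellFoundedLT.induction with
    | ind i ih =>
      intro x hx
      obtain ⟨c, hc⟩ := hgen i x hx
      obtain ⟨y, hy, hyx⟩ : ∃ y : M, y ∈ Submodule.span R (Set.range v) ∧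
          ∀ j, i ≤ j → f (x - y) j = 0 := by
        -- If `n i` has no coefficient at `i`, then by `hc` neither has `x`, and nothing needs to be
        -- subtracted.
        by_cases hi : f (n i) i = 0
        · refine ⟨0, Submodule.zero_mem _, fun j hj => ?_⟩
          rcases hj.eq_or_lt with rfl | hj
          · simp [hc, hi]
          · simp [hx j hj]
        · refine ⟨c • v ⟨i, hi⟩, Submodule.smul_mem _ _ (Submodule.subset_span ⟨_, rfl⟩),
            fun j hj => ?_⟩
          rcases hj.eq_or_lt with rfl | hj
          · simp [v, hc]
          · simp [v, hx j hj, hn i j hj]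
      have hxy : x - y ∈ Submodule.span R (Set.range v) := by
        rcases eq_or_ne (x - y) 0 with h | h
        · rw [h]
          exact Submodule.zero_mem _
        · obtain ⟨m, hm, hm'⟩ := hmax _ h
          exact ih m (not_le.1 fun hle => hm (hyx _ hle)) _ hm'
      simpa using Submodule.add_mem _ hxy hy
  refine Module.Free.of_basis (Module.Basis.mk (v := v) ?_ ?_)
  · rw [linearIndependent_iff]
    intro l hl
    by_contra hne
    have hs := Finsupp.support_nonempty_iff.2 hne
    -- At the largest index of a relation, triangularity leaves only the term of `m`.
    obtain ⟨m, hm, hmax⟩ := l.support.exists_max_image (fun i => i.1) hs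
    have h0 := congrArg (fun x => f x m.1) hl
    simp only [Finsupp.linearCombination_apply, Finsupp.sum, map_sum,
      Finsupp.finsetSum_apply, map_smul, Finsupp.smul_apply, v, smul_eq_mul,
      map_zero, Finsupp.coe_zero, Pi.zero_apply] at h0
    rw [Finset.sum_eq_single m] at h0
    · rcases mul_eq_zero.1 h0 with h | h
      · exact Finsupp.mem_support_iff.1 hm h
      · exact m.2 h
    · intro i hi him
      rw [hn i.1 m.1 (lt_of_le_of_ne (hmax i hi) fun h => him (Subtype.ext h)), mul_zero]
    · exact fun h => absurd hm h
  · intro x _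
    rcases eq_or_ne x 0 with h | h
    · rw [h]
      exact Submodule.zero_mem _
    · obtain ⟨m, -, hm⟩ := hmax x h
      exact hspan m x hm

/-- A module which embeds into a free module over a principal ideal domain is free. -/
theorem Module.Free.of_injective_of_pid {M N : Type*} [AddCommGroup M] [Module R M]
    [AddCommGroup N] [Module R N] [Module.Free R N] (f : M →ₗ[R] N)
    (hf : Function.Injective f) : Module.Free R M := by
  let e := (Module.Free.chooseBasis R N).repr
  exact Module.Free.of_injective_finsupp (e.toLinearMap ∘ₗ f) (e.injective.comp hf)

/-- If `ι` identifies `K` with the kernel of a map into a free module over a principal ideal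
domain, then `ι` has a retraction. -/
theorem exists_retraction_of_free {M N K : Type*} [AddCommGroup M] [Module R M]
    [AddCommGroup N] [Module R N] [Module.Free R N] [AddCommGroup K] [Module R K]
    (f : M →ₗ[R] N) (i : K →ₗ[R] M) (hi : Function.Injective i)
    (hr : LinearMap.range i = LinearMap.ker f) : ∃ p : M →ₗ[R] K, p ∘ₗ i = LinearMap.id := by
  -- The range of `f` is free, so `f` has a section `s` over its range; `x ↦ x - s (f x)` then
  -- projects onto the kernel.
  have : Module.Free R (LinearMap.range f) :=
    Module.Free.of_injective_of_pid (LinearMap.range f).subtype Subtype.val_injective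
  obtain ⟨s, hs⟩ := Module.projective_lifting_property f.rangeRestrict LinearMap.id
    f.surjective_rangeRestrict
  let e := LinearEquiv.ofInjective i hi
  have hmem : ∀ x, x - s (f.rangeRestrict x) ∈ LinearMap.range i := by
    intro x
    rw [hr, LinearMap.mem_ker, map_sub, sub_eq_zero]
    have := congrArg Subtype.val (LinearMap.congr_fun hs (f.rangeRestrict x))
    simpa using this.symm
  refine ⟨e.symm.toLinearMap ∘ₗ (LinearMap.id - s ∘ₗ f.rangeRestrict).codRestrict _ hmem, ?_⟩
  refine LinearMap.ext fun x => ?_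
  have hx : f.rangeRestrict (i x) = 0 := by
    refine Subtype.ext ?_
    have : i x ∈ LinearMap.ker f := hr ▸ LinearMap.mem_range_self i x
    simpa using this
  simp only [LinearMap.comp_apply, LinearEquiv.coe_coe, LinearMap.id_apply]
  rw [LinearEquiv.symm_apply_eq]
  refine Subtype.ext ?_
  simp only [LinearMap.codRestrict_apply, LinearMap.sub_apply, LinearMap.id_apply,
    LinearMap.comp_apply, hx, map_zero, sub_zero]
  rfl

end FreeSubmodule

/-! ### The first left derived functor and resolutions of length one -/

namespace CategoryTheory

open ZeroObject

variable {C D : Type*} [Category* C] [Category* D] [Abelian C] [Abelian D]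

/-- The terms of the complex `twoTerm`. -/
noncomputable abbrev twoTermX (B Z : C) : ℕ → C
  | 0 => Z
  | 1 => B
  | _ + 2 => 0

/-- The differentials of the complex `twoTerm`. -/
noncomputable abbrev twoTermD {B Z : C} (i : B ⟶ Z) : ∀ n, twoTermX B Z (n + 1) ⟶ twoTermX B Z n
  | 0 => i
  | _ + 1 => 0

/-- The complex `⋯ ⟶ 0 ⟶ B ⟶ Z` with `Z` in degree `0`. -/
noncomputable abbrev twoTerm {B Z : C} (i : B ⟶ Z) : ChainComplex C ℕ :=
  ChainComplex.of (twoTermX B Z) (twoTermD i) (fun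
    | 0 => zero_comp
    | _ + 1 => zero_comp)

theorem twoTerm_d {B Z : C} (i : B ⟶ Z) (n : ℕ) : (twoTerm i).d (n + 1) n = twoTermD i n :=
  ChainComplex.of_d (twoTermX B Z) (twoTermD i) n

/-- The components of `twoTermMap`. -/
noncomputable abbrev twoTermMapF {B Z B' Z' : C} (b : B ⟶ B') (z : Z ⟶ Z') :
    ∀ n, twoTermX B Z n ⟶ twoTermX B' Z' n
  | 0 => z
  | 1 => b
  | _ + 2 => 0

/-- The map of two-term complexes given by a commutative square. -/
noncomputable def twoTermMap {B Z B' Z' : C} {i : B ⟶ Z} {i' : B' ⟶ Z'} (b : B ⟶ B')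
    (z : Z ⟶ Z') (h : b ≫ i' = i ≫ z) : twoTerm i ⟶ twoTerm i' :=
  ChainComplex.ofHom (twoTermMapF b z) (fun n => by
    rw [twoTerm_d, twoTerm_d]
    match n with
    | 0 => exact h
    | n + 1 => exact comp_zero.trans zero_comp.symm)

instance projective_twoTermX (B Z : C) [Projective B] [Projective Z] :
    ∀ n, Projective (twoTermX B Z n)
  | 0 => inferInstanceAs (Projective Z)
  | 1 => inferInstanceAs (Projective B)
  | _ + 2 => inferInstanceAs (Projective (0 : C))

/-- In degree `0` the hypotheses on `f` identify `Y` with the cokernel of the first differential; in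
positive degrees both sides have zero homology. -/
theorem quasiIso_toSingle₀ {P : ChainComplex C ℕ} {Y : C} (f : P.X 0 ⟶ Y) (w : P.d 1 0 ≫ f = 0)
    (h₀ : (ShortComplex.mk (P.d 1 0) f w).Exact) [Epi f] (h : ∀ n, P.ExactAt (n + 1)) :
    QuasiIso ((ChainComplex.toSingle₀Equiv P Y).symm ⟨f, w⟩) where
  quasiIsoAt n := by
    cases n
    · rw [ChainComplex.quasiIsoAt₀_iff, ShortComplex.quasiIso_iff_of_zeros']
      · refine (ShortComplex.exact_and_epi_g_iff_of_iso ?_).2 ⟨h₀, by dsimp; infer_instance⟩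
        refine ShortComplex.isoMk (Iso.refl _) (Iso.refl _) (Iso.refl _)
          ((Category.id_comp _).trans (Category.comp_id _).symm) ?_
        exact (Category.id_comp _).trans ((ChainComplex.toSingle₀Equiv_symm_apply_f_zero f w).symm.trans
          (Category.comp_id _).symm)
      · exact P.shape _ _ (by simp)
      all_goals rfl
    · rw [quasiIsoAt_iff_exactAt']
      · apply h
      · apply ChainComplex.exactAt_succ_single_obj

/-- In degree `1` exactness is the injectivity of `i`; above that the terms are zero. -/
theorem twoTerm_exactAt {B Z : C} (i : B ⟶ Z) [Mono i] (n : ℕ) :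
    (twoTerm i).ExactAt (n + 1) := by
  rw [HomologicalComplex.exactAt_iff' _ (n + 1 + 1) (n + 1) n (by simp) (by simp)]
  match n with
  | 0 =>
    refine (ShortComplex.exact_iff_mono _ (twoTerm_d i 1)).2 ?_
    have : Mono ((twoTerm i).d 1 0) := by
      rw [twoTerm_d]
      infer_instance
    exact this
  | n + 1 => exact ShortComplex.exact_of_isZero_X₂ _ (isZero_zero C)

/-- A short exact sequence `0 ⟶ B ⟶ Z ⟶ Y ⟶ 0` with `B` and `Z` projective is a projective
resolution of `Y`. -/
noncomputable abbrev ShortComplex.ShortExact.projectiveResolution {S : ShortComplex C}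
    (hS : S.ShortExact) [Projective S.X₁] [Projective S.X₂] : ProjectiveResolution S.X₃ where
  complex := twoTerm S.f
  projective := projective_twoTermX _ _
  π := (ChainComplex.toSingle₀Equiv (twoTerm S.f) _).symm ⟨S.g, by
    rw [twoTerm_d]
    exact S.zero⟩
  quasiIso := by
    have := hS.mono_f
    have := hS.epi_g
    refine quasiIso_toSingle₀ (P := twoTerm S.f) _ _ ?_ (twoTerm_exactAt S.f)
    have key : ∀ (d : S.X₁ ⟶ S.X₂) (w : d ≫ S.g = 0), d = S.f →
        (ShortComplex.mk d S.g w).Exact := by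
      rintro _ _ rfl
      exact hS.exact
    exact key _ _ (twoTerm_d S.f 0)

section

variable (K L : ChainComplex D ℕ) (hK : K.d 2 1 = 0) (hL : L.d 2 1 = 0)

/-- The inclusion of the first homology of a complex with vanishing differential `K₂ ⟶ K₁`. -/
noncomputable def homologyOneι : K.homology 1 ⟶ K.X 1 :=
  K.homologyι 1 ≫ (K.pOpcyclesIso 2 1 (by simp) hK).inv

theorem homologyOneι_pOpcycles : homologyOneι K hK ≫ K.pOpcycles 1 = K.homologyι 1 := by
  rw [homologyOneι, Category.assoc, ← K.pOpcyclesIso_hom 2 1 (by simp) hK, Iso.inv_hom_id,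
    Category.comp_id]

theorem mono_homologyOneι : Mono (homologyOneι K hK) :=
  mono_of_mono_fac (homologyOneι_pOpcycles K hK)

theorem homologyOneι_comp_d : homologyOneι K hK ≫ K.d 1 0 = 0 := by
  rw [← K.p_fromOpcycles, ← Category.assoc, homologyOneι_pOpcycles,
    HomologicalComplex.homologyι_comp_fromOpcycles]

/-- Homology is the kernel of the map out of the opcycles, and without incoming differential the
opcycles are `K.X 1` itself. With `mono_homologyOneι` and `homologyOneι_comp_d`, this makes
`homologyOneι` a kernel of `K.d 1 0`. -/
theorem exists_lift_homologyOneι {A : D} (a : A ⟶ K.X 1) (ha : a ≫ K.d 1 0 = 0) :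
    ∃ t, t ≫ homologyOneι K hK = a := by
  have := K.isIso_pOpcycles 2 1 (by simp) hK
  obtain ⟨t, ht⟩ := KernelFork.IsLimit.lift' (K.homologyIsKernel 1 0 (by simp))
    (a ≫ K.pOpcycles 1) (by rw [Category.assoc, HomologicalComplex.p_fromOpcycles, ha])
  refine ⟨t, ?_⟩
  rw [← cancel_mono (K.pOpcycles 1), Category.assoc, homologyOneι_pOpcycles]
  exact ht

variable {K L}

theorem homologyOneι_naturality (f : K ⟶ L) :
    HomologicalComplex.homologyMap f 1 ≫ homologyOneι L hL = homologyOneι K hK ≫ f.f 1 := by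
  have := L.isIso_pOpcycles 2 1 (by simp) hL
  rw [← cancel_mono (L.pOpcycles 1), Category.assoc, Category.assoc, homologyOneι_pOpcycles,
    ← HomologicalComplex.p_opcyclesMap, ← Category.assoc, homologyOneι_pOpcycles,
    HomologicalComplex.homologyι_naturality]

end

theorem map_d_two_one_eq_zero {Y : C} (P : ProjectiveResolution Y)
    (hP : P.complex.d 2 1 = 0) (F : C ⥤ D) [F.Additive] :
    ((F.mapHomologicalComplex _).obj P.complex).d 2 1 = 0 := by
  rw [Functor.mapHomologicalComplex_obj_d, hP]
  exact F.map_zero _ _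

section

variable [HasProjectiveResolutions C] {Y Y' : C} (P : ProjectiveResolution Y)
  (P' : ProjectiveResolution Y') (hP : P.complex.d 2 1 = 0) (hP' : P'.complex.d 2 1 = 0)
  (F G : C ⥤ D) [F.Additive] [G.Additive]

/-- The inclusion of the first left derived functor computed by a resolution of length one. -/
noncomputable def leftDerivedOneι :
    (F.leftDerived 1).obj Y ⟶ ((F.mapHomologicalComplex _).obj P.complex).X 1 :=
  (P.isoLeftDerivedObj F 1).hom ≫ homologyOneι _ (map_d_two_one_eq_zero P hP F)

theorem mono_leftDerivedOneι : Mono (leftDerivedOneι P hP F) :=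
  @mono_comp _ _ _ _ _ (P.isoLeftDerivedObj F 1).hom inferInstance _
    (mono_homologyOneι _ (map_d_two_one_eq_zero P hP F))

theorem leftDerivedOneι_comp_d :
    leftDerivedOneι P hP F ≫ ((F.mapHomologicalComplex _).obj P.complex).d 1 0 = 0 := by
  refine (Category.assoc _ _ _).trans ?_
  exact (congrArg _ (homologyOneι_comp_d _ _)).trans comp_zero

theorem exists_lift_leftDerivedOneι {A : D}
    (a : A ⟶ ((F.mapHomologicalComplex _).obj P.complex).X 1)
    (ha : a ≫ ((F.mapHomologicalComplex _).obj P.complex).d 1 0 = 0) :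
    ∃ t, t ≫ leftDerivedOneι P hP F = a := by
  obtain ⟨t, ht⟩ := exists_lift_homologyOneι _ (map_d_two_one_eq_zero P hP F) a ha
  let t' : A ⟶ (HomologicalComplex.homologyFunctor D _ 1).obj
    ((F.mapHomologicalComplex _).obj P.complex) := t
  refine ⟨t' ≫ (P.isoLeftDerivedObj F 1).inv, ?_⟩
  refine Eq.trans ?_ ht
  refine (Category.assoc _ _ _).trans (congrArg (t' ≫ ·) ?_)
  exact (P.isoLeftDerivedObj F 1).inv_hom_id_assoc _

/-- Any chain map `φ` that covers `f` through the augmentations computes the derived map, so an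
explicit lift can be used. -/
theorem leftDerivedOneι_naturality (f : Y ⟶ Y') (φ : P.complex ⟶ P'.complex)
    (h : φ.f 0 ≫ P'.π.f 0 = P.π.f 0 ≫ f) :
    (F.leftDerived 1).map f ≫ leftDerivedOneι P' hP' F =
      leftDerivedOneι P hP F ≫ ((F.mapHomologicalComplex _).map φ).f 1 := by
  have e := ProjectiveResolution.isoLeftDerivedObj_hom_naturality f P P' φ h F 1
  refine (Category.assoc _ _ _).symm.trans ((congrArg (· ≫ _) e).trans ?_)
  refine (Category.assoc _ _ _).trans (Eq.trans ?_ (Category.assoc _ _ _).symm)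
  exact congrArg _ (homologyOneι_naturality (map_d_two_one_eq_zero P hP F)
    (map_d_two_one_eq_zero P' hP' F) ((F.mapHomologicalComplex _).map φ))

-- The derived transformation can be computed on one fixed resolution.
variable {F G} in
theorem leftDerivedOneι_naturality_functor (τ : F ⟶ G) :
    (NatTrans.leftDerived τ 1).app Y ≫ leftDerivedOneι P hP G =
      leftDerivedOneι P hP F ≫ ((NatTrans.mapHomologicalComplex τ _).app P.complex).f 1 := by
  rw [ProjectiveResolution.leftDerived_app_eq τ P 1]
  refine (Category.assoc _ _ _).trans (Eq.trans (congrArg _ ?_) (Category.assoc _ _ _).symm)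
  refine Eq.trans ?_ (homologyOneι_naturality (map_d_two_one_eq_zero P hP F)
    (map_d_two_one_eq_zero P hP G) ((NatTrans.mapHomologicalComplex τ _).app P.complex))
  refine (Category.assoc _ _ _).trans (congrArg _ ?_)
  exact (P.isoLeftDerivedObj G 1).inv_hom_id_assoc _

end

namespace ShortComplex.ShortExact

variable [HasProjectiveResolutions C] [MonoidalCategory C] [MonoidalPreadditive C]
  {S S' : ShortComplex C} (hS : S.ShortExact) (hS' : S'.ShortExact) [Projective S.X₁]
  [Projective S.X₂] [Projective S'.X₁] [Projective S'.X₂] (X Y : C)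

/-- The inclusion `Tor₁(X, S.X₃) ⟶ X ⊗ S.X₁` for a short exact sequence `S` in which `S.X₁` and
`S.X₂` are projective. -/
noncomputable def torι : ((Tor C 1).obj X).obj S.X₃ ⟶ X ⊗ S.X₁ :=
  leftDerivedOneι hS.projectiveResolution (twoTerm_d S.f 1) ((tensoringLeft C).obj X)

theorem mono_torι : Mono (hS.torι X) :=
  mono_leftDerivedOneι hS.projectiveResolution (twoTerm_d S.f 1) ((tensoringLeft C).obj X)

theorem torι_comp : hS.torι X ≫ X ◁ S.f = 0 := by
  have h : ((((tensoringLeft C).obj X).mapHomologicalComplex _).obj (twoTerm S.f)).d 1 0 =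
      X ◁ S.f :=
    (Functor.mapHomologicalComplex_obj_d _ _ _ _ _).trans
      (congrArg ((tensoringLeft C).obj X).map (twoTerm_d S.f 0))
  rw [← h]
  exact leftDerivedOneι_comp_d hS.projectiveResolution (twoTerm_d S.f 1)
    ((tensoringLeft C).obj X)

/-- Tensoring the resolution of length one with `X` leaves the single map `X ◁ S.f`, whose kernel is
the torsion product. What follows uses `Tor` only through this kernel property and the two
naturality squares below. -/
theorem exists_lift_torι {A : C} (a : A ⟶ X ⊗ S.X₁) (ha : a ≫ X ◁ S.f = 0) :
    ∃ t, t ≫ hS.torι X = a := by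
  have h : ((((tensoringLeft C).obj X).mapHomologicalComplex _).obj (twoTerm S.f)).d 1 0 =
      X ◁ S.f :=
    (Functor.mapHomologicalComplex_obj_d _ _ _ _ _).trans
      (congrArg ((tensoringLeft C).obj X).map (twoTerm_d S.f 0))
  rw [← h] at ha
  exact exists_lift_leftDerivedOneι hS.projectiveResolution (twoTerm_d S.f 1)
    ((tensoringLeft C).obj X) a ha

theorem torι_naturality_right (φ : S ⟶ S') :
    ((Tor C 1).obj X).map φ.τ₃ ≫ hS'.torι X = hS.torι X ≫ X ◁ φ.τ₁ :=
  leftDerivedOneι_naturality hS.projectiveResolution hS'.projectiveResolution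
    (twoTerm_d S.f 1) (twoTerm_d S'.f 1) ((tensoringLeft C).obj X) φ.τ₃
    (twoTermMap φ.τ₁ φ.τ₂ φ.comm₁₂) (by
      have e₁ : hS.projectiveResolution.π.f 0 = S.g :=
        ChainComplex.toSingle₀Equiv_symm_apply_f_zero (C := twoTerm S.f) _ _
      have e₂ : hS'.projectiveResolution.π.f 0 = S'.g :=
        ChainComplex.toSingle₀Equiv_symm_apply_f_zero (C := twoTerm S'.f) _ _
      rw [e₁, e₂]
      exact φ.comm₂₃)

variable {X Y} in
theorem torι_naturality_left (f : X ⟶ Y) :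
    ((Tor C 1).map f).app S.X₃ ≫ hS.torι Y = hS.torι X ≫ f ▷ S.X₁ :=
  leftDerivedOneι_naturality_functor hS.projectiveResolution (twoTerm_d S.f 1)
    ((tensoringLeft C).map f)

end ShortComplex.ShortExact

end CategoryTheory

/-! ### Elements of the homology of a complex of modules -/

/-- The factorisation of a linear map through a surjective one. -/
noncomputable def LinearMap.descSurjective {R M N P : Type*} [Ring R] [AddCommGroup M] [Module R M]
    [AddCommGroup N] [Module R N] [AddCommGroup P] [Module R P] (f : M →ₗ[R] N)
    (hf : Function.Surjective f) (g : M →ₗ[R] P) (h : ∀ x, f x = 0 → g x = 0) : N →ₗ[R] P :=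
  (LinearMap.ker f).liftQ g (fun x hx => h x hx) ∘ₗ
    (f.quotKerEquivOfSurjective hf).symm.toLinearMap

theorem LinearMap.descSurjective_apply {R M N P : Type*} [Ring R] [AddCommGroup M] [Module R M]
    [AddCommGroup N] [Module R N] [AddCommGroup P] [Module R P] (f : M →ₗ[R] N)
    (hf : Function.Surjective f) (g : M →ₗ[R] P) (h : ∀ x, f x = 0 → g x = 0) (x : M) :
    f.descSurjective hf g h (f x) = g x := by
  have : (f.quotKerEquivOfSurjective hf).symm (f x) = Submodule.Quotient.mk x := by
    rw [LinearEquiv.symm_apply_eq]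
    rfl
  rw [LinearMap.descSurjective, LinearMap.comp_apply, LinearEquiv.coe_coe, this]
  rfl

theorem ModuleCat.projective_of_module_free {R : Type} [CommRing R] (M : ModuleCat.{0} R)
    (_ : Module.Free R M) : Projective M :=
  (IsProjective.iff_projective M).1 Module.Projective.of_free

namespace ChainComplex

open TensorProduct

variable {R : Type} [CommRing R] (K L : ChainComplex (ModuleCat.{0} R) ℕ)

theorem iCycles_injective (n : ℕ) : Function.Injective (K.iCycles n).hom :=
  (ModuleCat.mono_iff_injective _).1 inferInstance

theorem homologyπ_surjective (n : ℕ) : Function.Surjective (K.homologyπ n).hom :=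
  (ModuleCat.epi_iff_surjective _).1 inferInstance

/-- Truncated subtraction agrees with the convention in degree `0`: there `next` is `0` and `d 0 0`
vanishes. Hence `K.d n (n - 1)` is the outgoing differential in every degree. -/
theorem next_eq_sub_one (n : ℕ) : (ComplexShape.down ℕ).next n = n - 1 := by
  cases n <;> simp

theorem exact_iCycles (n : ℕ) :
    Function.Exact (K.iCycles n).hom (K.d n (n - 1)).hom := by
  have h := ShortComplex.exact_of_f_is_kernel
    (ShortComplex.mk (K.iCycles n) (K.d n (n - 1)) (K.iCycles_d n (n - 1)))
    (K.cyclesIsKernel n (n - 1) (next_eq_sub_one n))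
  exact (ShortComplex.ShortExact.moduleCat_exact_iff_function_exact _).1 h

theorem exact_toCycles (n : ℕ) :
    Function.Exact (K.toCycles (n + 1) n).hom (K.homologyπ n).hom := by
  have h := ShortComplex.exact_of_g_is_cokernel
    (ShortComplex.mk (K.toCycles (n + 1) n) (K.homologyπ n) (K.toCycles_comp_homologyπ (n + 1) n))
    (K.homologyIsCokernel (n + 1) n (by simp))
  exact (ShortComplex.ShortExact.moduleCat_exact_iff_function_exact _).1 h

theorem iCycles_toCycles (n : ℕ) (x : K.X (n + 1)) :
    (K.iCycles n).hom ((K.toCycles (n + 1) n).hom x) = (K.d (n + 1) n).hom x :=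
  LinearMap.congr_fun (congrArg ModuleCat.Hom.hom (K.toCycles_i (n + 1) n)) x

theorem d_iCycles (n m : ℕ) (z : K.cycles n) : (K.d n m).hom ((K.iCycles n).hom z) = 0 :=
  LinearMap.congr_fun (congrArg ModuleCat.Hom.hom (K.iCycles_d n m)) z

theorem homologyπ_toCycles (n : ℕ) (x : K.X (n + 1)) :
    (K.homologyπ n).hom ((K.toCycles (n + 1) n).hom x) = 0 :=
  LinearMap.congr_fun (congrArg ModuleCat.Hom.hom (K.toCycles_comp_homologyπ (n + 1) n)) x

theorem toCycles_d (n : ℕ) (x : K.X (n + 2)) :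
    (K.toCycles (n + 1) n).hom ((K.d (n + 2) (n + 1)).hom x) = 0 :=
  LinearMap.congr_fun (congrArg ModuleCat.Hom.hom (K.d_toCycles (n + 2) (n + 1) n)) x

theorem exists_cycle {n : ℕ} (x : K.X n) (h : (K.d n (n - 1)).hom x = 0) :
    ∃ z, (K.iCycles n).hom z = x :=
  (exact_iCycles K n x).1 h

theorem homologyπ_eq_zero_iff {n : ℕ} (z : K.cycles n) :
    (K.homologyπ n).hom z = 0 ↔ ∃ y, (K.iCycles n).hom z = (K.d (n + 1) n).hom y := by
  rw [exact_toCycles K n z]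
  constructor
  · rintro ⟨y, rfl⟩
    exact ⟨y, iCycles_toCycles K n y⟩
  · rintro ⟨y, hy⟩
    exact ⟨y, iCycles_injective K n ((iCycles_toCycles K n y).trans hy.symm)⟩

variable {K L} in
theorem iCycles_cyclesMap (f : K ⟶ L) (n : ℕ) (z : K.cycles n) :
    (L.iCycles n).hom ((HomologicalComplex.cyclesMap f n).hom z) =
      (f.f n).hom ((K.iCycles n).hom z) :=
  LinearMap.congr_fun (congrArg ModuleCat.Hom.hom (HomologicalComplex.cyclesMap_i f n)) z

variable {K L} in
theorem homologyMap_homologyπ (f : K ⟶ L) (n : ℕ) (z : K.cycles n) :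
    (HomologicalComplex.homologyMap f n).hom ((K.homologyπ n).hom z) =
      (L.homologyπ n).hom ((HomologicalComplex.cyclesMap f n).hom z) :=
  LinearMap.congr_fun (congrArg ModuleCat.Hom.hom (HomologicalComplex.homologyπ_naturality f n)) z

variable {K L} in
theorem f_d (f : K ⟶ L) (n m : ℕ) (x : K.X n) :
    (f.f m).hom ((K.d n m).hom x) = (L.d n m).hom ((f.f n).hom x) :=
  LinearMap.congr_fun (congrArg ModuleCat.Hom.hom (f.comm n m).symm) x

/-! ### The resolution `0 ⟶ B_n ⟶ Z_n ⟶ H_n ⟶ 0` -/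

/-- The submodule of boundaries in the module of `n`-cycles. -/
noncomputable abbrev bounds (n : ℕ) : Submodule R (K.cycles n) :=
  LinearMap.range (K.toCycles (n + 1) n).hom

/-- The boundary map `K_{n+1} → B_n`. -/
noncomputable abbrev toBounds (n : ℕ) : K.X (n + 1) →ₗ[R] bounds K n :=
  (K.toCycles (n + 1) n).hom.rangeRestrict

/-- The short complex `B_n ⟶ Z_n ⟶ H_n`. -/
noncomputable abbrev homologyPresentation (n : ℕ) : ShortComplex (ModuleCat.{0} R) where
  X₁ := ModuleCat.of R (bounds K n)
  X₂ := K.cycles n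
  X₃ := K.homology n
  f := ModuleCat.ofHom (bounds K n).subtype
  g := K.homologyπ n
  zero := by
    ext ⟨_, y, rfl⟩
    exact homologyπ_toCycles K n y

theorem homologyPresentation_shortExact (n : ℕ) : (homologyPresentation K n).ShortExact where
  exact := by
    refine (ShortComplex.ShortExact.moduleCat_exact_iff_function_exact _).2 fun z => ?_
    rw [show (homologyPresentation K n).g.hom z = 0 ↔ _ from exact_toCycles K n z]
    constructor
    · rintro ⟨y, rfl⟩
      exact ⟨⟨_, y, rfl⟩, rfl⟩
    · rintro ⟨⟨_, y, rfl⟩, rfl⟩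
      exact ⟨y, rfl⟩
  mono_f := (ModuleCat.mono_iff_injective _).2 Subtype.val_injective
  epi_g := inferInstanceAs (Epi (K.homologyπ n))

variable {K L}

/-- The map induced on boundaries by a chain map. -/
noncomputable def boundsMap (f : K ⟶ L) (n : ℕ) : bounds K n →ₗ[R] bounds L n :=
  (HomologicalComplex.cyclesMap f n).hom.restrict (by
    rintro _ ⟨y, rfl⟩
    refine ⟨(f.f (n + 1)).hom y, iCycles_injective L n ?_⟩
    rw [iCycles_toCycles, iCycles_cyclesMap, iCycles_toCycles, f_d])

theorem boundsMap_toBounds (f : K ⟶ L) (n : ℕ) (y : K.X (n + 1)) :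
    boundsMap f n (toBounds K n y) = toBounds L n ((f.f (n + 1)).hom y) := by
  refine Subtype.ext (iCycles_injective L n ?_)
  refine (iCycles_cyclesMap f n _).trans ((congrArg _ (iCycles_toCycles K n y)).trans ?_)
  exact (f_d f _ _ y).trans (iCycles_toCycles L n _).symm

/-- The map of presentations of homology induced by a chain map. -/
noncomputable def homologyPresentationMap (f : K ⟶ L) (n : ℕ) :
    homologyPresentation K n ⟶ homologyPresentation L n where
  τ₁ := ModuleCat.ofHom (boundsMap f n)
  τ₂ := HomologicalComplex.cyclesMap f n
  τ₃ := HomologicalComplex.homologyMap f n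
  comm₁₂ := rfl
  comm₂₃ := (HomologicalComplex.homologyπ_naturality f n).symm

/-! ### Complexes of free modules -/

section Free

variable [IsDomain R] [IsPrincipalIdealRing R] (K) [∀ n, Module.Free R (K.X n)]

instance free_cycles (n : ℕ) : Module.Free R (K.cycles n) :=
  Module.Free.of_injective_of_pid _ (iCycles_injective K n)

instance free_bounds (n : ℕ) : Module.Free R (bounds K n) :=
  Module.Free.of_injective_of_pid (bounds K n).subtype Subtype.val_injective

instance flat_bounds (n : ℕ) : Module.Flat R (bounds K n) :=
  @Module.Flat.of_free _ _ _ _ _ (free_bounds K n)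

instance projective_cycles (n : ℕ) : Projective (K.cycles n) :=
  ModuleCat.projective_of_module_free _ (free_cycles K n)

instance projective_bounds (n : ℕ) : Projective (ModuleCat.of R (bounds K n)) :=
  ModuleCat.projective_of_module_free _ (free_bounds K n)

/-- The cycles are the kernel of a map into a free module, hence a direct summand. The choice of the
complement is what makes the Künneth splitting unnatural. -/
theorem exists_cycles_retraction (n : ℕ) :
    ∃ q : K.X n →ₗ[R] K.cycles n, ∀ z, q ((K.iCycles n).hom z) = z := by
  obtain ⟨q, hq⟩ := exists_retraction_of_free (K.d n (n - 1)).hom (K.iCycles n).hom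
    (iCycles_injective K n) (exact_iCycles K n).linearMap_ker_eq.symm
  exact ⟨q, fun z => LinearMap.congr_fun hq z⟩

/-- A chosen retraction of the module of chains onto the module of cycles. -/
noncomputable def cyclesRetraction (n : ℕ) : K.X n →ₗ[R] K.cycles n :=
  (exists_cycles_retraction K n).choose

theorem cyclesRetraction_iCycles (n : ℕ) (z : K.cycles n) :
    cyclesRetraction K n ((K.iCycles n).hom z) = z :=
  (exists_cycles_retraction K n).choose_spec z

/-- A chosen extension of the projection of cycles onto homology to all chains. -/
noncomputable def chainsToHomology (n : ℕ) : K.X n →ₗ[R] K.homology n :=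
  (K.homologyπ n).hom ∘ₗ cyclesRetraction K n

theorem chainsToHomology_iCycles (n : ℕ) (z : K.cycles n) :
    chainsToHomology K n ((K.iCycles n).hom z) = (K.homologyπ n).hom z :=
  congrArg (K.homologyπ n).hom (cyclesRetraction_iCycles K n z)

/-- Thus `chainsToHomology` is a chain map from `K` to its homology with zero differential, and it
induces the identity on homology. -/
theorem chainsToHomology_d (n : ℕ) (x : K.X (n + 1)) :
    chainsToHomology K n ((K.d (n + 1) n).hom x) = 0 := by
  rw [← iCycles_toCycles, chainsToHomology_iCycles, homologyπ_toCycles]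

end Free

end ChainComplex

/-! ### Complexes which decompose as tensor products -/

namespace ChainComplex

open TensorProduct KGraph

variable {R : Type} [CommRing R]

/-- An identification of `E` with the tensor product of the complexes `C` and `D`. -/
structure TensorDecomposition (C D E : ChainComplex (ModuleCat.{0} R) ℕ) where
  /-- The identification in degree `r`. -/
  equiv (r : ℕ) : E.X r ≃ₗ[R] ∀ p : TensorIndex r, C.X p.1.1 ⊗[R] D.X p.1.2
  equiv_d {i j r : ℕ} (h : i + j = r) (x : E.X (r + 1)) :
    equiv r ((E.d (r + 1) r).hom x) ⟨(i, j), h⟩ =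
      LinearMap.rTensor (D.X j) (C.d (i + 1) i).hom
          (equiv (r + 1) x ⟨(i + 1, j), by dsimp only; omega⟩) +
        (-1 : R) ^ i • LinearMap.lTensor (C.X i) (D.d (j + 1) j).hom
          (equiv (r + 1) x ⟨(i, j + 1), by dsimp only; omega⟩)

namespace TensorDecomposition

variable {C D E : ChainComplex (ModuleCat.{0} R) ℕ} (T : TensorDecomposition C D E)

/-- The component of bidegree `(i, j)`. -/
noncomputable def comp {i j r : ℕ} (h : i + j = r) : E.X r →ₗ[R] C.X i ⊗[R] D.X j :=
  LinearMap.proj (φ := fun p : TensorIndex r => C.X p.1.1 ⊗[R] D.X p.1.2) ⟨(i, j), h⟩ ∘ₗ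
    (T.equiv r).toLinearMap

open Classical in
/-- The inclusion of the summand of bidegree `(i, j)`. -/
noncomputable def single {i j r : ℕ} (h : i + j = r) : C.X i ⊗[R] D.X j →ₗ[R] E.X r :=
  (T.equiv r).symm.toLinearMap ∘ₗ
    LinearMap.single R (fun p : TensorIndex r => C.X p.1.1 ⊗[R] D.X p.1.2) ⟨(i, j), h⟩

theorem ext {r : ℕ} {x y : E.X r}
    (hxy : ∀ (i j : ℕ) (h : i + j = r), T.comp h x = T.comp h y) : x = y :=
  (T.equiv r).injective (funext fun p => hxy p.1.1 p.1.2 p.2)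

theorem comp_single_self {i j r : ℕ} (h : i + j = r) (t : C.X i ⊗[R] D.X j) :
    T.comp h (T.single h t) = t := by
  simp [comp, single]

theorem comp_single_of_ne {i j a b r : ℕ} (h : i + j = r) (h' : a + b = r) (hne : a ≠ i)
    (t : C.X i ⊗[R] D.X j) : T.comp h' (T.single h t) = 0 := by
  have : (⟨(a, b), h'⟩ : TensorIndex r) ≠ ⟨(i, j), h⟩ := fun e => hne (congrArg (fun p => p.1.1) e)
  simp [comp, single, this]

theorem exists_comp_eq {r : ℕ} (f : ∀ i j : ℕ, C.X i ⊗[R] D.X j) :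
    ∃ x : E.X r, ∀ (i j : ℕ) (h : i + j = r), T.comp h x = f i j :=
  ⟨(T.equiv r).symm fun p => f p.1.1 p.1.2, fun i j h => by simp [comp]⟩

theorem comp_d {i j r : ℕ} (h : i + j = r) (h₁ : i + 1 + j = r + 1) (h₂ : i + (j + 1) = r + 1)
    (x : E.X (r + 1)) : T.comp h ((E.d (r + 1) r).hom x) =
      LinearMap.rTensor (D.X j) (C.d (i + 1) i).hom (T.comp h₁ x) +
        (-1 : R) ^ i • LinearMap.lTensor (C.X i) (D.d (j + 1) j).hom (T.comp h₂ x) :=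
  T.equiv_d h x

/-- The differential of an element of one bidegree has two components; `ht` kills the one that
lowers the first degree. `d_single_left` is the mirror image. -/
theorem d_single_right {i j r : ℕ} (h : i + j = r) (h' : i + (j + 1) = r + 1)
    (t : C.X i ⊗[R] D.X (j + 1))
    (ht : LinearMap.rTensor (D.X (j + 1)) (C.d i (i - 1)).hom t = 0) :
    (E.d (r + 1) r).hom (T.single h' t) =
      T.single h ((-1 : R) ^ i • LinearMap.lTensor (C.X i) (D.d (j + 1) j).hom t) := by
  refine T.ext fun a b hab => ?_
  rw [T.comp_d hab (by omega) (by omega)]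
  by_cases hai : a = i
  · obtain rfl := hai
    obtain rfl : b = j := by omega
    rw [T.comp_single_self, T.comp_single_self, T.comp_single_of_ne _ _ (by omega), map_zero,
      zero_add]
  · rw [T.comp_single_of_ne h' _ hai, T.comp_single_of_ne h _ hai, map_zero, smul_zero, add_zero]
    by_cases hai' : a + 1 = i
    · obtain rfl := hai'
      obtain rfl : b = j + 1 := by omega
      rw [T.comp_single_self]
      exact ht
    · rw [T.comp_single_of_ne h' _ hai', map_zero]

theorem d_single_left {i j r : ℕ} (h : i + j = r) (h' : i + 1 + j = r + 1)
    (t : C.X (i + 1) ⊗[R] D.X j)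
    (ht : LinearMap.lTensor (C.X (i + 1)) (D.d j (j - 1)).hom t = 0) :
    (E.d (r + 1) r).hom (T.single h' t) =
      T.single h (LinearMap.rTensor (D.X j) (C.d (i + 1) i).hom t) := by
  refine T.ext fun a b hab => ?_
  rw [T.comp_d hab (by omega) (by omega)]
  by_cases hai : a = i
  · obtain rfl := hai
    obtain rfl : b = j := by omega
    rw [T.comp_single_self, T.comp_single_self, T.comp_single_of_ne _ _ (by omega), map_zero,
      smul_zero, add_zero]
  · rw [T.comp_single_of_ne h' _ (by omega), T.comp_single_of_ne h _ hai, map_zero, zero_add]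
    by_cases hai' : a = i + 1
    · obtain rfl := hai'
      obtain rfl : j = b + 1 := by omega
      rw [T.comp_single_self]
      exact (congrArg _ ht).trans (smul_zero _)
    · rw [T.comp_single_of_ne h' _ hai', map_zero, smul_zero]

theorem d_single_eq_zero {i j r : ℕ} (h : i + j = r) (t : C.X i ⊗[R] D.X j)
    (ht₁ : LinearMap.rTensor (D.X j) (C.d i (i - 1)).hom t = 0)
    (ht₂ : LinearMap.lTensor (C.X i) (D.d j (j - 1)).hom t = 0) :
    (E.d r (r - 1)).hom (T.single h t) = 0 := by
  cases r with
  | zero => rw [E.shape _ _ (by simp)]; rfl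
  | succ r =>
    refine T.ext fun a b hab => ?_
    refine (T.comp_d hab (by omega) (by omega) _).trans ?_
    rw [map_zero]
    by_cases hai : a = i
    · obtain rfl := hai
      obtain rfl : j = b + 1 := by omega
      rw [T.comp_single_self, T.comp_single_of_ne _ _ (by omega), map_zero, zero_add]
      exact (congrArg _ ht₂).trans (smul_zero _)
    · rw [T.comp_single_of_ne h _ hai, map_zero, smul_zero, add_zero]
      by_cases hai' : a + 1 = i
      · obtain rfl := hai'
        obtain rfl : b = j := by omega
        rw [T.comp_single_self]
        exact ht₁
      · rw [T.comp_single_of_ne h _ hai', map_zero]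

/-! ### The homology product -/

/-- The product of cycles. -/
noncomputable def cyclesProduct {i j r : ℕ} (h : i + j = r) :
    C.cycles i ⊗[R] D.cycles j →ₗ[R] E.cycles r :=
  (E.liftCycles (A := ModuleCat.of R (C.cycles i ⊗[R] D.cycles j))
    (ModuleCat.ofHom (T.single h ∘ₗ TensorProduct.map (C.iCycles i).hom (D.iCycles j).hom))
    (r - 1) (next_eq_sub_one r) (by
      refine ModuleCat.hom_ext (TensorProduct.ext' fun z z' => ?_)
      refine T.d_single_eq_zero h _ ?_ ?_
      · rw [TensorProduct.map_tmul, LinearMap.rTensor_tmul, d_iCycles, zero_tmul]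
      · rw [TensorProduct.map_tmul, LinearMap.lTensor_tmul, d_iCycles, tmul_zero])).hom

theorem iCycles_cyclesProduct {i j r : ℕ} (h : i + j = r) (t : C.cycles i ⊗[R] D.cycles j) :
    (E.iCycles r).hom (T.cyclesProduct h t) =
      T.single h (TensorProduct.map (C.iCycles i).hom (D.iCycles j).hom t) :=
  LinearMap.congr_fun (congrArg ModuleCat.Hom.hom
    (E.liftCycles_i (A := ModuleCat.of R (C.cycles i ⊗[R] D.cycles j))
      (ModuleCat.ofHom (T.single h ∘ₗ TensorProduct.map (C.iCycles i).hom (D.iCycles j).hom))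
      (r - 1) (next_eq_sub_one r) _)) t

theorem map_homologyπ_surjective (C D : ChainComplex (ModuleCat.{0} R) ℕ) (i j : ℕ) :
    Function.Surjective (TensorProduct.map (C.homologyπ i).hom (D.homologyπ j).hom) :=
  TensorProduct.map_surjective (homologyπ_surjective C i) (homologyπ_surjective D j)

/-- By right exactness the kernel of `Z_i ⊗ Z_j → H_i ⊗ H_j` is generated by products of a cycle and
a boundary in either order, and such a product is the boundary of a product. This makes the product
well defined on homology. -/
theorem homologyπ_cyclesProduct {i j r : ℕ} (h : i + j = r) (t : C.cycles i ⊗[R] D.cycles j)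
    (ht : TensorProduct.map (C.homologyπ i).hom (D.homologyπ j).hom t = 0) :
    (E.homologyπ r).hom (T.cyclesProduct h t) = 0 := by
  have h₁ : t ∈ LinearMap.ker (TensorProduct.map (C.homologyπ i).hom (D.homologyπ j).hom) := ht
  rw [TensorProduct.map_ker (exact_toCycles C i) (homologyπ_surjective C i) (exact_toCycles D j)
    (homologyπ_surjective D j)] at h₁
  obtain ⟨_, ⟨a, rfl⟩, _, ⟨b, rfl⟩, rfl⟩ := Submodule.mem_sup.1 h₁
  rw [map_add, map_add]
  refine (congrArg₂ (· + ·) ?_ ?_).trans (add_zero (0 : E.homology r))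
  · rw [homologyπ_eq_zero_iff]
    -- The factor `(-1)^i` cancels the sign in the Leibniz rule.
    refine ⟨T.single (i := i) (j := j + 1) (by omega)
      ((-1 : R) ^ i • TensorProduct.map (C.iCycles i).hom LinearMap.id a), ?_⟩
    rw [iCycles_cyclesProduct, T.d_single_right h]
    · congr 1
      rw [map_smul, smul_smul, ← pow_add, Even.neg_one_pow ⟨i, rfl⟩, one_smul]
      clear h₁ ht
      induction a with
      | zero => simp
      | add x y hx hy => simp only [map_add, hx, hy]
      | tmul x y => simp [iCycles_toCycles]
    · rw [map_smul]
      refine (congrArg _ ?_).trans (smul_zero _)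
      clear h₁ ht
      induction a with
      | zero => simp
      | add x y hx hy => simp only [map_add, hx, hy, add_zero]
      | tmul x y => simp [d_iCycles]
  · rw [homologyπ_eq_zero_iff]
    refine ⟨T.single (i := i + 1) (j := j) (by omega)
      (TensorProduct.map LinearMap.id (D.iCycles j).hom b), ?_⟩
    rw [iCycles_cyclesProduct, T.d_single_left h]
    · congr 1
      clear h₁ ht
      induction b with
      | zero => simp
      | add x y hx hy => simp only [map_add, hx, hy]
      | tmul x y => simp [iCycles_toCycles]
    · clear h₁ ht
      induction b with
      | zero => simp
      | add x y hx hy => simp only [map_add, hx, hy, add_zero]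
      | tmul x y => simp [d_iCycles]

/-- The homology product in bidegree `(i, j)`. -/
noncomputable def homologyProduct {i j r : ℕ} (h : i + j = r) :
    C.homology i ⊗[R] D.homology j →ₗ[R] E.homology r :=
  LinearMap.descSurjective _ (map_homologyπ_surjective C D i j)
    ((E.homologyπ r).hom ∘ₗ T.cyclesProduct h) (T.homologyπ_cyclesProduct h)

theorem homologyProduct_map {i j r : ℕ} (h : i + j = r) (t : C.cycles i ⊗[R] D.cycles j) :
    T.homologyProduct h (TensorProduct.map (C.homologyπ i).hom (D.homologyπ j).hom t) =
      (E.homologyπ r).hom (T.cyclesProduct h t) :=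
  LinearMap.descSurjective_apply _ _ _ _ t

end TensorDecomposition

end ChainComplex

namespace ChainComplex

open TensorProduct KGraph

variable {R : Type} [CommRing R]

/-! ### Composites of differentials with the cycle, boundary and retraction maps -/

theorem iCycles_comp_toCycles (K : ChainComplex (ModuleCat.{0} R) ℕ) (n : ℕ) :
    (K.iCycles n).hom ∘ₗ (K.toCycles (n + 1) n).hom = (K.d (n + 1) n).hom :=
  LinearMap.ext (iCycles_toCycles K n)

theorem d_comp_iCycles (K : ChainComplex (ModuleCat.{0} R) ℕ) (n m : ℕ) :
    (K.d n m).hom ∘ₗ (K.iCycles n).hom = 0 :=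
  LinearMap.ext (d_iCycles K n m)

theorem toBounds_comp_d (K : ChainComplex (ModuleCat.{0} R) ℕ) (n : ℕ) :
    toBounds K n ∘ₗ (K.d (n + 2) (n + 1)).hom = 0 :=
  LinearMap.ext fun x => Subtype.ext (toCycles_d K n x)

theorem toBounds_comp_iCycles (K : ChainComplex (ModuleCat.{0} R) ℕ) (n : ℕ) :
    toBounds K n ∘ₗ (K.iCycles (n + 1)).hom = 0 :=
  LinearMap.ext fun x => Subtype.ext (iCycles_injective K n
    ((iCycles_toCycles K n _).trans ((d_iCycles K _ _ x).trans (map_zero _).symm)))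

/-- The inclusion of the module of boundaries in the module of chains. -/
noncomputable abbrev boundsIncl (K : ChainComplex (ModuleCat.{0} R) ℕ) (n : ℕ) :
    bounds K n →ₗ[R] K.X n :=
  (K.iCycles n).hom ∘ₗ (bounds K n).subtype

theorem boundsIncl_injective (K : ChainComplex (ModuleCat.{0} R) ℕ) (n : ℕ) :
    Function.Injective (boundsIncl K n) :=
  (iCycles_injective K n).comp Subtype.val_injective

theorem boundsIncl_comp_toBounds (K : ChainComplex (ModuleCat.{0} R) ℕ) (n : ℕ) :
    boundsIncl K n ∘ₗ toBounds K n = (K.d (n + 1) n).hom :=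
  LinearMap.ext (iCycles_toCycles K n)

theorem d_comp_d_hom (K : ChainComplex (ModuleCat.{0} R) ℕ) (a b c : ℕ) :
    (K.d b c).hom ∘ₗ (K.d a b).hom = 0 :=
  congrArg ModuleCat.Hom.hom (K.d_comp_d a b c)

section

variable [IsDomain R] [IsPrincipalIdealRing R] (K : ChainComplex (ModuleCat.{0} R) ℕ)
  [∀ n, Module.Free R (K.X n)]

theorem chainsToHomology_comp_iCycles (n : ℕ) :
    chainsToHomology K n ∘ₗ (K.iCycles n).hom = (K.homologyπ n).hom :=
  LinearMap.ext (chainsToHomology_iCycles K n)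

theorem chainsToHomology_comp_d (n : ℕ) :
    chainsToHomology K n ∘ₗ (K.d (n + 1) n).hom = 0 :=
  LinearMap.ext (chainsToHomology_d K n)

theorem cyclesRetraction_comp_d (n : ℕ) :
    cyclesRetraction K n ∘ₗ (K.d (n + 1) n).hom = (K.toCycles (n + 1) n).hom := by
  refine LinearMap.ext fun x => ?_
  rw [LinearMap.comp_apply, ← iCycles_toCycles, cyclesRetraction_iCycles]

end

namespace TensorDecomposition

variable {C D E : ChainComplex (ModuleCat.{0} R) ℕ} (T : TensorDecomposition C D E)

/-- The component in bidegree `(i, j)` of the cycle condition, solved for its `1 ⊗ d` term. Any map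
that kills the image of `d ⊗ 1` therefore kills this term as well. -/
theorem lTensor_d_comp {i j r : ℕ} (h : i + j = r) (h₁ : i + 1 + j = r + 1)
    (h₂ : i + (j + 1) = r + 1) (z : E.cycles (r + 1)) :
    LinearMap.lTensor (C.X i) (D.d (j + 1) j).hom (T.comp h₂ ((E.iCycles _).hom z)) =
      LinearMap.rTensor (D.X j) (C.d (i + 1) i).hom
        (-((-1 : R) ^ i • T.comp h₁ ((E.iCycles _).hom z))) := by
  have e := T.comp_d h h₁ h₂ ((E.iCycles _).hom z)
  rw [d_iCycles, map_zero] at e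
  have e' := congrArg (fun t => (-1 : R) ^ i • t) e
  simp only [smul_zero, smul_add, smul_smul, ← pow_add, Even.neg_one_pow ⟨i, rfl⟩, one_smul] at e'
  rw [map_neg, map_smul]
  exact (neg_eq_of_add_eq_zero_right e'.symm).symm

variable [IsDomain R] [IsPrincipalIdealRing R] [∀ n, Module.Free R (C.X n)]

/-! ### The map to the torsion product -/

/-- The relevant component of a boundary is a sum of a `d ⊗ 1` term and a `1 ⊗ d` term.
`chainsToHomology` kills the first, and `d ∘ d = 0` kills the second. -/
theorem map_chainsToHomology_toBounds_eq_zero {i j r : ℕ} (h : i + (j + 1) = r) (z : E.cycles r)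
    (hz : (E.homologyπ r).hom z = 0) :
    TensorProduct.map (chainsToHomology C i) (toBounds D j)
      (T.comp h ((E.iCycles r).hom z)) = 0 := by
  obtain ⟨y, hy⟩ := (homologyπ_eq_zero_iff E z).1 hz
  rw [hy, T.comp_d h (by omega) (by omega), map_add, map_smul]
  simp only [LinearMap.lTensor, LinearMap.rTensor, TensorProduct.map_map,
    chainsToHomology_comp_d, toBounds_comp_d, TensorProduct.map_zero_left,
    TensorProduct.map_zero_right, LinearMap.zero_apply, smul_zero, add_zero]

/-- The map `H_r(E) → H_i(C) ⊗ B_j(D)` which sends the class of a cycle `x` to the class of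
`(1 ⊗ d) x`. -/
noncomputable def toHomologyTensorBounds {i j r : ℕ} (h : i + j + 1 = r) :
    E.homology r →ₗ[R] C.homology i ⊗[R] bounds D j :=
  LinearMap.descSurjective _ (homologyπ_surjective E r)
    (TensorProduct.map (chainsToHomology C i) (toBounds D j) ∘ₗ
      T.comp (i := i) (j := j + 1) h ∘ₗ (E.iCycles r).hom)
    (T.map_chainsToHomology_toBounds_eq_zero (i := i) (j := j) h)

theorem toHomologyTensorBounds_homologyπ {i j r : ℕ} (h : i + j + 1 = r) (z : E.cycles r) :
    T.toHomologyTensorBounds h ((E.homologyπ r).hom z) =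
      TensorProduct.map (chainsToHomology C i) (toBounds D j)
        (T.comp (i := i) (j := j + 1) h ((E.iCycles r).hom z)) :=
  LinearMap.descSurjective_apply _ _ _ _ z

/-- The second factor of a product of cycles is a cycle, so `1 ⊗ d` kills it. -/
theorem toHomologyTensorBounds_homologyProduct {i j a b r : ℕ} (h : i + j = r)
    (h' : a + b + 1 = r) (t : C.homology i ⊗[R] D.homology j) :
    T.toHomologyTensorBounds h' (T.homologyProduct h t) = 0 := by
  obtain ⟨t, rfl⟩ := map_homologyπ_surjective C D i j t
  rw [homologyProduct_map, toHomologyTensorBounds_homologyπ, iCycles_cyclesProduct]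
  by_cases hai : a = i
  · obtain rfl := hai
    obtain rfl : j = b + 1 := by omega
    rw [comp_single_self, TensorProduct.map_map, toBounds_comp_iCycles,
      TensorProduct.map_zero_right, LinearMap.zero_apply]
  · rw [T.comp_single_of_ne _ _ hai, map_zero]

/-- Surjectivity of `β`, one summand at a time. Lift `t` to `x₀` in `Z_i ⊗ D_{j+1}`. Since `t` dies
in `H_i ⊗ Z_j`, the element `(1 ⊗ d) x₀` equals `(d ⊗ 1) y` for some `y` in `C_{i+1} ⊗ Z_j`, and
`x₀` corrected by `y` is a cycle. The correction has cycles as second factors, so it is invisible to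
all components of `β`. -/
theorem exists_toHomologyTensorBounds_eq {i j r : ℕ} (h : i + j + 1 = r)
    (t : C.homology i ⊗[R] bounds D j)
    (ht : LinearMap.lTensor (C.homology i) (bounds D j).subtype t = 0) :
    ∃ x : E.homology r, T.toHomologyTensorBounds h x = t ∧
      ∀ (a b : ℕ) (h' : a + b + 1 = r), a ≠ i → T.toHomologyTensorBounds h' x = 0 := by
  obtain ⟨s, rfl⟩ : ∃ s : C.cycles i ⊗[R] bounds D j,
      TensorProduct.map (C.homologyπ i).hom LinearMap.id s = t :=
    TensorProduct.map_surjective (homologyπ_surjective C i) Function.surjective_id t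
  obtain ⟨x₀, rfl⟩ : ∃ x₀ : C.cycles i ⊗[R] D.X (j + 1),
      TensorProduct.map LinearMap.id (toBounds D j) x₀ = s :=
    TensorProduct.map_surjective Function.surjective_id
      (LinearMap.surjective_rangeRestrict _) s
  -- Exactness of `C_{i+1} ⊗ Z_j → Z_i ⊗ Z_j → H_i ⊗ Z_j` turns the hypothesis on `t` into the
  -- element `y`.
  obtain ⟨y, hy⟩ := (rTensor_exact (D.cycles j) (exact_toCycles C i)
    (homologyπ_surjective C i) (TensorProduct.map LinearMap.id (D.toCycles (j + 1) j).hom x₀)).1 (by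
      simp only [LinearMap.lTensor, LinearMap.rTensor, TensorProduct.map_map, LinearMap.id_comp,
        LinearMap.comp_id] at ht ⊢
      exact ht)
  obtain rfl := h
  -- The sign makes the differentials of the two terms both equal to `(-1)^i (1 ⊗ d) x₀`.
  let v : E.X (i + j + 1) := T.single (i := i) (j := j + 1) rfl
      (TensorProduct.map (C.iCycles i).hom LinearMap.id x₀) -
    T.single (i := i + 1) (j := j) (by omega)
      ((-1 : R) ^ i • TensorProduct.map LinearMap.id (D.iCycles j).hom y)
  have hv : (E.d (i + j + 1) (i + j)).hom v = 0 := by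
    rw [map_sub, T.d_single_right (i := i) (j := j) rfl, T.d_single_left (i := i) (j := j) rfl,
      sub_eq_zero]
    · congr 1
      rw [map_smul]
      congr 1
      have e := congrArg (TensorProduct.map (C.iCycles i).hom (D.iCycles j).hom) hy
      simp only [LinearMap.lTensor, LinearMap.rTensor, TensorProduct.map_map, LinearMap.id_comp,
        LinearMap.comp_id, iCycles_comp_toCycles] at e ⊢
      exact e.symm
    · rw [map_smul, LinearMap.lTensor, TensorProduct.map_map, d_comp_iCycles,
        TensorProduct.map_zero_right, LinearMap.zero_apply, smul_zero]
    · rw [LinearMap.rTensor, TensorProduct.map_map, d_comp_iCycles,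
        TensorProduct.map_zero_left, LinearMap.zero_apply]
  obtain ⟨z, hz⟩ := exists_cycle E v hv
  refine ⟨(E.homologyπ _).hom z, ?_, fun a b h' hne => ?_⟩
  · rw [toHomologyTensorBounds_homologyπ, hz, map_sub, T.comp_single_self,
      T.comp_single_of_ne _ _ (by omega), sub_zero, TensorProduct.map_map, TensorProduct.map_map,
      chainsToHomology_comp_iCycles]
    rfl
  · rw [toHomologyTensorBounds_homologyπ, hz, map_sub, T.comp_single_of_ne _ _ hne, zero_sub]
    by_cases hai : a = i + 1
    · obtain rfl := hai
      obtain rfl : j = b + 1 := by omega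
      rw [T.comp_single_self, map_neg, map_smul, TensorProduct.map_map, toBounds_comp_iCycles,
        TensorProduct.map_zero_right, LinearMap.zero_apply, smul_zero, neg_zero]
    · rw [T.comp_single_of_ne _ _ hai, neg_zero, map_zero]

variable [∀ n, Module.Free R (D.X n)]

/-- The cycle condition writes `(1 ⊗ d) x` as a `d ⊗ 1` term, so `d ⊗ 1` kills it; as `B_j` is flat,
it lies in `Z_i ⊗ B_j`. On that submodule `chainsToHomology` does not depend on the chosen
retraction. -/
theorem exists_cycles_tensor_bounds {i j r : ℕ} (h : i + j + 1 = r) (z : E.cycles r) :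
    ∃ u : C.cycles i ⊗[R] bounds D j,
      TensorProduct.map (C.iCycles i).hom LinearMap.id u =
        TensorProduct.map LinearMap.id (toBounds D j)
          (T.comp (i := i) (j := j + 1) h ((E.iCycles r).hom z)) := by
  obtain rfl := h
  refine (Module.Flat.rTensor_exact (bounds D j) (exact_iCycles C i) _).1 ?_
  -- Flatness of `C_{i-1}` allows the vanishing to be tested in `C_{i-1} ⊗ D_j` instead of `C_{i-1}
  -- ⊗ B_j`, where the cycle condition applies.
  refine Module.Flat.lTensor_preserves_injective_linearMap (boundsIncl D j)
    (boundsIncl_injective D j) ?_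
  have e := T.lTensor_d_comp (i := i) (j := j) rfl (by omega) (by omega) z
  have e' := congrArg (LinearMap.rTensor (D.X j) (C.d i (i - 1)).hom) e
  rw [map_zero]
  simp only [LinearMap.lTensor, LinearMap.rTensor, TensorProduct.map_map, LinearMap.id_comp,
    LinearMap.comp_id, d_comp_d_hom, TensorProduct.map_zero_left, LinearMap.zero_apply,
    boundsIncl_comp_toBounds] at e' ⊢
  exact e'

/-- The image of `toHomologyTensorBounds` lies in the kernel which computes the torsion
product. -/
theorem lTensor_toHomologyTensorBounds {i j r : ℕ} (h : i + j + 1 = r) (x : E.homology r) :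
    LinearMap.lTensor (C.homology i) (bounds D j).subtype (T.toHomologyTensorBounds h x) = 0 := by
  obtain rfl := h
  obtain ⟨z, rfl⟩ := homologyπ_surjective E _ x
  have e := T.lTensor_d_comp (i := i) (j := j) rfl (by omega) (by omega) z
  -- On the left, the retraction after `d` is the boundary map into `Z_j`; on the right,
  -- `chainsToHomology` kills the image of `d`.
  have e' := congrArg (TensorProduct.map (chainsToHomology C i) (cyclesRetraction D j)) e
  rw [toHomologyTensorBounds_homologyπ]
  simp only [LinearMap.lTensor, LinearMap.rTensor, TensorProduct.map_map, LinearMap.id_comp,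
    LinearMap.comp_id, chainsToHomology_comp_d, TensorProduct.map_zero_left, LinearMap.zero_apply,
    cyclesRetraction_comp_d] at e' ⊢
  exact e'

/-! ### Exactness -/

/-- The projection of the homology of `E` onto `H_i(C) ⊗ H_j(D)` determined by the chosen
retractions. -/
noncomputable def homologyRetraction {i j r : ℕ} (h : i + j = r) :
    E.homology r →ₗ[R] C.homology i ⊗[R] D.homology j :=
  LinearMap.descSurjective _ (homologyπ_surjective E r)
    (TensorProduct.map (chainsToHomology C i) (chainsToHomology D j) ∘ₗ T.comp h ∘ₗ
      (E.iCycles r).hom) fun z hz => by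
    obtain ⟨y, hy⟩ := (homologyπ_eq_zero_iff E z).1 hz
    rw [LinearMap.comp_apply, LinearMap.comp_apply, hy, T.comp_d h (by omega) (by omega), map_add,
      map_smul]
    simp only [LinearMap.lTensor, LinearMap.rTensor, TensorProduct.map_map,
      chainsToHomology_comp_d, TensorProduct.map_zero_left, TensorProduct.map_zero_right,
      LinearMap.zero_apply, smul_zero, add_zero]

theorem homologyRetraction_homologyπ {i j r : ℕ} (h : i + j = r) (z : E.cycles r) :
    T.homologyRetraction h ((E.homologyπ r).hom z) =
      TensorProduct.map (chainsToHomology C i) (chainsToHomology D j)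
        (T.comp h ((E.iCycles r).hom z)) :=
  LinearMap.descSurjective_apply _ _ _ _ z

/-- On cycles both maps `chainsToHomology` are the projections to homology, whichever retractions
were chosen. -/
theorem homologyRetraction_homologyProduct {i j r : ℕ} (h : i + j = r)
    (t : C.homology i ⊗[R] D.homology j) :
    T.homologyRetraction h (T.homologyProduct h t) = t := by
  obtain ⟨t, rfl⟩ := map_homologyπ_surjective C D i j t
  rw [homologyProduct_map, homologyRetraction_homologyπ, iCycles_cyclesProduct, comp_single_self,
    TensorProduct.map_map, chainsToHomology_comp_iCycles, chainsToHomology_comp_iCycles]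

theorem homologyRetraction_homologyProduct_of_ne {i j a b r : ℕ} (h : i + j = r) (h' : a + b = r)
    (hne : a ≠ i) (t : C.homology i ⊗[R] D.homology j) :
    T.homologyRetraction h' (T.homologyProduct h t) = 0 := by
  obtain ⟨t, rfl⟩ := map_homologyπ_surjective C D i j t
  rw [homologyProduct_map, homologyRetraction_homologyπ, iCycles_cyclesProduct,
    T.comp_single_of_ne _ _ hne, map_zero]

/-- By `exists_cycles_tensor_bounds` the element lies in `Z_i ⊗ B_j`. If it vanishes in `H_i ⊗ B_j`,
it comes from `C_{i+1} ⊗ B_j`, and from there it lifts to chains because `D_{j+1} → B_j` is onto. -/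
theorem exists_map_d_toBounds_eq {i j r : ℕ} (h : i + j + 1 = r) (z : E.cycles r)
    (hz : T.toHomologyTensorBounds h ((E.homologyπ r).hom z) = 0) :
    ∃ y : C.X (i + 1) ⊗[R] D.X (j + 1),
      TensorProduct.map LinearMap.id (toBounds D j)
          (T.comp (i := i) (j := j + 1) h ((E.iCycles r).hom z)) =
        TensorProduct.map (C.d (i + 1) i).hom (toBounds D j) y := by
  obtain ⟨u, hu⟩ := T.exists_cycles_tensor_bounds h z
  have e := congrArg (TensorProduct.map (chainsToHomology C i) LinearMap.id) hu
  rw [TensorProduct.map_map, TensorProduct.map_map, LinearMap.comp_id,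
    LinearMap.comp_id, LinearMap.id_comp, ← toHomologyTensorBounds_homologyπ, hz, chainsToHomology_comp_iCycles] at e
  obtain ⟨w, rfl⟩ := (rTensor_exact (bounds D j) (exact_toCycles C i)
    (homologyπ_surjective C i) u).1 e
  obtain ⟨y, rfl⟩ : ∃ y : C.X (i + 1) ⊗[R] D.X (j + 1),
      TensorProduct.map LinearMap.id (toBounds D j) y = w :=
    TensorProduct.map_surjective Function.surjective_id
      (LinearMap.surjective_rangeRestrict _) w
  refine ⟨y, hu.symm.trans ?_⟩
  rw [LinearMap.rTensor, TensorProduct.map_map, TensorProduct.map_map, LinearMap.comp_id,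
    LinearMap.id_comp, LinearMap.id_comp, iCycles_comp_toCycles]

/-- Subtract the boundary of the sum of all the chains `y`. In bidegree `(i, j + 1)` its `d ⊗ 1`
part cancels the component of `z` modulo the kernel of `1 ⊗ d`, and its `1 ⊗ d` part lies in that
kernel. One boundary thus serves all bidegrees at once. -/
theorem exists_homologous_cycle {r : ℕ} (z : E.cycles r)
    (hz : ∀ (i j : ℕ) (h : i + j + 1 = r),
      T.toHomologyTensorBounds h ((E.homologyπ r).hom z) = 0) :
    ∃ z' : E.cycles r, (E.homologyπ r).hom z' = (E.homologyπ r).hom z ∧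
      ∀ (i j : ℕ) (h : i + j + 1 = r), TensorProduct.map LinearMap.id (toBounds D j)
          (T.comp (i := i) (j := j + 1) h ((E.iCycles r).hom z')) = 0 := by
  choose y hy using fun i j h => T.exists_map_d_toBounds_eq (i := i) (j := j) h z (hz i j h)
  -- The chain `y i j` sits in bidegree `(i + 1, j + 1)`; bidegrees with a zero entry get no
  -- correction.
  let f : ∀ i j : ℕ, C.X i ⊗[R] D.X j := fun
    | 0, _ => 0
    | _ + 1, 0 => 0
    | i + 1, j + 1 => if h : i + j + 1 = r then y i j h else 0
  obtain ⟨Y, hY⟩ := T.exists_comp_eq (r := r + 1) f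
  refine ⟨z - (E.toCycles (r + 1) r).hom Y, ?_, fun i j h => ?_⟩
  · rw [map_sub, homologyπ_toCycles, sub_zero]
  · rw [map_sub, iCycles_toCycles, map_sub, map_sub, hy i j h,
      T.comp_d (i := i) (j := j + 1) h (by omega) (by omega), hY, hY, map_add, map_smul]
    have hf : f (i + 1) (j + 1) = y i j h := dif_pos h
    rw [hf, LinearMap.lTensor, LinearMap.rTensor, TensorProduct.map_map, TensorProduct.map_map,
      toBounds_comp_d, TensorProduct.map_zero_right, LinearMap.zero_apply, smul_zero, add_zero,
      LinearMap.id_comp, LinearMap.comp_id, sub_self]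

/-- For flat modules the kernels of `1 ⊗ d` and `d ⊗ 1` are `C_i ⊗ Z_j` and `Z_i ⊗ D_j`, and their
intersection is `Z_i ⊗ Z_j`. -/
theorem exists_tensor_cycles (i j : ℕ) (t : C.X i ⊗[R] D.X j)
    (ht₁ : LinearMap.rTensor (D.X j) (C.d i (i - 1)).hom t = 0)
    (ht₂ : LinearMap.lTensor (C.X i) (D.d j (j - 1)).hom t = 0) :
    ∃ u : C.cycles i ⊗[R] D.cycles j,
      TensorProduct.map (C.iCycles i).hom (D.iCycles j).hom u = t := by
  obtain ⟨s, rfl⟩ := (Module.Flat.lTensor_exact (C.X i) (exact_iCycles D j) t).1 ht₂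
  have := free_cycles D j
  have hs : LinearMap.rTensor (D.cycles j) (C.d i (i - 1)).hom s = 0 := by
    refine Module.Flat.lTensor_preserves_injective_linearMap (M := C.X (i - 1)) (D.iCycles j).hom
      (iCycles_injective D j) ?_
    rw [map_zero]
    simp only [LinearMap.lTensor, LinearMap.rTensor, TensorProduct.map_map, LinearMap.id_comp,
      LinearMap.comp_id] at ht₁ ⊢
    exact ht₁
  obtain ⟨u, rfl⟩ := (Module.Flat.rTensor_exact (D.cycles j) (exact_iCycles C i) s).1 hs
  refine ⟨u, ?_⟩
  rw [LinearMap.lTensor, LinearMap.rTensor, TensorProduct.map_map, LinearMap.id_comp,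
    LinearMap.comp_id]

/-- Once `1 ⊗ d` kills every component, the cycle condition forces `d ⊗ 1` to kill every component
too. -/
theorem exists_cyclesProduct_comp {r : ℕ} (z : E.cycles r)
    (hz : ∀ (i j : ℕ) (h : i + j + 1 = r), TensorProduct.map LinearMap.id (toBounds D j)
          (T.comp (i := i) (j := j + 1) h ((E.iCycles r).hom z)) = 0)
    {i j : ℕ} (h : i + j = r) :
    ∃ u : C.cycles i ⊗[R] D.cycles j,
      TensorProduct.map (C.iCycles i).hom (D.iCycles j).hom u = T.comp h ((E.iCycles r).hom z) := by
  have key : ∀ (i j : ℕ) (h : i + j = r), LinearMap.lTensor (C.X i) (D.d j (j - 1)).hom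
      (T.comp h ((E.iCycles r).hom z)) = 0 := by
    intro i j h
    cases j with
    | zero =>
      rw [D.shape _ _ (by simp)]
      rw [ModuleCat.hom_zero, LinearMap.lTensor_zero, LinearMap.zero_apply]
    | succ j =>
      have e := congrArg (LinearMap.lTensor (C.X i) (boundsIncl D j)) (hz i j h)
      rw [LinearMap.lTensor, TensorProduct.map_map, boundsIncl_comp_toBounds, LinearMap.comp_id,
        map_zero] at e
      exact e
  refine exists_tensor_cycles i j _ ?_ (key i j h)
  cases i with
  | zero =>
    rw [C.shape _ _ (by simp)]
    rw [ModuleCat.hom_zero, LinearMap.rTensor_zero, LinearMap.zero_apply]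
  | succ i =>
    obtain ⟨s, rfl⟩ : ∃ s, r = s + 1 := ⟨i + j, by omega⟩
    have e := T.comp_d (i := i) (j := j) (by omega) h (by omega) ((E.iCycles _).hom z)
    have e₂ := key i (j + 1) (by omega)
    rw [d_iCycles, map_zero] at e
    refine (e.trans ((congrArg _ ?_).trans (add_zero _))).symm
    exact (congrArg _ e₂).trans (smul_zero _)

/-- Exactness in the middle: a homologous cycle has all its components in `Z_i ⊗ Z_j`, hence is a
sum of products of cycles. -/
theorem mem_iSup_range_homologyProduct {r : ℕ} (x : E.homology r)
    (hx : ∀ (i j : ℕ) (h : i + j + 1 = r), T.toHomologyTensorBounds h x = 0) :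
    x ∈ ⨆ p : TensorIndex r, LinearMap.range (T.homologyProduct p.2) := by
  obtain ⟨z, rfl⟩ := homologyπ_surjective E r x
  obtain ⟨z', e, hz'⟩ := T.exists_homologous_cycle z hx
  choose u hu using fun p : TensorIndex r => T.exists_cyclesProduct_comp z' hz' p.2
  have := Fintype.ofFinite (TensorIndex r)
  have hsum : z' = ∑ p : TensorIndex r, T.cyclesProduct p.2 (u p) := by
    refine iCycles_injective E r (T.ext fun i j h => ?_)
    rw [map_sum, map_sum, Finset.sum_eq_single (⟨(i, j), h⟩ : TensorIndex r)]
    · rw [iCycles_cyclesProduct, hu ⟨(i, j), h⟩]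
      exact (T.comp_single_self h _).symm
    · intro p _ hp
      rw [iCycles_cyclesProduct]
      refine T.comp_single_of_ne p.2 h (fun hi => hp (Subtype.ext (Prod.ext hi.symm ?_))) _
      have := p.2
      dsimp only
      omega
    · exact fun h => absurd (Finset.mem_univ _) h
  rw [← e, hsum, map_sum]
  refine Submodule.sum_mem _ fun p _ => ?_
  rw [← T.homologyProduct_map]
  exact Submodule.mem_iSup_of_mem p (LinearMap.mem_range_self _ _)

end TensorDecomposition

end ChainComplex

namespace ChainComplex.TensorDecomposition

open TensorProduct KGraph

/-! ### Naturality -/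

variable {R : Type} [CommRing R] {C D E C' D' E' : ChainComplex (ModuleCat.{0} R) ℕ}
  (T : TensorDecomposition C D E) (T' : TensorDecomposition C' D' E') (f : C ⟶ C') (g : D ⟶ D')
  (e : E ⟶ E')

/-- Compatibility of chain maps with decompositions as tensor products. -/
def IsCompatible : Prop :=
  ∀ {i j r : ℕ} (h : i + j = r) (x : E.X r), T'.comp h ((e.f r).hom x) =
    TensorProduct.map (f.f i).hom (g.f j).hom (T.comp h x)

variable {T T' f g e} (he : IsCompatible T T' f g e)

include he

theorem IsCompatible.f_single {i j r : ℕ} (h : i + j = r) (t : C.X i ⊗[R] D.X j) :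
    (e.f r).hom (T.single h t) = T'.single h (TensorProduct.map (f.f i).hom (g.f j).hom t) := by
  refine T'.ext fun a b hab => ?_
  rw [he]
  by_cases hai : a = i
  · obtain rfl := hai
    obtain rfl : b = j := by omega
    rw [T.comp_single_self, T'.comp_single_self]
  · rw [T.comp_single_of_ne h hab hai, T'.comp_single_of_ne h hab hai, map_zero]

theorem IsCompatible.homologyMap_homologyProduct {i j r : ℕ} (h : i + j = r)
    (t : C.homology i ⊗[R] D.homology j) :
    (HomologicalComplex.homologyMap e r).hom (T.homologyProduct h t) =
      T'.homologyProduct h (TensorProduct.map (HomologicalComplex.homologyMap f i).hom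
        (HomologicalComplex.homologyMap g j).hom t) := by
  obtain ⟨s, rfl⟩ := map_homologyπ_surjective C D i j t
  have h₁ : (HomologicalComplex.homologyMap f i).hom ∘ₗ (C.homologyπ i).hom =
      (C'.homologyπ i).hom ∘ₗ (HomologicalComplex.cyclesMap f i).hom :=
    LinearMap.ext (homologyMap_homologyπ f i)
  have h₂ : (HomologicalComplex.homologyMap g j).hom ∘ₗ (D.homologyπ j).hom =
      (D'.homologyπ j).hom ∘ₗ (HomologicalComplex.cyclesMap g j).hom :=
    LinearMap.ext (homologyMap_homologyπ g j)
  have h₃ : (C'.iCycles i).hom ∘ₗ (HomologicalComplex.cyclesMap f i).hom =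
      (f.f i).hom ∘ₗ (C.iCycles i).hom := LinearMap.ext (iCycles_cyclesMap f i)
  have h₄ : (D'.iCycles j).hom ∘ₗ (HomologicalComplex.cyclesMap g j).hom =
      (g.f j).hom ∘ₗ (D.iCycles j).hom := LinearMap.ext (iCycles_cyclesMap g j)
  rw [homologyProduct_map, homologyMap_homologyπ, TensorProduct.map_map, h₁, h₂,
    ← TensorProduct.map_map, homologyProduct_map]
  congr 1
  refine iCycles_injective E' r ?_
  rw [iCycles_cyclesMap, iCycles_cyclesProduct, iCycles_cyclesProduct, he.f_single,
    TensorProduct.map_map, TensorProduct.map_map, h₃, h₄]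

variable [IsDomain R] [IsPrincipalIdealRing R] [∀ n, Module.Free R (C.X n)]
  [∀ n, Module.Free R (D.X n)] [∀ n, Module.Free R (C'.X n)]

/-- Chain maps need not commute with the chosen retractions. Both sides, however, can be evaluated
on the lift `u` in `Z_i ⊗ B_j`, where `chainsToHomology` is the natural projection. -/
theorem IsCompatible.toHomologyTensorBounds_homologyMap {i j r : ℕ} (h : i + j + 1 = r)
    (x : E.homology r) :
    T'.toHomologyTensorBounds h ((HomologicalComplex.homologyMap e r).hom x) =
      TensorProduct.map (HomologicalComplex.homologyMap f i).hom (boundsMap g j)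
        (T.toHomologyTensorBounds h x) := by
  obtain ⟨z, rfl⟩ := homologyπ_surjective E r x
  obtain ⟨u, hu⟩ := T.exists_cycles_tensor_bounds h z
  have h₁ : boundsMap g j ∘ₗ toBounds D j = toBounds D' j ∘ₗ (g.f (j + 1)).hom :=
    LinearMap.ext (boundsMap_toBounds g j)
  have h₂ : (HomologicalComplex.homologyMap f i).hom ∘ₗ (C.homologyπ i).hom =
      chainsToHomology C' i ∘ₗ (f.f i).hom ∘ₗ (C.iCycles i).hom := by
    refine LinearMap.ext fun z => ?_
    refine (homologyMap_homologyπ f i z).trans ?_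
    rw [← chainsToHomology_iCycles, iCycles_cyclesMap]
    rfl
  have e₁ := congrArg (TensorProduct.map (chainsToHomology C' i ∘ₗ (f.f i).hom) (boundsMap g j)) hu
  have e₂ := congrArg (TensorProduct.map
    ((HomologicalComplex.homologyMap f i).hom ∘ₗ chainsToHomology C i) (boundsMap g j)) hu
  rw [homologyMap_homologyπ, toHomologyTensorBounds_homologyπ, toHomologyTensorBounds_homologyπ,
    iCycles_cyclesMap, he]
  simp only [TensorProduct.map_map, LinearMap.comp_id, h₁, LinearMap.comp_assoc,
    chainsToHomology_comp_iCycles] at e₁ e₂ ⊢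
  rw [← e₁, ← e₂, h₂]

end ChainComplex.TensorDecomposition

namespace KGraph

open TensorProduct

variable {k k₁ k₂ : ℕ}

/-! ### Cubes of products -/

/-- The projection of a path of `Λ₁ × Λ₂` to `Λ₁`. -/
abbrev Path.fst {Λ₁ : KGraph k₁} {Λ₂ : KGraph k₂} (p : (Λ₁.prod Λ₂).Path) : Λ₁.Path :=
  ⟨p.src.1, p.tgt.1, p.hom.1⟩

/-- The projection of a path of `Λ₁ × Λ₂` to `Λ₂`. -/
abbrev Path.snd {Λ₁ : KGraph k₁} {Λ₂ : KGraph k₂} (p : (Λ₁.prod Λ₂).Path) : Λ₂.Path :=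
  ⟨p.src.2, p.tgt.2, p.hom.2⟩

theorem Path.degree_castAdd {Λ₁ : KGraph k₁} {Λ₂ : KGraph k₂} (p : (Λ₁.prod Λ₂).Path)
    (i : Fin k₁) : p.degree (Fin.castAdd k₂ i) = p.fst.degree i :=
  Fin.append_left _ _ i

theorem Path.degree_natAdd {Λ₁ : KGraph k₁} {Λ₂ : KGraph k₂} (p : (Λ₁.prod Λ₂).Path)
    (i : Fin k₂) : p.degree (Fin.natAdd k₁ i) = p.snd.degree i :=
  Fin.append_right _ _ i

section

variable {Λ₁ : KGraph k₁} {Λ₂ : KGraph k₂}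

/-- The cubes of `Λ₁ × Λ₂` are the pairs of a cube of `Λ₁` and a cube of `Λ₂`. -/
def prodCube (r : ℕ) (s : Σ p : TensorIndex r, Λ₁.Cube p.1.1 × Λ₂.Cube p.1.2) :
    (Λ₁.prod Λ₂).Cube r :=
  Cube.prod s.1.2 s.2.1 s.2.2

/-- The two projections of a cube recover the pair, and the bidegree is read off from the two
partial sums of its degree. -/
theorem prodCube_bijective (r : ℕ) :
    Function.Bijective (prodCube (Λ₁ := Λ₁) (Λ₂ := Λ₂) r) := by
  constructor
  · rintro ⟨⟨⟨a, b⟩, hp⟩, c₁, c₂⟩ ⟨⟨⟨a', b'⟩, hp'⟩, c₁', c₂'⟩ h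
    have h₁ : c₁.path = c₁'.path := congrArg (fun c => Path.fst (Cube.path c)) h
    have h₂ : c₂.path = c₂'.path := congrArg (fun c => Path.snd (Cube.path c)) h
    obtain rfl : a = a' := c₁.sum_degree.symm.trans
      ((congrArg (fun p : Λ₁.Path => ∑ i, p.degree i) h₁).trans c₁'.sum_degree)
    obtain rfl : b = b' := c₂.sum_degree.symm.trans
      ((congrArg (fun p : Λ₂.Path => ∑ i, p.degree i) h₂).trans c₂'.sum_degree)
    obtain rfl := Cube.ext h₁
    obtain rfl := Cube.ext h₂
    rfl
  · intro c
    refine ⟨⟨⟨(∑ i, c.path.fst.degree i, ∑ i, c.path.snd.degree i), ?_⟩,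
      ⟨c.path.fst, fun i => ?_, rfl⟩, ⟨c.path.snd, fun i => ?_, rfl⟩⟩, rfl⟩
    · refine Eq.trans ?_ c.sum_degree
      rw [Fin.sum_univ_add]
      simp only [Path.degree_castAdd, Path.degree_natAdd]
    · rw [← Path.degree_castAdd]
      exact c.le_one _
    · rw [← Path.degree_natAdd]
      exact c.le_one _

/-- Pad the two connecting paths with identities of the other factor, which have degree zero. -/
theorem isFace_prod_left {l : Fin 2} {i : Fin k₁} {p q : Λ₁.Path} (p' : Λ₂.Path)
    (h : IsFace l i p q) : IsFace (Λ := Λ₁.prod Λ₂) l (Fin.castAdd k₂ i)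
      ⟨(p.src, p'.src), (p.tgt, p'.tgt), (p.hom, p'.hom)⟩
      ⟨(q.src, p'.src), (q.tgt, p'.tgt), (q.hom, p'.hom)⟩ := by
  have key : ∀ (P : Prop) [Decidable P], Fin.append (if P then Pi.single i 1 else 0)
      (0 : Fin k₂ → ℕ) = if P then Pi.single (Fin.castAdd k₂ i) 1 else 0 := by
    intro P _
    funext j
    refine Fin.addCases (fun j => ?_) (fun j => ?_) j
    · rw [Fin.append_left]
      split_ifs
      · simp [Pi.single_apply]
      · rfl
    · rw [Fin.append_right]
      split_ifs
      · rw [Pi.single_eq_of_ne]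
        · rfl
        · intro e
          have := congrArg Fin.val e
          simp at this
          omega
      · rfl
  obtain ⟨α, β, hα, hβ, hc⟩ := h
  refine ⟨(α, 𝟙 _), (β, 𝟙 _), ?_, ?_, ?_⟩
  · exact (congrArg₂ Fin.append hα (Λ₂.deg_id _)).trans (key _)
  · exact (congrArg₂ Fin.append hβ (Λ₂.deg_id _)).trans (key _)
  · exact Prod.ext hc (by
      change 𝟙 _ ≫ p'.hom ≫ 𝟙 _ = p'.hom
      rw [Category.id_comp, Category.comp_id])

theorem isFace_prod_right {l : Fin 2} {i : Fin k₂} {p q : Λ₂.Path} (p' : Λ₁.Path)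
    (h : IsFace l i p q) : IsFace (Λ := Λ₁.prod Λ₂) l (Fin.natAdd k₁ i)
      ⟨(p'.src, p.src), (p'.tgt, p.tgt), (p'.hom, p.hom)⟩
      ⟨(p'.src, q.src), (p'.tgt, q.tgt), (p'.hom, q.hom)⟩ := by
  have key : ∀ (P : Prop) [Decidable P], Fin.append (0 : Fin k₁ → ℕ)
      (if P then Pi.single i 1 else 0) = if P then Pi.single (Fin.natAdd k₁ i) 1 else 0 := by
    intro P _
    funext j
    refine Fin.addCases (fun j => ?_) (fun j => ?_) j
    · rw [Fin.append_left]
      split_ifs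
      · rw [Pi.single_eq_of_ne]
        · rfl
        · intro e
          have := congrArg Fin.val e
          simp at this
          omega
      · rfl
    · rw [Fin.append_right]
      split_ifs
      · simp [Pi.single_apply]
      · rfl
  obtain ⟨α, β, hα, hβ, hc⟩ := h
  refine ⟨(𝟙 _, α), (𝟙 _, β), ?_, ?_, ?_⟩
  · exact (congrArg₂ Fin.append (Λ₁.deg_id _) hα).trans (key _)
  · exact (congrArg₂ Fin.append (Λ₁.deg_id _) hβ).trans (key _)
  · exact Prod.ext (by
      change 𝟙 _ ≫ p'.hom ≫ 𝟙 _ = p'.hom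
      rw [Category.id_comp, Category.comp_id]) hc

variable {a b r : ℕ}

/-- A direction of the first factor, as a direction of a product cube. -/
def Cube.dirLeft (h : a + b = r) (c₁ : Λ₁.Cube a) (c₂ : Λ₂.Cube b) (i : c₁.Dir) :
    (Cube.prod h c₁ c₂).Dir :=
  ⟨Fin.castAdd k₂ i.1, (Path.degree_castAdd _ _).trans i.2⟩

/-- A direction of the second factor, as a direction of a product cube. -/
def Cube.dirRight (h : a + b = r) (c₁ : Λ₁.Cube a) (c₂ : Λ₂.Cube b) (i : c₂.Dir) :
    (Cube.prod h c₁ c₂).Dir :=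
  ⟨Fin.natAdd k₁ i.1, (Path.degree_natAdd _ _).trans i.2⟩

theorem Cube.sum_dir_prod {M : Type*} [AddCommMonoid M] (h : a + b = r) (c₁ : Λ₁.Cube a)
    (c₂ : Λ₂.Cube b) (F : (Cube.prod h c₁ c₂).Dir → M) :
    ∑ i, F i = ∑ i, F (Cube.dirLeft h c₁ c₂ i) + ∑ i, F (Cube.dirRight h c₁ c₂ i) := by
  refine Eq.trans ?_ (Fintype.sum_sum_type (fun s : c₁.Dir ⊕ c₂.Dir =>
    F (Sum.elim (Cube.dirLeft h c₁ c₂) (Cube.dirRight h c₁ c₂) s)))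
  refine (Function.Bijective.sum_comp (e := Sum.elim (Cube.dirLeft h c₁ c₂)
    (Cube.dirRight h c₁ c₂)) ⟨?_, ?_⟩ F).symm
  · refine Function.Injective.sumElim ?_ ?_ ?_
    · intro i j hij
      exact Subtype.ext (Fin.castAdd_injective _ _ (congrArg Subtype.val hij))
    · intro i j hij
      exact Subtype.ext (Fin.natAdd_injective _ _ (congrArg Subtype.val hij))
    · intro i j hij
      have := congrArg (fun t => t.1.1) hij
      simp only [Cube.dirLeft, Cube.dirRight, Fin.val_castAdd, Fin.val_natAdd] at this
      omega
  · rintro ⟨i, hi⟩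
    revert hi
    refine Fin.addCases (fun i => ?_) (fun i => ?_) i
    · intro hi
      exact ⟨Sum.inl ⟨i, (Path.degree_castAdd _ _).symm.trans hi⟩, rfl⟩
    · intro hi
      exact ⟨Sum.inr ⟨i, (Path.degree_natAdd _ _).symm.trans hi⟩, rfl⟩

theorem Cube.face_prod_left (h : a + 1 + b = r + 1) (h' : a + b = r) (c₁ : Λ₁.Cube (a + 1))
    (c₂ : Λ₂.Cube b) (l : Fin 2) (i : c₁.Dir) :
    (Cube.prod h c₁ c₂).face l (Cube.dirLeft h c₁ c₂ i) = Cube.prod h' (c₁.face l i) c₂ :=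
  Cube.face_eq _ _ _ _ (isFace_prod_left c₂.path (c₁.isFace_face l i))

theorem Cube.face_prod_right (h : a + (b + 1) = r + 1) (h' : a + b = r) (c₁ : Λ₁.Cube a)
    (c₂ : Λ₂.Cube (b + 1)) (l : Fin 2) (i : c₂.Dir) :
    (Cube.prod h c₁ c₂).face l (Cube.dirRight h c₁ c₂ i) = Cube.prod h' c₁ (c₂.face l i) :=
  Cube.face_eq _ _ _ _ (isFace_prod_right c₁.path (c₂.isFace_face l i))

theorem Cube.pos_prod_left (h : a + b = r) (c₁ : Λ₁.Cube a) (c₂ : Λ₂.Cube b) (i : c₁.Dir) :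
    (Cube.prod h c₁ c₂).pos (Cube.dirLeft h c₁ c₂ i) = c₁.pos i := by
  rw [Cube.pos, Cube.pos, Finset.card_filter, Finset.card_filter, Fin.sum_univ_add]
  refine (congrArg₂ (· + ·) (Finset.sum_congr rfl fun j _ => ?_)
    (Finset.sum_eq_zero fun j _ => ?_)).trans (add_zero _)
  · rw [Path.degree_castAdd]
    simp only [Cube.dirLeft, Fin.le_def, Fin.val_castAdd]
    rfl
  · refine if_neg fun hj => ?_
    have := hj.2
    simp only [Cube.dirLeft, Fin.le_def, Fin.val_natAdd, Fin.val_castAdd] at this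
    omega

/-- All `a` directions of the first factor come before those of the second. This shift is the source
of the sign `(-1)^a` in the Leibniz rule. -/
theorem Cube.pos_prod_right (h : a + b = r) (c₁ : Λ₁.Cube a) (c₂ : Λ₂.Cube b) (i : c₂.Dir) :
    (Cube.prod h c₁ c₂).pos (Cube.dirRight h c₁ c₂ i) = a + c₂.pos i := by
  rw [Cube.pos, Cube.pos, Finset.card_filter, Finset.card_filter, Fin.sum_univ_add]
  refine congrArg₂ (· + ·) ?_ (Finset.sum_congr rfl fun j _ => ?_)
  · refine Eq.trans ?_ c₁.sum_degree
    refine Finset.sum_congr rfl fun j _ => ?_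
    rw [Path.degree_castAdd]
    have h₁ : Fin.castAdd k₂ j ≤ (Cube.dirRight h c₁ c₂ i).1 := by
      simp only [Cube.dirRight, Fin.le_def, Fin.val_natAdd, Fin.val_castAdd]
      omega
    have h₂ := c₁.le_one j
    by_cases hj : c₁.path.degree j = 1
    · exact (if_pos ⟨hj, h₁⟩).trans hj.symm
    · refine (if_neg fun e => hj e.1).trans ?_
      omega
  · rw [Path.degree_natAdd]
    simp only [Cube.dirRight, Fin.le_def, Fin.val_natAdd, Nat.add_le_add_iff_left]
    rfl

theorem Cube.isEmpty_dir {Λ : KGraph k} (c : Λ.Cube 0) : IsEmpty c.Dir := by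
  refine ⟨fun i => ?_⟩
  have := (Finset.sum_eq_zero_iff.1 c.sum_degree) i.1 (Finset.mem_univ _)
  rw [i.2] at this
  exact one_ne_zero this

end

end KGraph

namespace KGraph

open TensorProduct

attribute [local instance 2000] TensorProduct.instModule

variable {k k₁ k₂ : ℕ}

/-! ### The chain complex of a product -/

theorem chainComplex_d (Λ : KGraph k) (r : ℕ) :
    (Λ.chainComplex.d (r + 1) r).hom = Λ.boundary r :=
  congrArg ModuleCat.Hom.hom (ChainComplex.of_d (fun r => ModuleCat.of ℤ (Λ.Chain r))
    (fun r => ModuleCat.ofHom (Λ.boundary r)) r)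

instance (Λ : KGraph k) (r : ℕ) : Module.Free ℤ (Λ.chainComplex.X r) :=
  inferInstanceAs (Module.Free ℤ (Λ.Chain r))

variable {Λ₁ : KGraph k₁} {Λ₂ : KGraph k₂}

/-- The chains of `Λ₁ × Λ₂` are sums of tensor products of chains. -/
noncomputable def prodChainEquiv (Λ₁ : KGraph k₁) (Λ₂ : KGraph k₂) (r : ℕ) :
    (Λ₁.prod Λ₂).Chain r ≃ₗ[ℤ] ∀ p : TensorIndex r, Λ₁.Chain p.1.1 ⊗[ℤ] Λ₂.Chain p.1.2 :=
  letI : Fintype (TensorIndex r) := Fintype.ofFinite _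
  (Finsupp.domLCongr (Equiv.ofBijective _ (prodCube_bijective r)).symm).trans
    ((Finsupp.sigmaFinsuppLEquivPiFinsupp ℤ).trans
      (LinearEquiv.piCongrRight fun _ => (finsuppTensorFinsupp' ℤ _ _).symm))

/-- The cross product of chains as a linear map. -/
noncomputable def crossLin {a b r : ℕ} (h : a + b = r) :
    Λ₁.Chain a ⊗[ℤ] Λ₂.Chain b →ₗ[ℤ] (Λ₁.prod Λ₂).Chain r :=
  Finsupp.lmapDomain ℤ ℤ (fun c : Λ₁.Cube a × Λ₂.Cube b => Cube.prod h c.1 c.2) ∘ₗ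
    (finsuppTensorFinsupp' ℤ _ _).toLinearMap

theorem crossLin_single {a b r : ℕ} (h : a + b = r) (c₁ : Λ₁.Cube a) (c₂ : Λ₂.Cube b) (m n : ℤ) :
    crossLin h (Finsupp.single c₁ m ⊗ₜ[ℤ] Finsupp.single c₂ n) =
      Finsupp.single (Cube.prod h c₁ c₂) (m * n) := by
  refine (congrArg (Finsupp.mapDomain fun c : Λ₁.Cube a × Λ₂.Cube b => Cube.prod h c.1 c.2)
    (finsuppTensorFinsupp'_single_tmul_single ℤ _ _ c₁ c₂ m n)).trans ?_
  rw [Finsupp.mapDomain_single]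

theorem crossLin_tmul {a b r : ℕ} (h : a + b = r) (x₁ : Λ₁.Chain a) (x₂ : Λ₂.Chain b) :
    crossLin h (x₁ ⊗ₜ[ℤ] x₂) = cross h x₁ x₂ := by
  conv_lhs => rw [← Finsupp.sum_single x₁, ← Finsupp.sum_single x₂]
  simp only [Finsupp.sum, TensorProduct.sum_tmul, TensorProduct.tmul_sum, map_sum,
    crossLin_single]
  rw [Finset.sum_comm]
  rfl

theorem prodChainEquiv_crossLin_self {a b r : ℕ} (h : a + b = r)
    (t : Λ₁.Chain a ⊗[ℤ] Λ₂.Chain b) :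
    prodChainEquiv Λ₁ Λ₂ r (crossLin h t) ⟨(a, b), h⟩ = t := by
  refine (LinearEquiv.symm_apply_eq (finsuppTensorFinsupp' ℤ (Λ₁.Cube a) (Λ₂.Cube b))).2
    (Finsupp.ext fun c => ?_)
  exact Finsupp.mapDomain_apply (fun c c' e => by
    have := (prodCube_bijective r).1 (a₁ := ⟨⟨(a, b), h⟩, c⟩) (a₂ := ⟨⟨(a, b), h⟩, c'⟩) e
    simpa using this) _ c

theorem prodChainEquiv_crossLin_of_ne {a b i j r : ℕ} (h : a + b = r) (h' : i + j = r)
    (hne : i ≠ a) (t : Λ₁.Chain a ⊗[ℤ] Λ₂.Chain b) :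
    prodChainEquiv Λ₁ Λ₂ r (crossLin h t) ⟨(i, j), h'⟩ = 0 := by
  refine (LinearEquiv.symm_apply_eq (finsuppTensorFinsupp' ℤ (Λ₁.Cube i) (Λ₂.Cube j))).2
    (Eq.trans (Finsupp.ext fun c => ?_) (map_zero _).symm)
  refine Finsupp.mapDomain_of_notMem_range _ _ ?_
  rintro ⟨c', e⟩
  have := (prodCube_bijective r).1 (a₁ := ⟨⟨(a, b), h⟩, c'⟩) (a₂ := ⟨⟨(i, j), h'⟩, c⟩) e
  exact hne (congrArg (fun s => s.1.1.1) this).symm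

/-- The part of the boundary of a product cube in the directions of the first factor. -/
noncomputable def Cube.boundaryLeft {a b r : ℕ} (h : a + b = r + 1) (c₁ : Λ₁.Cube a)
    (c₂ : Λ₂.Cube b) : (Λ₁.prod Λ₂).Chain r :=
  ∑ l : Fin 2, ∑ i : c₁.Dir, Finsupp.single ((Cube.prod h c₁ c₂).face l (Cube.dirLeft h c₁ c₂ i))
    ((-1 : ℤ) ^ ((Cube.prod h c₁ c₂).pos (Cube.dirLeft h c₁ c₂ i) + l.1))

/-- The part of the boundary of a product cube in the directions of the second factor. -/
noncomputable def Cube.boundaryRight {a b r : ℕ} (h : a + b = r + 1) (c₁ : Λ₁.Cube a)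
    (c₂ : Λ₂.Cube b) : (Λ₁.prod Λ₂).Chain r :=
  ∑ l : Fin 2, ∑ i : c₂.Dir, Finsupp.single ((Cube.prod h c₁ c₂).face l (Cube.dirRight h c₁ c₂ i))
    ((-1 : ℤ) ^ ((Cube.prod h c₁ c₂).pos (Cube.dirRight h c₁ c₂ i) + l.1))

theorem Cube.boundary_prod {a b r : ℕ} (h : a + b = r + 1) (c₁ : Λ₁.Cube a) (c₂ : Λ₂.Cube b) :
    (Cube.prod h c₁ c₂).boundary = Cube.boundaryLeft h c₁ c₂ + Cube.boundaryRight h c₁ c₂ := by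
  rw [Cube.boundary, boundaryLeft, boundaryRight, ← Finset.sum_add_distrib]
  exact Finset.sum_congr rfl fun l _ => Cube.sum_dir_prod h c₁ c₂ _

theorem Cube.boundaryLeft_zero {b r : ℕ} (h : 0 + b = r + 1) (c₁ : Λ₁.Cube 0) (c₂ : Λ₂.Cube b) :
    Cube.boundaryLeft h c₁ c₂ = 0 := by
  have := c₁.isEmpty_dir
  simp [boundaryLeft]

theorem Cube.boundaryRight_zero {a r : ℕ} (h : a + 0 = r + 1) (c₁ : Λ₁.Cube a) (c₂ : Λ₂.Cube 0) :
    Cube.boundaryRight h c₁ c₂ = 0 := by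
  have := c₂.isEmpty_dir
  simp [boundaryRight]

theorem Cube.boundaryLeft_succ {a b r : ℕ} (h : a + 1 + b = r + 1) (h' : a + b = r)
    (c₁ : Λ₁.Cube (a + 1)) (c₂ : Λ₂.Cube b) :
    Cube.boundaryLeft h c₁ c₂ = crossLin h' (c₁.boundary ⊗ₜ[ℤ] Finsupp.single c₂ 1) := by
  simp only [boundaryLeft, Cube.boundary, TensorProduct.sum_tmul, map_sum, crossLin_single,
    mul_one, Cube.face_prod_left h h', Cube.pos_prod_left]

theorem Cube.boundaryRight_succ {a b r : ℕ} (h : a + (b + 1) = r + 1) (h' : a + b = r)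
    (c₁ : Λ₁.Cube a) (c₂ : Λ₂.Cube (b + 1)) :
    Cube.boundaryRight h c₁ c₂ =
      crossLin h' ((-1 : ℤ) ^ a • (Finsupp.single c₁ 1 ⊗ₜ[ℤ] c₂.boundary)) := by
  refine Eq.trans ?_ (map_smul (crossLin h') ((-1 : ℤ) ^ a) _).symm
  simp only [boundaryRight, Cube.boundary, TensorProduct.tmul_sum, map_sum, crossLin_single,
    one_mul, Cube.face_prod_right h h', Cube.pos_prod_right, Finset.smul_sum,
    Finsupp.smul_single, smul_eq_mul, ← pow_add, add_assoc]

/-- The Leibniz rule, checked on products of basis cubes. The two parts of the boundary match the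
two terms separately, and a `0`-cube contributes nothing because it has no directions. -/
theorem prodChainEquiv_boundary {i j r : ℕ} (h : i + j = r) (x : (Λ₁.prod Λ₂).Chain (r + 1)) :
    prodChainEquiv Λ₁ Λ₂ r ((Λ₁.prod Λ₂).boundary r x) ⟨(i, j), h⟩ =
      LinearMap.rTensor (Λ₂.Chain j) (Λ₁.boundary i)
          (prodChainEquiv Λ₁ Λ₂ (r + 1) x ⟨(i + 1, j), by dsimp only; omega⟩) +
        (-1 : ℤ) ^ i • LinearMap.lTensor (Λ₁.Chain i) (Λ₂.boundary j)
          (prodChainEquiv Λ₁ Λ₂ (r + 1) x ⟨(i, j + 1), by dsimp only; omega⟩) := by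
  have h₁ : i + 1 + j = r + 1 := by omega
  have h₂ : i + (j + 1) = r + 1 := by omega
  suffices e : LinearMap.proj (⟨(i, j), h⟩ : TensorIndex r) ∘ₗ
      (prodChainEquiv Λ₁ Λ₂ r).toLinearMap ∘ₗ (Λ₁.prod Λ₂).boundary r =
      LinearMap.rTensor (Λ₂.Chain j) (Λ₁.boundary i) ∘ₗ
          LinearMap.proj (⟨(i + 1, j), h₁⟩ : TensorIndex (r + 1)) ∘ₗ
          (prodChainEquiv Λ₁ Λ₂ (r + 1)).toLinearMap +
        (-1 : ℤ) ^ i • (LinearMap.lTensor (Λ₁.Chain i) (Λ₂.boundary j) ∘ₗ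
          LinearMap.proj (⟨(i, j + 1), h₂⟩ : TensorIndex (r + 1)) ∘ₗ
          (prodChainEquiv Λ₁ Λ₂ (r + 1)).toLinearMap) from LinearMap.congr_fun e x
  refine Finsupp.lhom_ext' fun c => LinearMap.ext_ring ?_
  obtain ⟨⟨⟨⟨a, b⟩, hab⟩, c₁, c₂⟩, rfl⟩ := (prodCube_bijective (r + 1)).2 c
  dsimp only at hab c₁ c₂
  have e : Finsupp.single (prodCube (r + 1) ⟨⟨(a, b), hab⟩, c₁, c₂⟩) (1 : ℤ) =
      crossLin hab (Finsupp.single c₁ 1 ⊗ₜ[ℤ] Finsupp.single c₂ 1) := by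
    rw [crossLin_single, mul_one]
    rfl
  have e' : (Λ₁.prod Λ₂).boundary r
      (crossLin hab (Finsupp.single c₁ 1 ⊗ₜ[ℤ] Finsupp.single c₂ 1)) =
      Cube.boundaryLeft hab c₁ c₂ + Cube.boundaryRight hab c₁ c₂ := by
    rw [crossLin_single, boundary_single, mul_one, one_smul, Cube.boundary_prod]
  simp only [LinearMap.comp_apply, LinearMap.add_apply, LinearMap.smul_apply,
    Finsupp.lsingle_apply, LinearEquiv.coe_coe, LinearMap.proj_apply]
  rw [e, e', map_add, Pi.add_apply]
  congr 1
  · by_cases ha : a = i + 1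
    · subst ha
      obtain rfl : b = j := by omega
      rw [Cube.boundaryLeft_succ hab h, prodChainEquiv_crossLin_self,
        prodChainEquiv_crossLin_self, LinearMap.rTensor_tmul, boundary_single, one_smul]
    · rw [prodChainEquiv_crossLin_of_ne hab h₁ (Ne.symm ha), map_zero]
      cases a with
      | zero => rw [Cube.boundaryLeft_zero, map_zero, Pi.zero_apply]
      | succ a =>
        rw [Cube.boundaryLeft_succ hab (by omega),
          prodChainEquiv_crossLin_of_ne _ h (by omega)]
  · by_cases hb : b = j + 1
    · subst hb
      obtain rfl : a = i := by omega
      rw [Cube.boundaryRight_succ hab h, prodChainEquiv_crossLin_self,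
        prodChainEquiv_crossLin_self, LinearMap.lTensor_tmul, boundary_single, one_smul]
    · rw [prodChainEquiv_crossLin_of_ne hab h₂ (by omega), map_zero, smul_zero]
      cases b with
      | zero => rw [Cube.boundaryRight_zero, map_zero, Pi.zero_apply]
      | succ b =>
        rw [Cube.boundaryRight_succ hab (by omega),
          prodChainEquiv_crossLin_of_ne _ h (by omega)]

/-- The decomposition of the chain complex of a product as a tensor product. -/
noncomputable def tensorDecomposition (Λ₁ : KGraph k₁) (Λ₂ : KGraph k₂) :
    ChainComplex.TensorDecomposition Λ₁.chainComplex Λ₂.chainComplex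
      (Λ₁.prod Λ₂).chainComplex where
  equiv r := prodChainEquiv Λ₁ Λ₂ r
  equiv_d {i j r} h x := by
    rw [chainComplex_d, chainComplex_d, chainComplex_d]
    exact prodChainEquiv_boundary h x

theorem tensorDecomposition_single {i j r : ℕ} (h : i + j = r)
    (t : Λ₁.Chain i ⊗[ℤ] Λ₂.Chain j) :
    (tensorDecomposition Λ₁ Λ₂).single h t = crossLin h t := by
  refine (tensorDecomposition Λ₁ Λ₂).ext fun a b hab => ?_
  by_cases hai : a = i
  · obtain rfl := hai
    obtain rfl : b = j := by omega
    exact (ChainComplex.TensorDecomposition.comp_single_self _ _ _).trans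
      (prodChainEquiv_crossLin_self h t).symm
  · exact (ChainComplex.TensorDecomposition.comp_single_of_ne _ _ _ hai _).trans
      (prodChainEquiv_crossLin_of_ne h hab hai t).symm

variable {Γ₁ : KGraph k₁} {Γ₂ : KGraph k₂} (φ₁ : Λ₁ ⟶ Γ₁) (φ₂ : Λ₂ ⟶ Γ₂)

/-- The product of two morphisms. -/
abbrev prodMap : Λ₁.prod Λ₂ ⟶ Γ₁.prod Γ₂ :=
  (prodFunctor k₁ k₂).map (X := (Λ₁, Λ₂)) (Y := (Γ₁, Γ₂)) (φ₁, φ₂)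

/-- The map of chains induced by a morphism. -/
noncomputable def mapChain {Λ Γ : KGraph k} (φ : Λ ⟶ Γ) (r : ℕ) : Λ.Chain r →ₗ[ℤ] Γ.Chain r :=
  Finsupp.lmapDomain ℤ ℤ (Hom.mapCube φ)

theorem mapChain_single {Λ Γ : KGraph k} (φ : Λ ⟶ Γ) {r : ℕ} (c : Λ.Cube r) (m : ℤ) :
    mapChain φ r (Finsupp.single c m) = Finsupp.single (Hom.mapCube φ c) m :=
  Finsupp.mapDomain_single

theorem mapChain_crossLin {a b r : ℕ} (h : a + b = r) (t : Λ₁.Chain a ⊗[ℤ] Λ₂.Chain b) :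
    mapChain (prodMap φ₁ φ₂) r (crossLin h t) =
      crossLin h (TensorProduct.map (mapChain φ₁ a) (mapChain φ₂ b) t) := by
  suffices e : mapChain (prodMap φ₁ φ₂) r ∘ₗ crossLin h =
      crossLin h ∘ₗ TensorProduct.map (mapChain φ₁ a) (mapChain φ₂ b) from
    LinearMap.congr_fun e t
  refine TensorProduct.ext (Finsupp.lhom_ext' fun c => LinearMap.ext_ring
    (Finsupp.lhom_ext' fun c' => LinearMap.ext_ring ?_))
  change mapChain (prodMap φ₁ φ₂) r (crossLin h (Finsupp.single c 1 ⊗ₜ[ℤ] Finsupp.single c' 1)) =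
    crossLin h (TensorProduct.map (mapChain φ₁ a) (mapChain φ₂ b)
      (Finsupp.single c 1 ⊗ₜ[ℤ] Finsupp.single c' 1))
  rw [TensorProduct.map_tmul, crossLin_single, mapChain_single, mapChain_single, mapChain_single,
    crossLin_single]
  rfl

theorem prodChainEquiv_mapChain {i j r : ℕ} (h : i + j = r) (x : (Λ₁.prod Λ₂).Chain r) :
    prodChainEquiv Γ₁ Γ₂ r (mapChain (prodMap φ₁ φ₂) r x) ⟨(i, j), h⟩ =
      TensorProduct.map (mapChain φ₁ i) (mapChain φ₂ j)
        (prodChainEquiv Λ₁ Λ₂ r x ⟨(i, j), h⟩) := by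
  suffices e : LinearMap.proj (⟨(i, j), h⟩ : TensorIndex r) ∘ₗ
      (prodChainEquiv Γ₁ Γ₂ r).toLinearMap ∘ₗ mapChain (prodMap φ₁ φ₂) r =
      TensorProduct.map (mapChain φ₁ i) (mapChain φ₂ j) ∘ₗ
          LinearMap.proj (⟨(i, j), h⟩ : TensorIndex r) ∘ₗ
          (prodChainEquiv Λ₁ Λ₂ r).toLinearMap from LinearMap.congr_fun e x
  refine Finsupp.lhom_ext' fun c => LinearMap.ext_ring ?_
  obtain ⟨⟨⟨⟨a, b⟩, hab⟩, c₁, c₂⟩, rfl⟩ := (prodCube_bijective r).2 c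
  dsimp only at hab c₁ c₂
  have e : Finsupp.single (prodCube r ⟨⟨(a, b), hab⟩, c₁, c₂⟩) (1 : ℤ) =
      crossLin hab (Finsupp.single c₁ 1 ⊗ₜ[ℤ] Finsupp.single c₂ 1) := by
    rw [crossLin_single, mul_one]
    rfl
  simp only [LinearMap.comp_apply, Finsupp.lsingle_apply, LinearEquiv.coe_coe,
    LinearMap.proj_apply]
  rw [e, mapChain_crossLin]
  by_cases hai : i = a
  · obtain rfl := hai
    obtain rfl : b = j := by omega
    rw [prodChainEquiv_crossLin_self, prodChainEquiv_crossLin_self]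
  · rw [prodChainEquiv_crossLin_of_ne hab h hai, prodChainEquiv_crossLin_of_ne hab h hai,
      map_zero]

theorem isCompatible_chainMap :
    ChainComplex.TensorDecomposition.IsCompatible (tensorDecomposition Λ₁ Λ₂)
      (tensorDecomposition Γ₁ Γ₂) (chainMap φ₁) (chainMap φ₂) (chainMap (prodMap φ₁ φ₂)) :=
  fun h x => prodChainEquiv_mapChain φ₁ φ₂ h x

end KGraph

/-! ### The Künneth sequence -/

/-- Elements are maps out of `R`, so the joint cancellation property of the projections applies to
them. -/
theorem ModuleCat.biproduct_ext {R : Type} [CommRing R] {J : Type} [Finite J]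
    {f : J → ModuleCat.{0} R} {x y : (⨁ f : ModuleCat.{0} R)}
    (h : ∀ j, (biproduct.π f j).hom x = (biproduct.π f j).hom y) : x = y := by
  have e : ModuleCat.ofHom (LinearMap.toSpanSingleton R _ x) =
      ModuleCat.ofHom (LinearMap.toSpanSingleton R _ y) := by
    refine biproduct.hom_ext _ _ fun j => ModuleCat.hom_ext (LinearMap.ext_ring ?_)
    simpa using h j
  simpa using LinearMap.congr_fun (congrArg ModuleCat.Hom.hom e) 1

namespace ChainComplex.TensorDecomposition

open KGraph

variable {R : Type} [CommRing R] {C D E C' D' E' : ChainComplex (ModuleCat.{0} R) ℕ}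
  (T : TensorDecomposition C D E) (T' : TensorDecomposition C' D' E')

/-- The homology product on the sum of the products of homology modules. -/
noncomputable def tensorToHomology (r : ℕ) :
    (⨁ fun p : TensorIndex r => C.homology p.1.1 ⊗ D.homology p.1.2) ⟶ E.homology r :=
  biproduct.desc fun p => ModuleCat.ofHom (T.homologyProduct p.2)

theorem ι_tensorToHomology {r : ℕ} (p : TensorIndex r) :
    biproduct.ι (fun p : TensorIndex r => C.homology p.1.1 ⊗ D.homology p.1.2) p ≫
      T.tensorToHomology r = ModuleCat.ofHom (T.homologyProduct p.2) :=
  biproduct.ι_desc _ _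

theorem tensorToHomology_naturality {T : TensorDecomposition C D E}
    {T' : TensorDecomposition C' D' E'} {f : C ⟶ C'} {g : D ⟶ D'} {e : E ⟶ E'}
    (he : IsCompatible T T' f g e) (r : ℕ) :
    (biproduct.map fun p : TensorIndex r => HomologicalComplex.homologyMap f p.1.1 ⊗ₘ
        HomologicalComplex.homologyMap g p.1.2) ≫ T'.tensorToHomology r =
      T.tensorToHomology r ≫ HomologicalComplex.homologyMap e r := by
  refine biproduct.hom_ext' _ _ fun p => ?_
  rw [biproduct.ι_map_assoc, ι_tensorToHomology, reassoc_of% T.ι_tensorToHomology]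
  exact ModuleCat.hom_ext (LinearMap.ext fun t => (he.homologyMap_homologyProduct p.2 t).symm)

variable [IsDomain R] [IsPrincipalIdealRing R] [∀ n, Module.Free R (C.X n)]
  [∀ n, Module.Free R (D.X n)] [∀ n, Module.Free R (C'.X n)] [∀ n, Module.Free R (D'.X n)]

theorem exists_toTor {i j r : ℕ} (h : i + j + 1 = r) :
    ∃ t : E.homology r ⟶ ((Tor (ModuleCat.{0} R) 1).obj (C.homology i)).obj (D.homology j),
      t ≫ (homologyPresentation_shortExact D j).torι (C.homology i) =
        ModuleCat.ofHom (T.toHomologyTensorBounds h) :=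
  (homologyPresentation_shortExact D j).exists_lift_torι (C.homology i)
    (ModuleCat.ofHom (T.toHomologyTensorBounds h))
    (ModuleCat.hom_ext (LinearMap.ext (T.lTensor_toHomologyTensorBounds h)))

/-- The map from homology to the torsion product in bidegree `(i, j)`. -/
noncomputable def toTor {i j r : ℕ} (h : i + j + 1 = r) :
    E.homology r ⟶ ((Tor (ModuleCat.{0} R) 1).obj (C.homology i)).obj (D.homology j) :=
  (T.exists_toTor h).choose

theorem toTor_torι {i j r : ℕ} (h : i + j + 1 = r) :
    T.toTor h ≫ (homologyPresentation_shortExact D j).torι (C.homology i) =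
      ModuleCat.ofHom (T.toHomologyTensorBounds h) :=
  (T.exists_toTor h).choose_spec

theorem torι_injective (C D : ChainComplex (ModuleCat.{0} R) ℕ) [∀ n, Module.Free R (D.X n)]
    (i j : ℕ) : Function.Injective
      ((homologyPresentation_shortExact D j).torι (C.homology i)).hom :=
  (ModuleCat.mono_iff_injective _).1
    ((homologyPresentation_shortExact D j).mono_torι (C.homology i))

theorem torι_toTor {i j r : ℕ} (h : i + j + 1 = r) (x : E.homology r) :
    ((homologyPresentation_shortExact D j).torι (C.homology i)).hom ((T.toTor h).hom x) =
      T.toHomologyTensorBounds h x :=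
  LinearMap.congr_fun (congrArg ModuleCat.Hom.hom (T.toTor_torι h)) x

theorem toTor_eq_zero_iff {i j r : ℕ} (h : i + j + 1 = r) (x : E.homology r) :
    (T.toTor h).hom x = 0 ↔ T.toHomologyTensorBounds h x = 0 := by
  rw [← T.torι_toTor h]
  exact (map_eq_zero_iff _ (torι_injective C D i j)).symm

/-- After composition with the monomorphism `torι`, this becomes naturality of the map to `H_i ⊗
B_j`. -/
theorem toTor_naturality {T : TensorDecomposition C D E}
    {T' : TensorDecomposition C' D' E'} {f : C ⟶ C'} {g : D ⟶ D'} {e : E ⟶ E'}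
    (he : IsCompatible T T' f g e) {i j r : ℕ} (h : i + j + 1 = r) :
    HomologicalComplex.homologyMap e r ≫ T'.toTor h =
      T.toTor h ≫ ((Tor (ModuleCat.{0} R) 1).map (HomologicalComplex.homologyMap f i)).app _ ≫
        ((Tor (ModuleCat.{0} R) 1).obj _).map (HomologicalComplex.homologyMap g j) := by
  have := (homologyPresentation_shortExact D' j).mono_torι (C'.homology i)
  rw [← cancel_mono ((homologyPresentation_shortExact D' j).torι (C'.homology i))]
  have h₁ := (homologyPresentation_shortExact D j).torι_naturality_right
    (homologyPresentation_shortExact D' j) (C'.homology i) (homologyPresentationMap g j)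
  have h₂ := (homologyPresentation_shortExact D j).torι_naturality_left
    (HomologicalComplex.homologyMap f i)
  simp only [Category.assoc]
  rw [toTor_torι]
  refine Eq.trans ?_ (congrArg (fun t => T.toTor h ≫ ((Tor (ModuleCat.{0} R) 1).map
    (HomologicalComplex.homologyMap f i)).app _ ≫ t) h₁).symm
  rw [reassoc_of% h₂, reassoc_of% T.toTor_torι h]
  refine ModuleCat.hom_ext (LinearMap.ext fun x => ?_)
  refine (he.toHomologyTensorBounds_homologyMap h x).trans ?_
  refine LinearMap.congr_fun (?_ : _ = LinearMap.lTensor _ (boundsMap g j) ∘ₗ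
    LinearMap.rTensor _ (HomologicalComplex.homologyMap f i).hom) _
  rw [LinearMap.lTensor, LinearMap.rTensor, ← TensorProduct.map_comp, LinearMap.id_comp,
    LinearMap.comp_id]

/-- The map from homology to the sum of the torsion products of homology modules. -/
noncomputable def homologyToTor (r : ℕ) : E.homology r ⟶
    ⨁ fun p : TorIndex r =>
      ((Tor (ModuleCat.{0} R) 1).obj (C.homology p.1.1)).obj (D.homology p.1.2) :=
  biproduct.lift fun p => T.toTor p.2

theorem homologyToTor_π {r : ℕ} (p : TorIndex r) :
    T.homologyToTor r ≫ biproduct.π (fun p : TorIndex r =>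
      ((Tor (ModuleCat.{0} R) 1).obj (C.homology p.1.1)).obj (D.homology p.1.2)) p =
      T.toTor p.2 :=
  biproduct.lift_π _ _

theorem π_homologyToTor_apply {r : ℕ} (p : TorIndex r) (x : E.homology r) :
    (biproduct.π (fun p : TorIndex r => ((Tor (ModuleCat.{0} R) 1).obj (C.homology p.1.1)).obj
      (D.homology p.1.2)) p).hom ((T.homologyToTor r).hom x) = (T.toTor p.2).hom x :=
  LinearMap.congr_fun (congrArg ModuleCat.Hom.hom (T.homologyToTor_π p)) x

theorem homologyToTor_naturality {T : TensorDecomposition C D E}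
    {T' : TensorDecomposition C' D' E'} {f : C ⟶ C'} {g : D ⟶ D'} {e : E ⟶ E'}
    (he : IsCompatible T T' f g e) (r : ℕ) :
    HomologicalComplex.homologyMap e r ≫ T'.homologyToTor r =
      T.homologyToTor r ≫ biproduct.map fun p : TorIndex r =>
        ((Tor (ModuleCat.{0} R) 1).map (HomologicalComplex.homologyMap f p.1.1)).app _ ≫
          ((Tor (ModuleCat.{0} R) 1).obj _).map (HomologicalComplex.homologyMap g p.1.2) := by
  refine biproduct.hom_ext _ _ fun p => ?_
  rw [Category.assoc, Category.assoc, biproduct.map_π, homologyToTor_π,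
    reassoc_of% T.homologyToTor_π, toTor_naturality he]

theorem tensorToHomology_homologyToTor (r : ℕ) :
    T.tensorToHomology r ≫ T.homologyToTor r = 0 := by
  refine biproduct.hom_ext' _ _ fun p => biproduct.hom_ext _ _ fun q => ?_
  rw [reassoc_of% T.ι_tensorToHomology, Category.assoc, homologyToTor_π, comp_zero, zero_comp]
  refine ModuleCat.hom_ext (LinearMap.ext fun t => ?_)
  exact (T.toTor_eq_zero_iff q.2 _).2 (T.toHomologyTensorBounds_homologyProduct p.2 q.2 t)

theorem mem_range_tensorToHomology {r : ℕ} (x : E.homology r)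
    (hx : (T.homologyToTor r).hom x = 0) : ∃ y, (T.tensorToHomology r).hom y = x := by
  have h₁ : x ∈ ⨆ p : TensorIndex r, LinearMap.range (T.homologyProduct p.2) := by
    refine T.mem_iSup_range_homologyProduct x fun i j h => (T.toTor_eq_zero_iff h x).1 ?_
    rw [← T.π_homologyToTor_apply ⟨(i, j), h⟩ x, hx, map_zero]
  refine (iSup_le fun p => ?_ : _ ≤ LinearMap.range (T.tensorToHomology r).hom) h₁
  rintro _ ⟨t, rfl⟩
  exact ⟨_, LinearMap.congr_fun (congrArg ModuleCat.Hom.hom (T.ι_tensorToHomology p)) t⟩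

/-- Each element of one summand is hit by a class with zero components in all other summands, so a
map that kills the image kills every summand. -/
theorem epi_homologyToTor (r : ℕ) : Epi (T.homologyToTor r) := by
  refine Preadditive.epi_of_cancel_zero _ fun g hg => biproduct.hom_ext' _ _ fun p => ?_
  rw [comp_zero]
  refine ModuleCat.hom_ext (LinearMap.ext fun t => ?_)
  obtain ⟨x, hx, hx'⟩ := T.exists_toHomologyTensorBounds_eq p.2
    (((homologyPresentation_shortExact D p.1.2).torι (C.homology p.1.1)).hom t)
    (LinearMap.congr_fun (congrArg ModuleCat.Hom.hom
      ((homologyPresentation_shortExact D p.1.2).torι_comp (C.homology p.1.1))) t)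
  have e : (biproduct.ι (fun p : TorIndex r => ((Tor (ModuleCat.{0} R) 1).obj
      (C.homology p.1.1)).obj (D.homology p.1.2)) p).hom t = (T.homologyToTor r).hom x := by
    refine ModuleCat.biproduct_ext fun q => ?_
    rw [π_homologyToTor_apply, ← LinearMap.comp_apply, ← ModuleCat.hom_comp]
    by_cases hpq : p = q
    · subst hpq
      rw [biproduct.ι_π_self]
      refine torι_injective C D _ _ ?_
      rw [torι_toTor, hx]
      rfl
    · rw [biproduct.ι_π_ne _ hpq]
      refine ((T.toTor_eq_zero_iff q.2 x).2 (hx' _ _ q.2 fun e => hpq ?_)).symm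
      have h₁ := p.2
      have h₂ := q.2
      exact Subtype.ext (Prod.ext e.symm (by omega))
  refine (congrArg g.hom e).trans ?_
  exact LinearMap.congr_fun (congrArg ModuleCat.Hom.hom hg) x

/-- The Künneth sequence. -/
noncomputable abbrev kunnethSequence (r : ℕ) : ShortComplex (ModuleCat.{0} R) :=
  ShortComplex.mk (T.tensorToHomology r) (T.homologyToTor r) (T.tensorToHomology_homologyToTor r)

/-- A retraction of the homology product in bidegree `(i, j)`. -/
noncomputable def homologyToTensor {i j r : ℕ} (h : i + j = r) :
    E.homology r ⟶ C.homology i ⊗ D.homology j :=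
  ModuleCat.ofHom (T.homologyRetraction h)

theorem tensorToHomology_retraction (r : ℕ) :
    T.tensorToHomology r ≫ (biproduct.lift fun p : TensorIndex r => T.homologyToTensor p.2) =
      𝟙 _ := by
  refine biproduct.hom_ext' _ _ fun p => biproduct.hom_ext _ _ fun q => ?_
  rw [reassoc_of% T.ι_tensorToHomology, Category.assoc, biproduct.lift_π, Category.comp_id]
  by_cases hpq : p = q
  · subst hpq
    rw [biproduct.ι_π_self]
    exact ModuleCat.hom_ext (LinearMap.ext (T.homologyRetraction_homologyProduct p.2))
  · rw [biproduct.ι_π_ne _ hpq]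
    refine ModuleCat.hom_ext (LinearMap.ext (T.homologyRetraction_homologyProduct_of_ne p.2 q.2
      fun e => hpq ?_))
    have h₁ := p.2
    have h₂ := q.2
    exact Subtype.ext (Prod.ext e.symm (by omega))

theorem nonempty_splitting_kunnethSequence (r : ℕ) : Nonempty (T.kunnethSequence r).Splitting :=
  ⟨ShortComplex.Splitting.ofExactOfRetraction _
    ((ShortComplex.ShortExact.moduleCat_exact_iff_function_exact _).2 fun x =>
      ⟨T.mem_range_tensorToHomology x, by
        rintro ⟨y, rfl⟩
        exact LinearMap.congr_fun (congrArg ModuleCat.Hom.hom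
          (T.tensorToHomology_homologyToTor r)) y⟩)
    _ (T.tensorToHomology_retraction r) (T.epi_homologyToTor r)⟩

end ChainComplex.TensorDecomposition

namespace KGraph

variable (k₁ k₂ r : ℕ)

/-- The homology product as a natural transformation. -/
noncomputable def kunnethProduct : tensorHomology k₁ k₂ r ⟶ prodHomology k₁ k₂ r where
  app P := (tensorDecomposition P.1 P.2).tensorToHomology r
  naturality _ _ φ := ChainComplex.TensorDecomposition.tensorToHomology_naturality
    (isCompatible_chainMap φ.1 φ.2) r

/-- The map to the torsion products as a natural transformation. -/
noncomputable def kunnethTor : prodHomology k₁ k₂ r ⟶ torHomology k₁ k₂ r where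
  app P := (tensorDecomposition P.1 P.2).homologyToTor r
  naturality _ _ φ := ChainComplex.TensorDecomposition.homologyToTor_naturality
    (isCompatible_chainMap φ.1 φ.2) r

variable {k₁ k₂ r}

theorem kunnethProduct_ι {Λ₁ : KGraph k₁} {Λ₂ : KGraph k₂} (p : TensorIndex r)
    (t : TensorProduct ℤ (Λ₁.chainComplex.homology p.1.1) (Λ₂.chainComplex.homology p.1.2)) :
    ((kunnethProduct k₁ k₂ r).app (Λ₁, Λ₂)).hom
      ((biproduct.ι (fun q : TensorIndex r => (homologyFunctor k₁ q.1.1).obj Λ₁ ⊗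
        (homologyFunctor k₂ q.1.2).obj Λ₂) p).hom t) =
      (tensorDecomposition Λ₁ Λ₂).homologyProduct p.2 t :=
  LinearMap.congr_fun (congrArg ModuleCat.Hom.hom
    ((tensorDecomposition Λ₁ Λ₂).ι_tensorToHomology p)) t

theorem cycleChain_cyclesProduct {Λ₁ : KGraph k₁} {Λ₂ : KGraph k₂} {i j : ℕ} (h : i + j = r)
    (z₁ : Λ₁.chainComplex.cycles i) (z₂ : Λ₂.chainComplex.cycles j) :
    cycleChain ((tensorDecomposition Λ₁ Λ₂).cyclesProduct h (TensorProduct.tmul ℤ z₁ z₂)) =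
      cross h (cycleChain z₁) (cycleChain z₂) :=
  ((tensorDecomposition Λ₁ Λ₂).iCycles_cyclesProduct h _).trans
    ((tensorDecomposition_single h _).trans (crossLin_tmul h _ _))

theorem kunnethProduct_homologyClass {Λ₁ : KGraph k₁} {Λ₂ : KGraph k₂} (p : TensorIndex r)
    (z₁ : Λ₁.chainComplex.cycles p.1.1) (z₂ : Λ₂.chainComplex.cycles p.1.2) :
    ((kunnethProduct k₁ k₂ r).app (Λ₁, Λ₂)).hom
      ((biproduct.ι (fun q : TensorIndex r => (homologyFunctor k₁ q.1.1).obj Λ₁ ⊗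
        (homologyFunctor k₂ q.1.2).obj Λ₂) p).hom
        (TensorProduct.tmul ℤ (homologyClass z₁) (homologyClass z₂))) =
      homologyClass ((tensorDecomposition Λ₁ Λ₂).cyclesProduct p.2 (TensorProduct.tmul ℤ z₁ z₂)) :=
  (kunnethProduct_ι p _).trans ((tensorDecomposition Λ₁ Λ₂).homologyProduct_map p.2
    (TensorProduct.tmul ℤ z₁ z₂))

theorem kunneth_splitExact (k₁ k₂ r : ℕ) (Λ₁ : KGraph k₁) (Λ₂ : KGraph k₂) :
    ∃ w : (kunnethProduct k₁ k₂ r).app (Λ₁, Λ₂) ≫ (kunnethTor k₁ k₂ r).app (Λ₁, Λ₂) = 0,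
      (ShortComplex.mk _ _ w).ShortExact ∧ Nonempty (ShortComplex.mk _ _ w).Splitting := by
  obtain ⟨s⟩ := (tensorDecomposition Λ₁ Λ₂).nonempty_splitting_kunnethSequence r
  exact ⟨(tensorDecomposition Λ₁ Λ₂).tensorToHomology_homologyToTor r, s.shortExact, ⟨s⟩⟩

end KGraph

/-! ### A family of `2`-graphs -/

namespace KGraph

/-- The vertices of the `2`-graphs `squareGraph θ`. -/
inductive SquareObj : Type
  | source (v : Bool)
  | left
  | right
  | sink

/-- The paths of the `2`-graphs `squareGraph θ`. -/
inductive SquareHom (I : Type) : SquareObj → SquareObj → Type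
  | id (x : SquareObj) : SquareHom I x x
  | toLeft (v : Bool) : SquareHom I (.source v) .left
  | toRight (v : Bool) : SquareHom I (.source v) .right
  | fromLeft (i : I) : SquareHom I .left .sink
  | fromRight (i : I) : SquareHom I .right .sink
  | diag (v : Bool) (i : I) : SquareHom I (.source v) .sink

namespace SquareHom

variable {I J : Type}

/-- The composition of paths. -/
def comp (θ : Bool → Equiv.Perm I) :
    ∀ {x y z : SquareObj}, SquareHom I x y → SquareHom I y z → SquareHom I x z
  | _, _, _, .id _, g => g
  | _, _, _, .toLeft v, .id _ => .toLeft v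
  | _, _, _, .toLeft v, .fromLeft i => .diag v i
  | _, _, _, .toRight v, .id _ => .toRight v
  | _, _, _, .toRight v, .fromRight i => .diag v ((θ v).symm i)
  | _, _, _, .fromLeft i, .id _ => .fromLeft i
  | _, _, _, .fromRight i, .id _ => .fromRight i
  | _, _, _, .diag v i, .id _ => .diag v i

/-- The degree of a path. -/
def degree : ∀ {x y : SquareObj}, SquareHom I x y → Fin 2 → ℕ
  | _, _, .id _ => ![0, 0]
  | _, _, .toLeft _ => ![1, 0]
  | _, _, .toRight _ => ![0, 1]
  | _, _, .fromLeft _ => ![0, 1]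
  | _, _, .fromRight _ => ![1, 0]
  | _, _, .diag _ _ => ![1, 1]

/-- The map of paths induced by a map of index sets. -/
def map (g : I → J) : ∀ {x y : SquareObj}, SquareHom I x y → SquareHom J x y
  | _, _, .id x => .id x
  | _, _, .toLeft v => .toLeft v
  | _, _, .toRight v => .toRight v
  | _, _, .fromLeft i => .fromLeft (g i)
  | _, _, .fromRight i => .fromRight (g i)
  | _, _, .diag v i => .diag v (g i)

theorem comp_id (θ : Bool → Equiv.Perm I) {x y : SquareObj} (f : SquareHom I x y) :
    f.comp θ (.id y) = f := by
  cases f <;> rfl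

theorem comp_assoc (θ : Bool → Equiv.Perm I) {x y z w : SquareObj} (f : SquareHom I x y)
    (g : SquareHom I y z) (h : SquareHom I z w) :
    (f.comp θ g).comp θ h = f.comp θ (g.comp θ h) := by
  cases f <;> cases g <;> cases h <;> rfl

theorem degree_comp (θ : Bool → Equiv.Perm I) {x y z : SquareObj} (f : SquareHom I x y)
    (g : SquareHom I y z) : (f.comp θ g).degree = f.degree + g.degree := by
  cases f <;> cases g <;> simp [comp, degree]

theorem degree_map (g : I → J) {x y : SquareObj} (f : SquareHom I x y) :
    (f.map g).degree = f.degree := by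
  cases f <;> rfl

theorem map_comp {θ : Bool → Equiv.Perm I} {η : Bool → Equiv.Perm J} {g : I → J}
    (hg : ∀ v i, g (θ v i) = η v (g i)) {x y z : SquareObj} (f : SquareHom I x y)
    (f' : SquareHom I y z) : (f.comp θ f').map g = (f.map g).comp η (f'.map g) := by
  have hg' : ∀ v i, g ((θ v).symm i) = (η v).symm (g i) := fun v i => by
    rw [Equiv.eq_symm_apply, ← hg, Equiv.apply_symm_apply]
  cases f <;> cases f' <;> simp [comp, map, hg']

instance [Countable I] : Countable (Σ x y : SquareObj, SquareHom I x y) := by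
  have h : Countable SquareObj := by
    refine Function.Surjective.countable (α := Bool ⊕ Fin 3)
      (f := Sum.elim .source ![.left, .right, .sink]) ?_
    rintro (v | _ | _ | _)
    exacts [⟨.inl v, rfl⟩, ⟨.inr 0, rfl⟩, ⟨.inr 1, rfl⟩, ⟨.inr 2, rfl⟩]
  refine Function.Surjective.countable
    (α := SquareObj ⊕ (Bool ⊕ Bool) ⊕ (I ⊕ I) ⊕ Bool × I)
    (f := Sum.elim (fun x => ⟨x, x, .id x⟩) (Sum.elim
      (Sum.elim (fun v => ⟨_, _, .toLeft v⟩) (fun v => ⟨_, _, .toRight v⟩))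
      (Sum.elim (Sum.elim (fun i => ⟨_, _, .fromLeft i⟩) (fun i => ⟨_, _, .fromRight i⟩))
        fun p => ⟨_, _, .diag p.1 p.2⟩))) ?_
  rintro ⟨x, _, (_ | v | v | i | i | ⟨v, i⟩)⟩
  exacts [⟨.inl x, rfl⟩, ⟨.inr (.inl (.inl v)), rfl⟩, ⟨.inr (.inl (.inr v)), rfl⟩,
    ⟨.inr (.inr (.inl (.inl i))), rfl⟩, ⟨.inr (.inr (.inl (.inr i))), rfl⟩,
    ⟨.inr (.inr (.inr (v, i))), rfl⟩]

/-- Degrees are at most `(1, 1)`, which leaves finitely many splittings `m + n`. In each one the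
types and degrees determine the factors, except that a square read through `right` needs `θ v` to be
a bijection. -/
theorem factorisation (θ : Bool → Equiv.Perm I) {x y : SquareObj} (f : SquareHom I x y)
    (m n : Fin 2 → ℕ) (h : f.degree = m + n) :
    ∃! p : Σ z : SquareObj, SquareHom I z y × SquareHom I x z,
      p.2.1.degree = m ∧ p.2.2.degree = n ∧ p.2.2.comp θ p.2.1 = f := by
  obtain ⟨a, b, rfl⟩ : ∃ a b, m = ![a, b] := ⟨m 0, m 1, by ext i; fin_cases i <;> rfl⟩
  obtain ⟨c, d, rfl⟩ : ∃ c d, n = ![c, d] := ⟨n 0, n 1, by ext i; fin_cases i <;> rfl⟩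
  have h₀ := congrFun h 0
  have h₁ := congrFun h 1
  clear h
  cases f with
  | id =>
    simp only [degree, Pi.add_apply, Matrix.cons_val_zero, Matrix.cons_val_one] at h₀ h₁
    have ha : a = 0 ∧ c = 0 := by omega
    have hb : b = 0 ∧ d = 0 := by omega
    clear h₀ h₁
    obtain ⟨rfl, rfl⟩ := ha
    obtain ⟨rfl, rfl⟩ := hb
    · refine ⟨⟨_, .id _, .id _⟩, by simp [degree, comp], ?_⟩
      rintro ⟨z, μ, ν⟩ ⟨e₁, e₂, e₃⟩
      cases ν <;> cases μ <;> simp_all [comp, degree]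
  | toLeft v =>
    simp only [degree, Pi.add_apply, Matrix.cons_val_zero, Matrix.cons_val_one] at h₀ h₁
    have ha : a = 0 ∧ c = 1 ∨ a = 1 ∧ c = 0 := by omega
    have hb : b = 0 ∧ d = 0 := by omega
    clear h₀ h₁
    rcases ha with ⟨rfl, rfl⟩ | ⟨rfl, rfl⟩ <;> obtain ⟨rfl, rfl⟩ := hb
    · refine ⟨⟨_, .id _, .toLeft v⟩, by simp [degree, comp], ?_⟩
      rintro ⟨z, μ, ν⟩ ⟨e₁, e₂, e₃⟩
      cases ν <;> cases μ <;> simp_all [comp, degree]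
    · refine ⟨⟨_, .toLeft v, .id _⟩, by simp [degree, comp], ?_⟩
      rintro ⟨z, μ, ν⟩ ⟨e₁, e₂, e₃⟩
      cases ν <;> cases μ <;> simp_all [comp, degree]
  | toRight v =>
    simp only [degree, Pi.add_apply, Matrix.cons_val_zero, Matrix.cons_val_one] at h₀ h₁
    have ha : a = 0 ∧ c = 0 := by omega
    have hb : b = 0 ∧ d = 1 ∨ b = 1 ∧ d = 0 := by omega
    clear h₀ h₁
    obtain ⟨rfl, rfl⟩ := ha
    rcases hb with ⟨rfl, rfl⟩ | ⟨rfl, rfl⟩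
    · refine ⟨⟨_, .id _, .toRight v⟩, by simp [degree, comp], ?_⟩
      rintro ⟨z, μ, ν⟩ ⟨e₁, e₂, e₃⟩
      cases ν <;> cases μ <;> simp_all [comp, degree]
    · refine ⟨⟨_, .toRight v, .id _⟩, by simp [degree, comp], ?_⟩
      rintro ⟨z, μ, ν⟩ ⟨e₁, e₂, e₃⟩
      cases ν <;> cases μ <;> simp_all [comp, degree]
  | fromLeft i =>
    simp only [degree, Pi.add_apply, Matrix.cons_val_zero, Matrix.cons_val_one] at h₀ h₁
    have ha : a = 0 ∧ c = 0 := by omega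
    have hb : b = 0 ∧ d = 1 ∨ b = 1 ∧ d = 0 := by omega
    clear h₀ h₁
    obtain ⟨rfl, rfl⟩ := ha
    rcases hb with ⟨rfl, rfl⟩ | ⟨rfl, rfl⟩
    · refine ⟨⟨_, .id _, .fromLeft i⟩, by simp [degree, comp], ?_⟩
      rintro ⟨z, μ, ν⟩ ⟨e₁, e₂, e₃⟩
      cases ν <;> cases μ <;> simp_all [comp, degree]
    · refine ⟨⟨_, .fromLeft i, .id _⟩, by simp [degree, comp], ?_⟩
      rintro ⟨z, μ, ν⟩ ⟨e₁, e₂, e₃⟩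
      cases ν <;> cases μ <;> simp_all [comp, degree]
  | fromRight i =>
    simp only [degree, Pi.add_apply, Matrix.cons_val_zero, Matrix.cons_val_one] at h₀ h₁
    have ha : a = 0 ∧ c = 1 ∨ a = 1 ∧ c = 0 := by omega
    have hb : b = 0 ∧ d = 0 := by omega
    clear h₀ h₁
    rcases ha with ⟨rfl, rfl⟩ | ⟨rfl, rfl⟩ <;> obtain ⟨rfl, rfl⟩ := hb
    · refine ⟨⟨_, .id _, .fromRight i⟩, by simp [degree, comp], ?_⟩
      rintro ⟨z, μ, ν⟩ ⟨e₁, e₂, e₃⟩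
      cases ν <;> cases μ <;> simp_all [comp, degree]
    · refine ⟨⟨_, .fromRight i, .id _⟩, by simp [degree, comp], ?_⟩
      rintro ⟨z, μ, ν⟩ ⟨e₁, e₂, e₃⟩
      cases ν <;> cases μ <;> simp_all [comp, degree]
  | diag v i =>
    simp only [degree, Pi.add_apply, Matrix.cons_val_zero, Matrix.cons_val_one] at h₀ h₁
    have ha : a = 0 ∧ c = 1 ∨ a = 1 ∧ c = 0 := by omega
    have hb : b = 0 ∧ d = 1 ∨ b = 1 ∧ d = 0 := by omega
    clear h₀ h₁
    rcases ha with ⟨rfl, rfl⟩ | ⟨rfl, rfl⟩ <;> rcases hb with ⟨rfl, rfl⟩ | ⟨rfl, rfl⟩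
    · refine ⟨⟨_, .id _, .diag v i⟩, by simp [degree, comp], ?_⟩
      rintro ⟨z, μ, ν⟩ ⟨e₁, e₂, e₃⟩
      cases ν <;> cases μ <;> simp_all [comp, degree]
    · refine ⟨⟨_, .fromLeft i, .toLeft v⟩, by simp [degree, comp], ?_⟩
      rintro ⟨z, μ, ν⟩ ⟨e₁, e₂, e₃⟩
      cases ν <;> cases μ <;> simp_all [comp, degree]
    -- The composite with `fromRight j` is the square with index `(θ v).symm j`, so `j` must be `θ v
    -- i`.
    · refine ⟨⟨_, .fromRight (θ v i), .toRight v⟩, by simp [degree, comp], ?_⟩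
      rintro ⟨z, μ, ν⟩ ⟨e₁, e₂, e₃⟩
      cases ν <;> cases μ <;> simp_all [comp, degree]
      exact (Equiv.symm_apply_eq _).1 e₃
    · refine ⟨⟨_, .diag v i, .id _⟩, by simp [degree, comp], ?_⟩
      rintro ⟨z, μ, ν⟩ ⟨e₁, e₂, e₃⟩
      cases ν <;> cases μ <;> simp_all [comp, degree]

end SquareHom

/-- A `2`-graph with squares indexed by `Bool × I`, where the square `(v, i)` is
`toLeft v ≫ fromLeft i = toRight v ≫ fromRight (θ v i)`. -/
def squareGraph {I : Type} [Countable I] (θ : Bool → Equiv.Perm I) : KGraph 2 where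
  Obj := SquareObj
  cat :=
    { Hom := SquareHom I
      id := .id
      comp := SquareHom.comp θ
      id_comp := fun _ => rfl
      comp_id := SquareHom.comp_id θ
      assoc := SquareHom.comp_assoc θ }
  nonempty := ⟨.left⟩
  countable := inferInstanceAs (Countable (Σ x y : SquareObj, SquareHom I x y))
  deg := SquareHom.degree
  deg_id _ := by
    ext i
    fin_cases i <;> rfl
  deg_comp := SquareHom.degree_comp θ
  factorisation := SquareHom.factorisation θ

/-- The morphism induced by an equivariant map of index sets. -/
def squareGraphMap {I J : Type} [Countable I] [Countable J] {θ : Bool → Equiv.Perm I}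
    {η : Bool → Equiv.Perm J} (g : I → J) (hg : ∀ v i, g (θ v i) = η v (g i)) :
    squareGraph θ ⟶ squareGraph η where
  functor :=
    { obj := fun x => x
      map := SquareHom.map g
      map_id := fun _ => rfl
      map_comp := SquareHom.map_comp hg }
  deg_map := SquareHom.degree_map g

end KGraph

namespace KGraph

/-! ### Squares of `2`-graphs -/

theorem Cube.isEmpty_of_lt {k r : ℕ} (Λ : KGraph k) (h : k < r) : IsEmpty (Λ.Cube r) := by
  refine ⟨fun c => ?_⟩
  have := Finset.sum_le_sum fun i (_ : i ∈ Finset.univ) => c.le_one i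
  rw [c.sum_degree] at this
  simp at this
  omega

theorem Cube.degree_eq_one {Λ : KGraph 2} (c : Λ.Cube 2) (i : Fin 2) : c.path.degree i = 1 := by
  have h := c.sum_degree
  rw [Fin.sum_univ_two] at h
  have h₀ := c.le_one 0
  have h₁ := c.le_one 1
  fin_cases i
  · change c.path.degree 0 = 1
    omega
  · change c.path.degree 1 = 1
    omega

/-- Both directions occur in a `2`-cube of a `2`-graph, so the position of direction `i : Fin 2` is
`i + 1`. -/
theorem Cube.boundary_of_isFace {Λ : KGraph 2} (c : Λ.Cube 2) (q : Fin 2 → Fin 2 → Λ.Cube 1)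
    (hq : ∀ l i, IsFace l i c.path (q l i).path) :
    c.boundary = Finsupp.single (q 0 1) 1 - Finsupp.single (q 0 0) 1 +
      (Finsupp.single (q 1 0) 1 - Finsupp.single (q 1 1) 1) := by
  have h : ∀ l : Fin 2, (∑ i : c.Dir, Finsupp.single (c.face l i) ((-1 : ℤ) ^ (c.pos i + l.1))) =
      ∑ i : Fin 2, Finsupp.single (q l i) ((-1 : ℤ) ^ (i.1 + 1 + l.1)) := by
    intro l
    refine Fintype.sum_equiv (Equiv.subtypeUnivEquiv c.degree_eq_one) _ _ fun i => ?_
    rw [c.face_eq l i (q l i.1) (hq l i.1)]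
    have hp : c.pos i = i.1.1 + 1 := by
      obtain ⟨i, hi⟩ := i
      rw [Cube.pos]
      simp only [c.degree_eq_one, true_and]
      fin_cases i <;> rfl
    rw [hp]
    rfl
  rw [Cube.boundary, Fin.sum_univ_two, h, h, Fin.sum_univ_two, Fin.sum_univ_two]
  simp [Finsupp.single_neg, pow_succ]
  abel

/-! ### The chains of `squareGraph θ` -/

section

variable {I : Type} [Countable I] (θ : Bool → Equiv.Perm I)

/-- A path as a cube. -/
def squareCube {x y : SquareObj} (f : SquareHom I x y) (r : ℕ) (h : ∀ i, f.degree i ≤ 1)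
    (h' : ∑ i, f.degree i = r) : (squareGraph θ).Cube r :=
  ⟨⟨x, y, f⟩, h, h'⟩

/-- The edge `left → sink` with index `i`. -/
def leftEdge (i : I) : (squareGraph θ).Cube 1 :=
  squareCube θ (.fromLeft i) 1 (Fin.forall_fin_two.2 ⟨zero_le_one, le_rfl⟩) (Fin.sum_univ_two _)

/-- The edge `right → sink` with index `i`. -/
def rightEdge (i : I) : (squareGraph θ).Cube 1 :=
  squareCube θ (.fromRight i) 1 (Fin.forall_fin_two.2 ⟨le_rfl, zero_le_one⟩) (Fin.sum_univ_two _)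

/-- The edge `source v → left`. -/
def toLeftEdge (v : Bool) : (squareGraph θ).Cube 1 :=
  squareCube θ (.toLeft v) 1 (Fin.forall_fin_two.2 ⟨le_rfl, zero_le_one⟩) (Fin.sum_univ_two _)

/-- The edge `source v → right`. -/
def toRightEdge (v : Bool) : (squareGraph θ).Cube 1 :=
  squareCube θ (.toRight v) 1 (Fin.forall_fin_two.2 ⟨zero_le_one, le_rfl⟩) (Fin.sum_univ_two _)

/-- The square with index `(v, i)`. -/
def diagSquare (v : Bool) (i : I) : (squareGraph θ).Cube 2 :=
  squareCube θ (.diag v i) 2 (Fin.forall_fin_two.2 ⟨le_rfl, le_rfl⟩) (Fin.sum_univ_two _)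

theorem squareCube_eq_diagSquare {x y : SquareObj} (f : SquareHom I x y)
    (h : ∀ i, f.degree i ≤ 1) (h' : ∑ i, f.degree i = 2) :
    ∃ v i, squareCube θ f 2 h h' = diagSquare θ v i := by
  cases f with
  | diag v i => exact ⟨v, i, rfl⟩
  | _ => simp [SquareHom.degree] at h'

theorem exists_diagSquare_eq (c : (squareGraph θ).Cube 2) : ∃ v i, c = diagSquare θ v i :=
  squareCube_eq_diagSquare θ c.path.hom c.le_one c.sum_degree

theorem boundary_diagSquare (v : Bool) (i : I) :
    (diagSquare θ v i).boundary =
      Finsupp.single (rightEdge θ (θ v i)) 1 - Finsupp.single (leftEdge θ i) 1 +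
        (Finsupp.single (toRightEdge θ v) 1 - Finsupp.single (toLeftEdge θ v) 1) := by
  have e : ∀ j : Fin 2, (Pi.single j 1 : Fin 2 → ℕ) = ![![1, 0], ![0, 1]] j := by decide
  have hc : SquareHom.comp θ (.toRight v) (.fromRight (θ v i)) = .diag v i := by
    simp [SquareHom.comp]
  -- Rows are indexed by `l`, columns by the direction of the removed edge.
  refine (diagSquare θ v i).boundary_of_isFace
    ![![leftEdge θ i, rightEdge θ (θ v i)], ![toRightEdge θ v, toLeftEdge θ v]] ?_
  refine Fin.forall_fin_two.2 ⟨Fin.forall_fin_two.2 ⟨?_, ?_⟩, Fin.forall_fin_two.2 ⟨?_, ?_⟩⟩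
  · exact (isFace_zero_iff _ _).2 ⟨_, _, SquareHom.toLeft v, rfl, (e 0).symm, rfl⟩
  · exact (isFace_zero_iff _ _).2 ⟨_, _, SquareHom.toRight v, rfl, (e 1).symm, hc⟩
  · exact (isFace_one_iff _ _).2 ⟨_, _, SquareHom.fromRight (θ v i), rfl, (e 0).symm, hc⟩
  · exact (isFace_one_iff _ _).2 ⟨_, _, SquareHom.fromLeft i, rfl, (e 1).symm, rfl⟩

/-- The function on paths with given values on the edges. -/
def SquareHom.edgeValue {M : Type} [Zero M] (l r : I → M) (tl tr : Bool → M) :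
    ∀ {x y : SquareObj}, SquareHom I x y → M
  | _, _, .id _ => 0
  | _, _, .toLeft v => tl v
  | _, _, .toRight v => tr v
  | _, _, .fromLeft i => l i
  | _, _, .fromRight i => r i
  | _, _, .diag _ _ => 0

/-- The function on paths with given values on the squares. -/
def SquareHom.diagValue {M : Type} [Zero M] (a : Bool → I → M) :
    ∀ {x y : SquareObj}, SquareHom I x y → M
  | _, _, .diag v i => a v i
  | _, _, _ => 0

/-- The linear map on `1`-chains with given values on the edges. -/
noncomputable def edgeLift {M : Type} [AddCommGroup M] (l r : I → M) (tl tr : Bool → M) :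
    (squareGraph θ).Chain 1 →ₗ[ℤ] M :=
  Finsupp.linearCombination ℤ fun c => SquareHom.edgeValue l r tl tr (x := c.path.src) c.path.hom

theorem edgeLift_boundary {M : Type} [AddCommGroup M] (l r : I → M) (tl tr : Bool → M) (v : Bool)
    (i : I) : edgeLift θ l r tl tr (diagSquare θ v i).boundary =
      r (θ v i) - l i + (tr v - tl v) := by
  rw [boundary_diagSquare]
  simp only [edgeLift, map_add, map_sub, Finsupp.linearCombination_single, one_smul]
  rfl

end

end KGraph

/-! ### Products of classes of order two -/

namespace ChainComplex

theorem subsingleton_homology {R : Type} [CommRing R] (K : ChainComplex (ModuleCat.{0} R) ℕ)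
    {n : ℕ} (h : ∀ x : K.X n, (K.d n (n - 1)).hom x = 0 → x = 0) :
    Subsingleton (K.homology n) := by
  refine subsingleton_of_forall_eq 0 fun x => ?_
  obtain ⟨z, rfl⟩ := homologyπ_surjective K n x
  have : z = 0 := iCycles_injective K n ((h _ (d_iCycles K _ _ z)).trans (map_zero _).symm)
  rw [this, map_zero]

namespace TensorDecomposition

open TensorProduct KGraph

variable {R : Type} [CommRing R] {C D E : ChainComplex (ModuleCat.{0} R) ℕ}
  (T : TensorDecomposition C D E)

theorem comp_single_left {i j a b r : ℕ} (h : i + j = r) (h' : a + b = r) (hne : a ≠ i)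
    (t : C.X a ⊗[R] D.X b) (t' : C.X i ⊗[R] D.X j) :
    T.comp h (T.single h t' + T.single h' t) = t' := by
  rw [map_add, T.comp_single_self, T.comp_single_of_ne h' h hne.symm, add_zero]

theorem comp_single_right {i j a b r : ℕ} (h : i + j = r) (h' : a + b = r) (hne : a ≠ i)
    (t : C.X a ⊗[R] D.X b) (t' : C.X i ⊗[R] D.X j) :
    T.comp h (T.single h' t + T.single h t') = t' := by
  rw [add_comm, comp_single_left T h h' hne]

/-- The differential is `2z ⊗ z' - z ⊗ 2z' = 0`. The resulting cycle represents the torsion class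
built from two classes whose doubles are boundaries. -/
theorem exists_cycle_add {w : C.X 2} {z : C.X 1} {w' : D.X 2} {z' : D.X 1}
    (hw : (C.d 2 1).hom w = z + z) (hw' : (D.d 2 1).hom w' = z' + z')
    (hz : (C.d 1 0).hom z = 0) (hz' : (D.d 1 0).hom z' = 0) :
    ∃ ζ : E.cycles 3, (E.iCycles 3).hom ζ =
      T.single (i := 2) (j := 1) rfl (w ⊗ₜ z') + T.single (i := 1) (j := 2) rfl (z ⊗ₜ w') := by
  refine exists_cycle E _ ?_
  refine (map_add _ _ _).trans ?_
  refine (congrArg₂ (· + ·) (T.d_single_left (i := 1) (j := 1) (r := 2) rfl rfl _ ?_)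
    (T.d_single_right (i := 1) (j := 1) (r := 2) rfl rfl _ ?_)).trans ?_
  · exact (LinearMap.lTensor_tmul _ _ _ _).trans
      ((congrArg _ hz').trans (TensorProduct.tmul_zero _ _))
  · exact (LinearMap.rTensor_tmul _ _ _ _).trans
      ((congrArg (· ⊗ₜ w') hz).trans (TensorProduct.zero_tmul _ _))
  · rw [LinearMap.rTensor_tmul, LinearMap.lTensor_tmul]
    refine ((congrArg₂ (· + ·) (congrArg (T.single rfl) (congrArg (· ⊗ₜ[R] z') hw))
      (congrArg (fun t => T.single rfl ((-1 : R) ^ 1 • (z ⊗ₜ[R] t))) hw'))).trans ?_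
    rw [← map_add, pow_one, neg_smul, one_smul, TensorProduct.add_tmul, TensorProduct.tmul_add,
      add_neg_cancel, map_zero]

/-- A test that the image of the class is nonzero. In bidegree `(2, 1)` a boundary is a sum of a `d
⊗ 1` term from `C'_3 = 0` and a `1 ⊗ d` term, which `φ` kills. Since there are no `3`-chains, any
functional `χ` on `2`-chains is admissible. -/
theorem tmul_eq_zero_of_homologyMap_eq_zero {C' D' E' : ChainComplex (ModuleCat.{0} R) ℕ}
    {T : TensorDecomposition C D E} {T' : TensorDecomposition C' D' E'} {f : C ⟶ C'} {g : D ⟶ D'}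
    {e : E ⟶ E'} (he : IsCompatible T T' f g e) {w : C.X 2} {z : C.X 1} {w' : D.X 2} {z' : D.X 1}
    {ζ : E.cycles 3} (hζ : (E.iCycles 3).hom ζ =
      T.single (i := 2) (j := 1) rfl (w ⊗ₜ z') + T.single (i := 1) (j := 2) rfl (z ⊗ₜ w'))
    (h : (HomologicalComplex.homologyMap e 3).hom ((E.homologyπ 3).hom ζ) = 0)
    (h₃ : Subsingleton (C'.X 3)) {M N : Type} [AddCommGroup M] [Module R M] [AddCommGroup N]
    [Module R N] (χ : C'.X 2 →ₗ[R] M) (φ : D'.X 1 →ₗ[R] N)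
    (hφ : ∀ x, φ ((D'.d 2 1).hom x) = 0) :
    χ ((f.f 2).hom w) ⊗ₜ[R] φ ((g.f 1).hom z') = 0 := by
  rw [homologyMap_homologyπ, homologyπ_eq_zero_iff] at h
  obtain ⟨y, hy⟩ := h
  have h₁ := congrArg (T'.comp (i := 2) (j := 1) rfl) hy
  rw [iCycles_cyclesMap, he, hζ, T.comp_single_left _ _ (by decide),
    T'.comp_d (i := 2) (j := 1) rfl rfl rfl, TensorProduct.map_tmul] at h₁
  have h₂ : (C'.d 3 2).hom = 0 := LinearMap.ext fun x => by
    rw [Subsingleton.elim x 0, map_zero, map_zero]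
  have h₄ : φ ∘ₗ (D'.d 2 1).hom = 0 := LinearMap.ext hφ
  refine (congrArg (TensorProduct.map χ φ) h₁).trans ?_
  rw [map_add, map_smul, h₂, LinearMap.rTensor_zero, LinearMap.zero_apply, map_zero, zero_add,
    LinearMap.lTensor, TensorProduct.map_map, h₄, TensorProduct.map_zero_right,
    LinearMap.zero_apply, smul_zero]

/-- The component `w ⊗ z'` dies because the image of `z'` is a cycle, the component `z ⊗ w'` because
the image of `z` is a boundary, and there is no third component. -/
theorem homologyToTor_homologyMap_eq_zero [IsDomain R] [IsPrincipalIdealRing R]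
    {C' D' E' : ChainComplex (ModuleCat.{0} R) ℕ}
    [∀ n, Module.Free R (C'.X n)] [∀ n, Module.Free R (D'.X n)] {T : TensorDecomposition C D E}
    {T' : TensorDecomposition C' D' E'} {f : C ⟶ C'} {g : D ⟶ D'} {e : E ⟶ E'}
    (he : IsCompatible T T' f g e) {w : C.X 2} {z : C.X 1} {w' : D.X 2} {z' : D.X 1}
    {ζ : E.cycles 3} (hζ : (E.iCycles 3).hom ζ =
      T.single (i := 2) (j := 1) rfl (w ⊗ₜ z') + T.single (i := 1) (j := 2) rfl (z ⊗ₜ w'))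
    {y : C'.X 2}
    (hy : (C'.d 2 1).hom y = (f.f 1).hom z) (hz' : (D'.d 1 0).hom ((g.f 1).hom z') = 0) :
    (T'.homologyToTor 3).hom
      ((HomologicalComplex.homologyMap e 3).hom ((E.homologyπ 3).hom ζ)) = 0 := by
  refine ModuleCat.biproduct_ext fun p => ?_
  rw [π_homologyToTor_apply, map_zero, toTor_eq_zero_iff, homologyMap_homologyπ,
    toHomologyTensorBounds_homologyπ, iCycles_cyclesMap, he, hζ]
  obtain ⟨⟨i, j⟩, h⟩ := p
  dsimp only at h ⊢
  have hi : i = 2 ∧ j = 0 ∨ i = 1 ∧ j = 1 ∨ i = 0 ∧ j = 2 := by omega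
  rcases hi with ⟨rfl, rfl⟩ | ⟨rfl, rfl⟩ | ⟨rfl, rfl⟩
  · rw [T.comp_single_left _ _ (by decide), TensorProduct.map_tmul, TensorProduct.map_tmul]
    have h₁ : toBounds D' 0 ((g.f 1).hom z') = 0 := Subtype.ext (iCycles_injective D' 0
      ((iCycles_toCycles D' 0 _).trans (hz'.trans (map_zero _).symm)))
    exact (congrArg (_ ⊗ₜ[R] ·) h₁).trans (TensorProduct.tmul_zero _ _)
  · rw [T.comp_single_right _ _ (by decide), TensorProduct.map_tmul,
      TensorProduct.map_tmul, ← hy, chainsToHomology_d, TensorProduct.zero_tmul]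
  · rw [map_add, T.comp_single_of_ne _ _ (by decide), T.comp_single_of_ne _ _ (by decide),
      add_zero, map_zero, map_zero]

variable [IsDomain R] [IsPrincipalIdealRing R] [∀ n, Module.Free R (C.X n)]
  [∀ n, Module.Free R (D.X n)]

theorem homologyToTor_injective {r : ℕ}
    (h : ∀ p : TensorIndex r, Subsingleton (C.homology p.1.1 ⊗[R] D.homology p.1.2)) :
    Function.Injective (T.homologyToTor r).hom := by
  rw [injective_iff_map_eq_zero]
  intro x hx
  obtain ⟨y, rfl⟩ := T.mem_range_tensorToHomology x hx
  have : y = 0 := ModuleCat.biproduct_ext fun p =>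
    (h p).elim _ _
  rw [this, map_zero]

end TensorDecomposition

end ChainComplex

/-! ### The splitting is not natural -/

namespace KGraph

/-- The involution of the index set for the `2`-graph of the projective plane. -/
def planePerm (v : Bool) : Equiv.Perm Bool :=
  if v then Equiv.boolNot else 1

/-- A `2`-graph of the projective plane. -/
abbrev planeGraph : KGraph 2 := squareGraph planePerm

/-- The extension of `planePerm` by a fixed index. -/
def filledPerm (v : Bool) : Equiv.Perm (Option Bool) :=
  (planePerm v).optionCongr

/-- A `2`-graph in which the cycle of order two of the projective plane is a boundary. -/
abbrev filledGraph : KGraph 2 := squareGraph filledPerm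

/-- The inclusion of the projective plane. -/
def planeIncl : planeGraph ⟶ filledGraph :=
  squareGraphMap some fun _ _ => rfl

/-- A `1`-cycle of order two. -/
noncomputable def planeCycle : planeGraph.Chain 1 :=
  Finsupp.single (leftEdge planePerm true) 1 - Finsupp.single (leftEdge planePerm false) 1

/-- A `2`-chain whose boundary is twice `planeCycle`. -/
noncomputable def planeChain : planeGraph.Chain 2 :=
  Finsupp.single (diagSquare planePerm false false) 1 -
    Finsupp.single (diagSquare planePerm false true) 1 +
    (Finsupp.single (diagSquare planePerm true false) 1 -
      Finsupp.single (diagSquare planePerm true true) 1)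

theorem boundary_planeChain : planeGraph.boundary 1 planeChain = planeCycle + planeCycle := by
  simp only [planeChain, planeCycle, map_add, map_sub, boundary_single, one_smul,
    boundary_diagSquare, planePerm, Bool.false_eq_true, if_true, if_false, Equiv.Perm.coe_one,
    id_eq, Equiv.boolNot_apply, Bool.not_true, Bool.not_false]
  abel

/-- Twice the chain is a boundary, hence a cycle, and chain groups have no torsion. -/
theorem boundary_planeCycle : planeGraph.boundary 0 planeCycle = 0 := by
  have h : planeGraph.boundary 0 (planeCycle + planeCycle) = 0 := by
    rw [← boundary_planeChain]
    exact LinearMap.congr_fun (boundary_comp_boundary planeGraph 0) _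
  rw [map_add] at h
  exact self_eq_neg.1 (eq_neg_of_add_eq_zero_left h)

/-- A map on `1`-chains whose composition with the boundary is multiplication by two. -/
noncomputable def planeRetraction : planeGraph.Chain 1 →ₗ[ℤ] planeGraph.Chain 2 :=
  let q : Bool → Bool → planeGraph.Chain 2 := fun v i =>
    Finsupp.single (diagSquare planePerm v i) 1
  let x := q false false - q false true - q true false + q true true
  -- Normalise the values on both edges into `left`, on `toRight false` and on the right edge
  -- `false` to zero. The other four values then solve the four equations given by the squares; the
  -- factor two makes them solvable over `ℤ`.
  edgeLift planePerm
    (fun i => if i then q true false - q true true - q false false - q false true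
      else -q false false - q false false)
    (fun i => if i then -x else 0) 0
    (fun v => if v then q true false + q true true - q false false - q false true else 0)

theorem planeRetraction_boundary (x : planeGraph.Chain 2) :
    planeRetraction (planeGraph.boundary 1 x) = x + x := by
  suffices e : planeRetraction ∘ₗ planeGraph.boundary 1 = LinearMap.id + LinearMap.id from
    LinearMap.congr_fun e x
  refine Finsupp.lhom_ext' fun c => LinearMap.ext_ring ?_
  change planeRetraction (planeGraph.boundary 1 (Finsupp.single c 1)) =
    Finsupp.single c 1 + Finsupp.single c 1
  obtain ⟨v, i, rfl⟩ := exists_diagSquare_eq planePerm c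
  rw [boundary_single, one_smul, planeRetraction, edgeLift_boundary]
  cases v <;> cases i <;> simp [planePerm] <;> abel

/-- Multiplication by two is injective on chains and factors through the boundary map. -/
theorem boundary_plane_injective (x : planeGraph.Chain 2) (hx : planeGraph.boundary 1 x = 0) :
    x = 0 := by
  have h := planeRetraction_boundary x
  rw [hx, map_zero] at h
  exact self_eq_neg.1 (eq_neg_of_add_eq_zero_left h.symm)

theorem exists_boundary_eq_planeIncl :
    ∃ y, filledGraph.boundary 1 y = mapChain planeIncl 1 planeCycle := by
  -- The first two squares share a right edge; their difference bounds `planeCycle` up to edges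
  -- leaving the sources. The squares of index `none`, fixed by both permutations, cancel those
  -- edges.
  refine ⟨Finsupp.single (diagSquare filledPerm false (some false)) 1 -
    Finsupp.single (diagSquare filledPerm true (some true)) 1 -
    (Finsupp.single (diagSquare filledPerm false none) 1 -
      Finsupp.single (diagSquare filledPerm true none) 1), ?_⟩
  have h : ∀ i, Hom.mapCube planeIncl (leftEdge planePerm i) = leftEdge filledPerm (some i) :=
    fun i => rfl
  have h₁ : filledPerm false (some false) = some false := rfl
  have h₂ : filledPerm true (some true) = some false := rfl
  have h₃ : filledPerm false none = none := rfl
  have h₄ : filledPerm true none = none := rfl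
  simp only [planeCycle, map_sub, boundary_single, one_smul, mapChain_single, h,
    boundary_diagSquare, h₁, h₂, h₃, h₄]
  abel

/-- A cocycle modulo two which does not vanish on `planeCycle`. -/
noncomputable def planeCocycle : planeGraph.Chain 1 →ₗ[ℤ] ZMod 2 :=
  -- Left and right edges take their index modulo two. The swap at `v = true` changes the index by
  -- one, which the value on `toRight true` compensates.
  edgeLift planePerm (fun i => if i then 1 else 0) (fun i => if i then 1 else 0) 0
    (fun v => if v then 1 else 0)

theorem planeCocycle_boundary (x : planeGraph.Chain 2) :
    planeCocycle (planeGraph.boundary 1 x) = 0 := by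
  suffices e : planeCocycle ∘ₗ planeGraph.boundary 1 = 0 from LinearMap.congr_fun e x
  refine Finsupp.lhom_ext' fun c => LinearMap.ext_ring ?_
  change planeCocycle (planeGraph.boundary 1 (Finsupp.single c 1)) = 0
  obtain ⟨v, i, rfl⟩ := exists_diagSquare_eq planePerm c
  rw [boundary_single, one_smul, planeCocycle, edgeLift_boundary]
  cases v <;> cases i <;> simp [planePerm] <;> decide

theorem planeCocycle_planeCycle : planeCocycle planeCycle = 1 := by
  have h : ∀ i, planeCocycle (Finsupp.single (leftEdge planePerm i) 1) = if i then 1 else 0 :=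
    fun i => (Finsupp.linearCombination_single _ _ _).trans (one_smul _ _)
  rw [planeCycle, map_sub, h, h]
  simp

/-- The coefficient of the square `(false, some false)`, modulo two. -/
noncomputable def squareCoeff : filledGraph.Chain 2 →ₗ[ℤ] ZMod 2 :=
  Finsupp.linearCombination ℤ fun c => SquareHom.diagValue
    (fun v i => if v = false ∧ i = some false then 1 else 0) (x := c.path.src) c.path.hom

theorem squareCoeff_planeChain : squareCoeff (mapChain planeIncl 2 planeChain) = 1 := by
  have h : ∀ v i, squareCoeff (mapChain planeIncl 2 (Finsupp.single (diagSquare planePerm v i) 1)) =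
      if v = false ∧ some i = some false then 1 else 0 := by
    intro v i
    rw [mapChain_single]
    exact (Finsupp.linearCombination_single _ _ _).trans (one_smul _ _)
  rw [planeChain]
  simp only [map_add, map_sub, h]
  simp

theorem subsingleton_chain {k r : ℕ} (Λ : KGraph k) (h : k < r) :
    Subsingleton (Λ.chainComplex.X r) :=
  have := Cube.isEmpty_of_lt Λ h
  inferInstanceAs (Subsingleton (Λ.Chain r))

theorem subsingleton_homology_planeGraph {n : ℕ} (h : 2 ≤ n) :
    Subsingleton (planeGraph.chainComplex.homology n) := by
  refine ChainComplex.subsingleton_homology _ fun x hx => ?_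
  obtain rfl | h := h.eq_or_lt
  · refine boundary_plane_injective x ?_
    rw [← chainComplex_d]
    exact hx
  · have := subsingleton_chain planeGraph h
    exact Subsingleton.elim _ _

/-- The sequence has no splitting which is natural for `planeIncl`. -/
theorem not_exists_natural_splitting :
    ¬ ∃ σ : torHomology 2 2 3 ⟶ prodHomology 2 2 3,
      σ ≫ kunnethTor 2 2 3 = 𝟙 (torHomology 2 2 3) := by
  rintro ⟨σ, hσ⟩
  have hw : (planeGraph.chainComplex.d 2 1).hom planeChain = planeCycle + planeCycle := by
    rw [chainComplex_d]
    exact boundary_planeChain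
  have hz : (planeGraph.chainComplex.d 1 0).hom planeCycle = 0 := by
    rw [chainComplex_d]
    exact boundary_planeCycle
  obtain ⟨ζ, hζ⟩ := (tensorDecomposition planeGraph planeGraph).exists_cycle_add hw hw hz hz
  obtain ⟨y, hy⟩ := exists_boundary_eq_planeIncl
  have hid : mapChain (𝟙 planeGraph) 1 planeCycle = planeCycle := Finsupp.mapDomain_id
  let φ : ((planeGraph, planeGraph) : KGraph 2 × KGraph 2) ⟶ (filledGraph, planeGraph) :=
    (planeIncl, 𝟙 planeGraph)
  let x : (prodHomology 2 2 3).obj (planeGraph, planeGraph) := homologyClass ζ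
  -- The torsion class dies in the target because `planeCycle` bounds in `filledGraph`.
  have h₁ : ((kunnethTor 2 2 3).app (filledGraph, planeGraph)).hom
      (((prodHomology 2 2 3).map φ).hom x) = 0 := by
    refine ChainComplex.TensorDecomposition.homologyToTor_homologyMap_eq_zero
      (isCompatible_chainMap planeIncl (𝟙 planeGraph)) hζ (y := y) ?_ ?_
    · rw [chainComplex_d]
      exact hy
    · exact (congrArg _ hid).trans hz
  -- In total degree `3` one factor has degree at least `2`, where the plane has no homology. So `β`
  -- is injective here, and a section of it recovers `x`.
  have h₂ : x = (σ.app (planeGraph, planeGraph)).hom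
      (((kunnethTor 2 2 3).app (planeGraph, planeGraph)).hom x) := by
    refine (tensorDecomposition planeGraph planeGraph).homologyToTor_injective (r := 3)
      (fun p => ?_) ?_
    · obtain h | h : 2 ≤ p.1.1 ∨ 2 ≤ p.1.2 := by
        have := p.2
        omega
      · have := subsingleton_homology_planeGraph h
        infer_instance
      · have := subsingleton_homology_planeGraph h
        infer_instance
    · exact (LinearMap.congr_fun (congrArg (fun t => (t.app (planeGraph, planeGraph)).hom) hσ)
        (((kunnethTor 2 2 3).app (planeGraph, planeGraph)).hom x)).symm
  -- Naturality of `σ` and `β` carries the vanishing of the torsion class over to the image of `x`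
  -- itself.
  have h₃ : ((prodHomology 2 2 3).map φ).hom x = 0 := by
    rw [h₂]
    have n₁ := LinearMap.congr_fun (congrArg ModuleCat.Hom.hom (σ.naturality φ))
      (((kunnethTor 2 2 3).app (planeGraph, planeGraph)).hom x)
    have n₂ := LinearMap.congr_fun (congrArg ModuleCat.Hom.hom
      ((kunnethTor 2 2 3).naturality φ)) x
    refine n₁.symm.trans ?_
    refine (congrArg (σ.app (filledGraph, planeGraph)).hom (n₂.symm.trans h₁)).trans ?_
    exact map_zero _
  have h₄ := ChainComplex.TensorDecomposition.tmul_eq_zero_of_homologyMap_eq_zero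
      (isCompatible_chainMap planeIncl (𝟙 planeGraph)) hζ h₃
    (subsingleton_chain filledGraph (by decide)) squareCoeff planeCocycle fun x => by
      rw [chainComplex_d]
      exact planeCocycle_boundary x
  have h₅ : TensorProduct.tmul ℤ (squareCoeff (mapChain planeIncl 2 planeChain))
      (planeCocycle (mapChain (𝟙 planeGraph) 1 planeCycle)) = 0 := h₄
  rw [hid, squareCoeff_planeChain, planeCocycle_planeCycle] at h₅
  -- Multiplication on `ZMod 2` shows that `1 ⊗ 1` is nonzero.
  have h₆ := congrArg (LinearMap.mul' ℤ (ZMod 2)) h₅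
  rw [LinearMap.mul'_apply, map_zero] at h₆
  exact absurd h₆ (by decide)

end KGraph

theorem mainTheorem2 :
    ∃ (α : ∀ k₁ k₂ r : ℕ, KGraph.tensorHomology k₁ k₂ r ⟶ KGraph.prodHomology k₁ k₂ r)
      (β : ∀ k₁ k₂ r : ℕ, KGraph.prodHomology k₁ k₂ r ⟶ KGraph.torHomology k₁ k₂ r),
      -- `α` is the homology cross product
      (∀ (k₁ k₂ r : ℕ) (Λ₁ : KGraph k₁) (Λ₂ : KGraph k₂) (p : KGraph.TensorIndex r)
        (z₁ : Λ₁.chainComplex.cycles p.1.1) (z₂ : Λ₂.chainComplex.cycles p.1.2),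
        ∃ z : (Λ₁.prod Λ₂).chainComplex.cycles r,
          KGraph.cycleChain z =
            KGraph.cross p.2 (KGraph.cycleChain z₁) (KGraph.cycleChain z₂) ∧
          ((α k₁ k₂ r).app (Λ₁, Λ₂)).hom
            ((biproduct.ι (fun q : KGraph.TensorIndex r =>
                (KGraph.homologyFunctor k₁ q.1.1).obj Λ₁ ⊗
                  (KGraph.homologyFunctor k₂ q.1.2).obj Λ₂) p).hom
              (TensorProduct.tmul ℤ (KGraph.homologyClass z₁) (KGraph.homologyClass z₂))) =
            KGraph.homologyClass z) ∧
      -- the sequence is split exact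
      (∀ (k₁ k₂ r : ℕ) (Λ₁ : KGraph k₁) (Λ₂ : KGraph k₂),
        ∃ w : (α k₁ k₂ r).app (Λ₁, Λ₂) ≫ (β k₁ k₂ r).app (Λ₁, Λ₂) = 0,
          (ShortComplex.mk _ _ w).ShortExact ∧ Nonempty (ShortComplex.mk _ _ w).Splitting) ∧
      -- the splitting is not natural
      (∃ k₁ k₂ r : ℕ, ¬ ∃ σ : KGraph.torHomology k₁ k₂ r ⟶ KGraph.prodHomology k₁ k₂ r,
        σ ≫ β k₁ k₂ r = 𝟙 (KGraph.torHomology k₁ k₂ r)) :=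
  ⟨KGraph.kunnethProduct, KGraph.kunnethTor,
    fun _ _ _ _ _ p z₁ z₂ => ⟨_, KGraph.cycleChain_cyclesProduct p.2 z₁ z₂,
      KGraph.kunnethProduct_homologyClass p z₁ z₂⟩,
    KGraph.kunneth_splitExact, ⟨2, 2, 3, KGraph.not_exists_natural_splitting⟩⟩
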